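/- **Theorem 2 (divergence of the fourth conformal fundamental form).** Let $(\widetilde M,\widetilde g_{ab})$ be a four-dimensional asymptotically de Sitter spacetime: a Lorentzian manifold of signature $(-,+,+,+)$ with $\widetilde R_{ab}-\tfrac12\widetilde R\,\widetilde g_{ab}+\Lambda\widetilde g_{ab}=\widetilde T_{ab}$, $\Lambda>0$, that admits a conformal extension, i.e. a smooth manifold $M$ with boundary $\Sigma$, a smooth Lorentzian metric $g_{ab}$ on $M$, an embedding of $\widetilde M$ onto $M\setminus\Sigma$, and a smooth function $\widetilde\sigma\ge 0$ on $M$ with $\Sigma=\widetilde\sigma^{-1}(0)$, $d\widetilde\sigma\neq0$ on $\Sigma$ and $\widetilde g_{ab}=\widetilde\sigma^{-2}g_{ab}$ on $\widetilde M$. Suppose that $\widetilde T_{ab}=\widetilde\sigma^{q}\tau_{ab}$ with $q\in\{1,2\}$ and $\tau_{ab}$ smooth on $M$ (up to $\Sigma$). Put $\lambda=\Lambda/3$, $n_a=\lambda^{-1/2}\nabla_a\widetilde\sigma$, $n^a=g^{ab}n_b$ and $\tau=g^{ab}\tau_{ab}$, where $\nabla$ is the Levi-Civita connection of $g_{ab}$.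 An index $n$ denotes contraction with $n^a$, $\top$ orthogonal projection to the annihilator of $n^a$ (to $\Sigma$), and $\overline\nabla$ the Levi-Civita connection of the induced metric of $\Sigma$. With $[\nabla_a,\nabla_b]v^c=R_{ab}{}^c{}_d v^d$, let $P_{ab}$ be the Schouten tensor, $C_{abcd}$ the Weyl tensor and $A_{abc}=\nabla_bP_{ca}-\nabla_cP_{ba}$ the Cotton tensor of $g_{ab}$, let $H$ be the trace of the second fundamental form $(\nabla_an_b)^\top$ of $\Sigma$, and let $$\mathring{\mathcal K}^{(4)}_{ab}:=\lambda\Big(\overline\nabla{}^cC^\top_{n(ab)c}-A^\top_{(a|n|b)}-\tfrac13HC_{nanb}\Big)$$ be the fourth conformal fundamental form of $\Sigma$. Then, on $\Sigma$: 1. $C_{abcd}=0$, and $\mathring{\mathcal K}^{(4)}_{ab}=-\lambda A^\top_{anb}$; 2. if $q=1$, then $\tau^\top_{an}=0$ on $\Sigma$; so near each point of $\Sigma$ there is a smooth covector field $j_a$ with $\tau^\top_{an}=\widetilde\sigma j_a+\mathcal O(\widetilde\sigma^2)$, and for every such $j_a$ (continuity is enough) $$\overline\nabla{}^b\mathring{\mathcal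 K}^{(4)}_{ab}=-\lambda^2j_a+\frac{\lambda^{3/2}}{3}\overline\nabla_a\tau ;$$ 3. if $q=2$, then $$\overline\nabla{}^b\mathring{\mathcal K}^{(4)}_{ab}=-\lambda^2\tau^\top_{an}.$$ -/

import Mathlib

open Set
open scoped Manifold ContDiff Topology

noncomputable section

namespace AdS

/-! ### Tensor calculus in a coordinate domain

Tensors are given by their components with respect to the coordinates of `ℝⁿ`, as functions on a
set `S` (an open set, or a relatively open subset of a half-space, so that all partial derivatives
are derivatives within `S`).  Conventions: `[∇_a, ∇_b] v^c = R_{ab}{}^c{}_d v^d`. -/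

/-- The coordinate space `ℝⁿ`. -/
abbrev Coord (n : ℕ) := EuclideanSpace ℝ (Fin n)

/-- The partial derivative `∂_i f` within `S`. -/
def pd {n : ℕ} (S : Set (Coord n)) (f : Coord n → ℝ) (x : Coord n) (i : Fin n) : ℝ :=
  fderivWithin ℝ f S x (EuclideanSpace.single i 1)

/-- The components `g^{ab}` of the inverse metric. -/
def ginv {n : ℕ} (g : Coord n → Fin n → Fin n → ℝ) (x : Coord n) (a b : Fin n) : ℝ :=
  (Matrix.of (g x))⁻¹ a b

/-- The Christoffel symbols `Γ^c_{ab}` of the Levi-Civita connection of `g`. -/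
def christoffel {n : ℕ} (S : Set (Coord n)) (g : Coord n → Fin n → Fin n → ℝ)
    (x : Coord n) (c a b : Fin n) : ℝ :=
  (1 / 2) * ∑ d, ginv g x c d *
    (pd S (fun y => g y b d) x a + pd S (fun y => g y a d) x b - pd S (fun y => g y a b) x d)

/-- The covariant derivative `∇_a η_b`. -/
def cov1 {n : ℕ} (S : Set (Coord n)) (g : Coord n → Fin n → Fin n → ℝ)
    (η : Coord n → Fin n → ℝ) (x : Coord n) (a b : Fin n) : ℝ :=
  pd S (fun y => η y b) x a - ∑ e, christoffel S g x e a b * η x e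

/-- The covariant derivative `∇_a t_{bc}`. -/
def cov2 {n : ℕ} (S : Set (Coord n)) (g : Coord n → Fin n → Fin n → ℝ)
    (t : Coord n → Fin n → Fin n → ℝ) (x : Coord n) (a b c : Fin n) : ℝ :=
  pd S (fun y => t y b c) x a - ∑ e, christoffel S g x e a b * t x e c
    - ∑ e, christoffel S g x e a c * t x b e

/-- The covariant derivative `∇_a t_{bcd}`. -/
def cov3 {n : ℕ} (S : Set (Coord n)) (g : Coord n → Fin n → Fin n → ℝ)
    (t : Coord n → Fin n → Fin n → Fin n → ℝ) (x : Coord n) (a b c d : Fin n) : ℝ :=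
  pd S (fun y => t y b c d) x a - ∑ e, christoffel S g x e a b * t x e c d
    - ∑ e, christoffel S g x e a c * t x b e d - ∑ e, christoffel S g x e a d * t x b c e

/-- The trace `g^{ab} t_{ab}`. -/
def trace {n : ℕ} (g t : Coord n → Fin n → Fin n → ℝ) (x : Coord n) : ℝ :=
  ∑ a, ∑ b, ginv g x a b * t x a b

/-- The Riemann tensor `R_{ab}{}^c{}_d`. -/
def riemannUp {n : ℕ} (S : Set (Coord n)) (g : Coord n → Fin n → Fin n → ℝ)
    (x : Coord n) (a b c d : Fin n) : ℝ :=
  pd S (fun y => christoffel S g y c b d) x a - pd S (fun y => christoffel S g y c a d) x b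
    + ∑ e, (christoffel S g x c a e * christoffel S g x e b d
        - christoffel S g x c b e * christoffel S g x e a d)

/-- The Riemann tensor with all indices lowered, `R_{abcd} = g_{ce} R_{ab}{}^e{}_d`. -/
def riemann {n : ℕ} (S : Set (Coord n)) (g : Coord n → Fin n → Fin n → ℝ)
    (x : Coord n) (a b c d : Fin n) : ℝ :=
  ∑ e, g x c e * riemannUp S g x a b e d

/-- The Ricci tensor `R_{bd} = R_{ab}{}^a{}_d`. -/
def ricci {n : ℕ} (S : Set (Coord n)) (g : Coord n → Fin n → Fin n → ℝ)
    (x : Coord n) (b d : Fin n) : ℝ :=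
  ∑ a, riemannUp S g x a b a d

/-- The scalar curvature. -/
def scalarCurv {n : ℕ} (S : Set (Coord n)) (g : Coord n → Fin n → Fin n → ℝ)
    (x : Coord n) : ℝ :=
  trace g (ricci S g) x

/-- The Schouten tensor `P_{ab}` (for `n ≥ 3`). -/
def schouten {n : ℕ} (S : Set (Coord n)) (g : Coord n → Fin n → Fin n → ℝ)
    (x : Coord n) (a b : Fin n) : ℝ :=
  1 / ((n : ℝ) - 2) * (ricci S g x a b - scalarCurv S g x / (2 * ((n : ℝ) - 1)) * g x a b)

/-- The Weyl tensor `C_{abcd} = R_{abcd} - 2 (g_{c[a} P_{b]d} + g_{d[b} P_{a]c})`. -/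
def weyl {n : ℕ} (S : Set (Coord n)) (g : Coord n → Fin n → Fin n → ℝ)
    (x : Coord n) (a b c d : Fin n) : ℝ :=
  riemann S g x a b c d
    - (g x c a * schouten S g x b d - g x c b * schouten S g x a d
      + g x d b * schouten S g x a c - g x d a * schouten S g x b c)

/-- The Cotton tensor `A_{abc} = ∇_b P_{ca} - ∇_c P_{ba}`. -/
def cotton {n : ℕ} (S : Set (Coord n)) (g : Coord n → Fin n → Fin n → ℝ)
    (x : Coord n) (a b c : Fin n) : ℝ :=
  cov2 S g (schouten S g) x b c a - cov2 S g (schouten S g) x c b a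

/-! ### Tensor fields on manifolds and their components in charts -/

section Manifolds

variable {n : ℕ} {H : Type*} [TopologicalSpace H] (I : ModelWithCorners ℝ (Coord n) H)
  (M : Type*) [TopologicalSpace M] [ChartedSpace H M]

/-- (Not necessarily smooth or symmetric) covariant 2-tensor fields on `M`. -/
abbrev Tensor2 := ∀ p : M, TangentSpace I p →L[ℝ] TangentSpace I p →L[ℝ] ℝ

variable {M}

/-- The coordinate vector `∂_i` of the chart `e`, at the point with coordinates `x`. -/
def coordVec (e : OpenPartialHomeomorph M H) (x : Coord n) (i : Fin n) :
    TangentSpace I ((e.extend I).symm x) :=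
  mfderivWithin 𝓘(ℝ, Coord n) I (e.extend I).symm (e.extend I).target x
    (EuclideanSpace.single i (1 : ℝ) : Coord n)

/-- The components `t_{ij} = t(∂_i, ∂_j)` of a tensor field in the chart `e`. -/
def comp (e : OpenPartialHomeomorph M H) (t : Tensor2 I M) (x : Coord n) (i j : Fin n) : ℝ :=
  t ((e.extend I).symm x) (coordVec I e x i) (coordVec I e x j)

/-- A covariant 2-tensor field is smooth (up to the boundary of `M`, if there is one) if its
components in every chart of the smooth structure are smooth. -/
def IsSmoothTensor (t : Tensor2 I M) : Prop :=
  ∀ e ∈ IsManifold.maximalAtlas I ∞ M, ∀ i j : Fin n,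
    ContDiffOn ℝ ∞ (fun x => comp I e t x i j) (e.extend I).target

end Manifolds

/-- A smooth Lorentzian metric of signature `(-,+,+,+)` on a 4-manifold. -/
structure IsLorentzMetric {H : Type*} [TopologicalSpace H] (I : ModelWithCorners ℝ (Coord 4) H)
    {M : Type*} [TopologicalSpace M] [ChartedSpace H M] (g : Tensor2 I M) : Prop where
  smooth : IsSmoothTensor I g
  symm : ∀ (p : M) (v w : TangentSpace I p), g p v w = g p w v
  signature : ∀ p : M, ∃ b : Module.Basis (Fin 4) ℝ (TangentSpace I p), ∀ i j : Fin 4,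
    g p (b i) (b j) = if i = j then (if i = 0 then -1 else 1) else 0

/-- The Einstein field equations `R_{ab} - ½ R g_{ab} + Λ g_{ab} = T_{ab}` on `M`. -/
def EinsteinEquations {n : ℕ} {H : Type*} [TopologicalSpace H] (I : ModelWithCorners ℝ (Coord n) H)
    {M : Type*} [TopologicalSpace M] [ChartedSpace H M] (Λ : ℝ) (g T : Tensor2 I M) : Prop :=
  ∀ e ∈ IsManifold.maximalAtlas I ∞ M, ∀ x ∈ (e.extend I).target, ∀ a b : Fin n,
    ricci (e.extend I).target (comp I e g) x a b
      - 1 / 2 * scalarCurv (e.extend I).target (comp I e g) x * comp I e g x a b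
      + Λ * comp I e g x a b = comp I e T x a b

/-- `(N, gN)` is a four-dimensional asymptotically de Sitter spacetime with stress-energy tensor
`TN` and positive cosmological constant `Λ`; `(M, g)` is a conformal extension of it, with embedding
`φ : N → M`, defining function `Ω` of the boundary of `M`, and `gN = Ω⁻² g`, `TN = Ω^q τ` on the
interior, where the tensor field `τ` is smooth up to the boundary. -/
structure IsConformalExtension
    {N : Type*} [TopologicalSpace N] [ChartedSpace (Coord 4) N]
    {M : Type*} [TopologicalSpace M] [ChartedSpace (EuclideanHalfSpace 4) M]
    (Λ : ℝ) (q : ℕ) (gN TN : Tensor2 (𝓡 4) N) (φ : N → M)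
    (g : Tensor2 (𝓡∂ 4) M) (Ω : M → ℝ) (τ : Tensor2 (𝓡∂ 4) M) : Prop where
  Λ_pos : 0 < Λ
  lorentz_phys : IsLorentzMetric (𝓡 4) gN
  einstein : EinsteinEquations (𝓡 4) Λ gN TN
  embedding : Manifold.IsSmoothEmbedding (𝓡 4) (𝓡∂ 4) ∞ φ
  range_embedding : range φ = ((𝓡∂ 4).boundary M)ᶜ
  lorentz : IsLorentzMetric (𝓡∂ 4) g
  smooth_Ω : ContMDiff (𝓡∂ 4) 𝓘(ℝ, ℝ) ∞ Ω
  nonneg_Ω : ∀ p, 0 ≤ Ω p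
  zero_Ω : ∀ p, Ω p = 0 ↔ p ∈ (𝓡∂ 4).boundary M
  deriv_Ω : ∀ p ∈ (𝓡∂ 4).boundary M, mfderiv (𝓡∂ 4) 𝓘(ℝ, ℝ) Ω p ≠ 0
  metric_eq : ∀ (p : N) (v w : TangentSpace (𝓡 4) p), gN p v w =
    (Ω (φ p) ^ 2)⁻¹ * g (φ p) (mfderiv (𝓡 4) (𝓡∂ 4) φ p v) (mfderiv (𝓡 4) (𝓡∂ 4) φ p w)
  smooth_τ : IsSmoothTensor (𝓡∂ 4) τ
  stress_eq : ∀ (p : N) (v w : TangentSpace (𝓡 4) p), TN p v w =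
    Ω (φ p) ^ q * τ (φ p) (mfderiv (𝓡 4) (𝓡∂ 4) φ p v) (mfderiv (𝓡 4) (𝓡∂ 4) φ p w)

/-! ### The geometry of the conformal boundary in a boundary chart

In a chart with values in the half-space `{x⁰ ≥ 0}` the boundary is `{x⁰ = 0}`, with coordinates
`z = (x¹, x², x³)`.  Below `S` is the image of the chart in the half-space, `g` the metric, `σ` the
defining function, `τ` the rescaled stress-energy tensor (all in coordinates), and `l` is `λ`.
The projection to `Σ` of a covariant tensor at a point of `Σ` is encoded by its components along
`∂_1, ∂_2, ∂_3`. -/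

section Boundary

/-- The point `(0, z)` of the half-space with boundary coordinates `z`. -/
def slice (z : Coord 3) : Coord 4 := WithLp.toLp 2 (Fin.cons (0 : ℝ) (fun i : Fin 3 => z i))

/-- The boundary coordinates `(x¹, x², x³)` of `x`. -/
def bdryCoord (x : Coord 4) : Coord 3 := WithLp.toLp 2 (fun i : Fin 3 => x i.succ)

/-- The coordinate domain of the boundary. -/
def bdryDom (S : Set (Coord 4)) : Set (Coord 3) := slice ⁻¹' S

variable (S : Set (Coord 4)) (g : Coord 4 → Fin 4 → Fin 4 → ℝ) (σ : Coord 4 → ℝ) (l : ℝ)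

/-- The induced metric of the boundary. -/
def gbar (z : Coord 3) (α β : Fin 3) : ℝ := g (slice z) α.succ β.succ

/-- The normal covector `n_a = λ^{-1/2} ∇_a σ`. -/
def nLow (x : Coord 4) (a : Fin 4) : ℝ := pd S σ x a / √l

/-- The normal vector `n^a = g^{ab} n_b`. -/
def nUp (x : Coord 4) (a : Fin 4) : ℝ := ∑ b, ginv g x a b * nLow S σ l x b

/-- The second fundamental form `K_{ab} = (∇_a n_b)^⊤`. -/
def secondFF (z : Coord 3) (α β : Fin 3) : ℝ :=
  cov1 S g (nLow S σ l) (slice z) α.succ β.succ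

/-- The mean curvature `H`, i.e. the trace of the second fundamental form. -/
def meanCurv (z : Coord 3) : ℝ := trace (gbar g) (secondFF S g σ l) z

/-- `C^⊤_{nabc}`. -/
def weylMag (z : Coord 3) (α β γ : Fin 3) : ℝ :=
  ∑ d, weyl S g (slice z) d α.succ β.succ γ.succ * nUp S g σ l (slice z) d

/-- `C_{nanb}`. -/
def weylEl (z : Coord 3) (α β : Fin 3) : ℝ :=
  ∑ c, ∑ d, weyl S g (slice z) c α.succ d β.succ
    * nUp S g σ l (slice z) c * nUp S g σ l (slice z) d

/-- `A^⊤_{anb}`. -/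
def cottonN (z : Coord 3) (α β : Fin 3) : ℝ :=
  ∑ c, cotton S g (slice z) α.succ c β.succ * nUp S g σ l (slice z) c

/-- The fourth conformal fundamental form
`K⁽⁴⁾_{ab} = λ (∇̄^c C^⊤_{n(ab)c} - A^⊤_{(a|n|b)} - ⅓ H C_{nanb})`. -/
def fourthFF (z : Coord 3) (α β : Fin 3) : ℝ :=
  l * (∑ γ, ∑ δ, ginv (gbar g) z γ δ *
        cov3 (bdryDom S) (gbar g)
          (fun y α' β' γ' => (weylMag S g σ l y α' β' γ' + weylMag S g σ l y β' α' γ') / 2)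
          z δ α β γ
      - (cottonN S g σ l z α β + cottonN S g σ l z β α) / 2
      - 1 / 3 * meanCurv S g σ l z * weylEl S g σ l z α β)

/-- The divergence `∇̄^b K⁽⁴⁾_{ab}` with respect to the Levi-Civita connection of the induced
metric. -/
def divFourthFF (z : Coord 3) (α : Fin 3) : ℝ :=
  ∑ β, ∑ γ, ginv (gbar g) z β γ *
    cov2 (bdryDom S) (gbar g) (fourthFF S g σ l) z γ α β

variable (τ : Coord 4 → Fin 4 → Fin 4 → ℝ)

/-- `τ_{an} = τ_{ab} n^b`. -/
def stressN (x : Coord 4) (a : Fin 4) : ℝ := ∑ b, τ x a b * nUp S g σ l x b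

/-- `τ^⊤_{an}`: the orthogonal projection of `τ_{an}` to the annihilator of `n^a`, on the set where
`n` is not null (a neighbourhood of the boundary, on which `n_a n^a = -1`). -/
def stressNT (x : Coord 4) (a : Fin 4) : ℝ :=
  stressN S g σ l τ x a
    - nLow S σ l x a * (∑ c, stressN S g σ l τ x c * nUp S g σ l x c)
        / (∑ c, nLow S σ l x c * nUp S g σ l x c)

/-- `j` is a covector field, continuous at the boundary point `y`, with
`τ^⊤_{an} = σ j_a + O(σ²)` near `y`. -/
def IsStressExpansion (j : Coord 4 → Fin 4 → ℝ) (y : Coord 4) : Prop :=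
  ∀ a : Fin 4, ContinuousWithinAt (fun x => j x a) S y ∧
    (fun x => stressNT S g σ l τ x a - σ x * j x a) =O[𝓝[S] y] (fun x => σ x ^ 2)

end Boundary

end AdS

end

noncomputable section

namespace AdS

/-! Write `r = q - 1`. The conformal transformation of the Ricci tensor turns the Einstein equations
of `σ⁻² g` into the almost-Einstein system `∇_a∇_bσ + σ P_ab + ρ g_ab = σ^(r+2) E_ab`, `|dσ|² + λ +
2σρ = 0`, with `E = ½(τ_ab - ⅓ τ g_ab)`. It holds for `σ > 0` and, by density, up to the boundary.
Everything else is a consequence of this system (`EinsteinScale`). The curvature identities are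
proved over a commutative ring with four commuting derivations. There "divide by σ" means that `σ`
is not a zero divisor, and "restrict to a boundary point" means applying a ring homomorphism to `ℝ`;
no limits are taken in this part.

Commuting derivatives in the Hessian equation gives the integrability condition `weylT_contract`:
the Weyl tensor contracted with `σ^a = ∇^aσ` equals `σ` times the Cotton tensor plus terms of order
`σ^(r+1)`. Three things follow from it. At `σ = 0` the contraction vanishes, and since the normal is
not null the Weyl tensor reduces to a trace-free curvature-type tensor in dimension three, which is
zero. A second contraction with `σ^a` kills the Weyl side by antisymmetry and yields the normal
contraction of the Cotton tensor (`cot_contract`). The trace kills it as well and yields the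
conservation law for `E` (`conservation`).

Because the Weyl tensor vanishes along the whole boundary, the fourth form there is `-√λ B` with
`B_bd = A_bcd σ^c`, which is symmetric and tangential at the boundary. The boundary divergence of a
tangential tensor is the ambient divergence minus its double normal part. The ambient divergence of
`B` vanishes at the boundary: the Cotton tensor is divergence-free in its first index (`div_cot`),
the boundary is umbilic, and the Cotton tensor is trace-free. What remains is the normal derivative
of `W_d = A_bcd σ^b σ^c` (`divFourthFF_eq`).

By `cot_contract`, `W` is explicit in `E` and is divisible by `σ`. For `r = 1` its normal derivative
is `2λ² E_ab σ^b` in tangential directions. For `r = 0` conservation makes `E_ab σ^b` proportional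
to `σ_a` modulo `σ`, and differentiating that relation gives `2λ² ∇^b E_ab`. Expressing `E` through
`τ`, and using for `r = 0` that `τ_ab σ^b = τ σ_a + σ ∇^b τ_ab`, gives both formulas: the
coefficient `j` is `λ^(-1/2) ∇^b τ_ab` on the boundary. -/

/-- The data of a metric and its Levi-Civita connection over a commutative ring with four commuting
derivations: components of the metric, of its inverse, and the Christoffel symbols `Γ^c_{ab}`. -/
structure MetricCalculus (R : Type*) [CommRing R] [Algebra ℝ R] where
  D : Fin 4 → Derivation ℝ R R
  D_comm : ∀ i j f, D i (D j f) = D j (D i f)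
  g : Fin 4 → Fin 4 → R
  gi : Fin 4 → Fin 4 → R
  Γ : Fin 4 → Fin 4 → Fin 4 → R
  g_symm : ∀ a b, g a b = g b a
  gi_symm : ∀ a b, gi a b = gi b a
  gi_mul_g : ∀ a b, ∑ e, gi a e * g e b = if a = b then 1 else 0
  Γ_symm : ∀ c a b, Γ c a b = Γ c b a
  D_g : ∀ a b c, D a (g b c) = ∑ e, Γ e a b * g e c + ∑ e, Γ e a c * g b e

/-! ### Riemann symmetries, Bianchi and Ricci identities over a differential ring. -/

namespace MetricCalculus

variable {R : Type*} [CommRing R] [Algebra ℝ R] (m : MetricCalculus R)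

/-- The covariant derivative `∇_a u_b`. -/
def nabla1 (u : Fin 4 → R) (a b : Fin 4) : R := m.D a (u b) - ∑ e, m.Γ e a b * u e

/-- The covariant derivative `∇_a t_{bc}`. -/
def nabla2 (t : Fin 4 → Fin 4 → R) (a b c : Fin 4) : R :=
  m.D a (t b c) - ∑ e, m.Γ e a b * t e c - ∑ e, m.Γ e a c * t b e

/-- The covariant derivative `∇_a t_{bcd}`. -/
def nabla3 (t : Fin 4 → Fin 4 → Fin 4 → R) (a b c d : Fin 4) : R :=
  m.D a (t b c d) - ∑ e, m.Γ e a b * t e c d - ∑ e, m.Γ e a c * t b e d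
    - ∑ e, m.Γ e a d * t b c e

/-- The Riemann tensor `R_{ab}{}^c{}_d`. -/
def riem (a b c d : Fin 4) : R :=
  m.D a (m.Γ c b d) - m.D b (m.Γ c a d)
    + ∑ e, (m.Γ c a e * m.Γ e b d - m.Γ c b e * m.Γ e a d)

/-- The Riemann tensor `R_{abcd}`. -/
def riemLow (a b c d : Fin 4) : R := ∑ e, m.g c e * m.riem a b e d

/-- The Ricci tensor. -/
def ric (b d : Fin 4) : R := ∑ a, m.riem a b a d

/-- The vector `g^{ab} u_b`. -/
def raise (u : Fin 4 → R) (a : Fin 4) : R := ∑ b, m.gi a b * u b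

/-- The trace `g^{ab} t_{ab}`. -/
def tr (t : Fin 4 → Fin 4 → R) : R := ∑ a, ∑ b, m.gi a b * t a b

/-- The ring is an `ℝ`-algebra, so 2 can be cancelled even though the ring is not assumed to be a
domain. -/
theorem eq_zero_of_two_mul {x : R} (h : 2 * x = 0) : x = 0 := by
  have : (2 : ℝ) • x = 0 := by rw [Algebra.smul_def, map_ofNat]; exact h
  have h2 := congrArg (fun y => (1 / 2 : ℝ) • y) this
  simpa [smul_smul] using h2

/-- Metric compatibility for the inverse: differentiate `g⁻¹ g = 1` as a matrix identity and
multiply by `g⁻¹` on the right. -/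
theorem D_gi (a b c : Fin 4) :
    m.D a (m.gi b c) = -∑ e, m.Γ b a e * m.gi e c - ∑ e, m.Γ c a e * m.gi b e := by
  let G : Matrix (Fin 4) (Fin 4) R := Matrix.of m.g
  let Gi : Matrix (Fin 4) (Fin 4) R := Matrix.of m.gi
  let Γ : Matrix (Fin 4) (Fin 4) R := Matrix.of fun c b => m.Γ c a b
  let DGi : Matrix (Fin 4) (Fin 4) R := Matrix.of fun b c => m.D a (m.gi b c)
  have h1 : Gi * G = 1 := by
    ext i j; simp [Matrix.mul_apply, G, Gi, m.gi_mul_g, Matrix.one_apply]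
  have h2 : G * Gi = 1 := mul_eq_one_comm.mp h1
  have h3 : DGi * G + Gi * (Γ.transpose * G + G * Γ) = 0 := by
    ext i j
    have h := congrArg (m.D a) (m.gi_mul_g i j)
    have h0 : m.D a (if i = j then 1 else 0) = 0 := by split_ifs <;> simp
    rw [h0] at h
    simp only [map_sum, Derivation.leibniz, smul_eq_mul, m.D_g] at h
    simp only [Matrix.add_apply, Matrix.mul_apply, Matrix.transpose_apply, Matrix.zero_apply,
      DGi, G, Gi, Γ, Matrix.of_apply, ← Finset.sum_add_distrib]
    rw [← h]
    refine Finset.sum_congr rfl fun e _ => ?_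
    rw [Finset.sum_add_distrib]
    have : ∀ x, m.Γ x a j * m.g e x = m.g e x * m.Γ x a j := fun x => mul_comm _ _
    simp only [this]
    ring
  have h4 : DGi = -(Γ * Gi) - Gi * Γ.transpose := by
    calc DGi = (DGi * G) * Gi := by rw [mul_assoc, h2, mul_one]
      _ = -(Gi * (Γ.transpose * G + G * Γ)) * Gi := by rw [eq_neg_of_add_eq_zero_left h3]
      _ = -(Gi * Γ.transpose * (G * Gi)) - (Gi * G) * Γ * Gi := by noncomm_ring
      _ = _ := by rw [h1, h2]; noncomm_ring
  have h5 := congrFun (congrFun h4 b) c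
  simp only [Matrix.sub_apply, Matrix.neg_apply, Matrix.mul_apply, Matrix.transpose_apply, DGi, Γ,
    Gi, Matrix.of_apply] at h5
  rw [h5]
  simp only [mul_comm (m.gi b _)]

theorem riem_antisymm (a b c d : Fin 4) : m.riem a b c d = -m.riem b a c d := by
  simp only [riem, Fin.sum_univ_four]; ring

theorem riem_cyclic (a b c d : Fin 4) : m.riem a b c d + m.riem b d c a + m.riem d a c b = 0 := by
  simp only [riem, Fin.sum_univ_four, m.Γ_symm _ d a, m.Γ_symm _ d b, m.Γ_symm _ b a]; ring

theorem riemLow_antisymm_left (a b c d : Fin 4) : m.riemLow a b c d = -m.riemLow b a c d := by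
  simp only [riemLow, m.riem_antisymm a b, mul_neg, Finset.sum_neg_distrib]

theorem riemLow_cyclic (a b c d : Fin 4) :
    m.riemLow a b c d + m.riemLow b d c a + m.riemLow d a c b = 0 := by
  simp only [riemLow, ← Finset.sum_add_distrib, ← mul_add, m.riem_cyclic, mul_zero,
    Finset.sum_const_zero]

/-- The commuting derivations annihilate the commutator on `g_cd`; expanding both second derivatives
by metric compatibility leaves exactly the symmetric part of the curvature in its last two indices.
-/
theorem riemLow_antisymm_right (a b c d : Fin 4) : m.riemLow a b c d = -m.riemLow a b d c := by
  have h := m.D_comm a b (m.g c d)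
  simp only [m.D_g, map_add, Derivation.leibniz, smul_eq_mul, Fin.sum_univ_four] at h
  simp only [riemLow, riem, Fin.sum_univ_four]
  simp only [m.g_symm c, m.g_symm d] at h ⊢
  linear_combination h

/-- The classical octahedron argument: a signed sum of four cyclic identities, normalised by the two
antisymmetries, is twice the desired difference. -/
theorem riemLow_pair (a b c d : Fin 4) : m.riemLow a b c d = m.riemLow c d a b := by
  have h : 2 * (m.riemLow a b c d - m.riemLow c d a b) = 0 := by
    linear_combination m.riemLow_cyclic a b c d - m.riemLow_cyclic a b d c
      - m.riemLow_cyclic b c a d + m.riemLow_cyclic a c b d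
      + m.riemLow_antisymm_right a b c d - m.riemLow_antisymm_right c d a b
      - m.riemLow_antisymm_left b d c a + m.riemLow_antisymm_right d b c a
      - m.riemLow_antisymm_right d a c b + m.riemLow_antisymm_right b c d a
      + m.riemLow_antisymm_left c a d b - m.riemLow_antisymm_right a c d b
  exact sub_eq_zero.mp (eq_zero_of_two_mul h)

/-- The covariant derivative of the Riemann tensor. -/
def nablaRiem (k i j c d : Fin 4) : R :=
  m.D k (m.riem i j c d) + ∑ e, m.Γ c k e * m.riem i j e d - ∑ e, m.Γ e k d * m.riem i j c e
    - ∑ e, m.Γ e k i * m.riem e j c d - ∑ e, m.Γ e k j * m.riem i e c d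

theorem bianchi (k i j c d : Fin 4) :
    m.nablaRiem k i j c d + m.nablaRiem i j k c d + m.nablaRiem j k i c d = 0 := by
  -- Here the connection terms acting on the two form indices are left out; by torsion-freeness they
  -- cancel in the cyclic sum, which is the content of `h1`.
  have h : m.D k (m.riem i j c d) + ∑ e, m.Γ c k e * m.riem i j e d
        - ∑ e, m.Γ e k d * m.riem i j c e
      + (m.D i (m.riem j k c d) + ∑ e, m.Γ c i e * m.riem j k e d
        - ∑ e, m.Γ e i d * m.riem j k c e)
      + (m.D j (m.riem k i c d) + ∑ e, m.Γ c j e * m.riem k i e d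
        - ∑ e, m.Γ e j d * m.riem k i c e) = 0 := by
    simp only [riem, Fin.sum_univ_four, map_add, map_sub, Derivation.leibniz, smul_eq_mul,
      m.D_comm j k, m.D_comm i k, m.D_comm j i]
    ring
  have h1 : ∀ p q r : Fin 4, ∑ e, m.Γ e p q * m.riem e r c d = -∑ e, m.Γ e q p * m.riem r e c d := by
    intro p q r
    rw [← Finset.sum_neg_distrib]
    refine Finset.sum_congr rfl fun e _ => ?_
    rw [m.riem_antisymm e r, m.Γ_symm e p q]; ring
  simp only [nablaRiem, h1]
  linear_combination h

/-- The Ricci identity for covectors; applied to `dσ` it produces the integrability condition of the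
almost-Einstein system. -/
theorem nabla1_comm (u : Fin 4 → R) (c a b : Fin 4) :
    m.nabla2 (m.nabla1 u) c a b - m.nabla2 (m.nabla1 u) a c b = -∑ d, m.riem c a d b * u d := by
  simp only [nabla1, nabla2, riem, Fin.sum_univ_four, map_add, map_sub, Derivation.leibniz,
    smul_eq_mul, m.D_comm c a, m.Γ_symm _ c a]
  ring

theorem nabla2_comm (t : Fin 4 → Fin 4 → R) (e c d b : Fin 4) :
    m.nabla3 (m.nabla2 t) e c d b - m.nabla3 (m.nabla2 t) c e d b =
      -∑ f, m.riem e c f d * t f b - ∑ f, m.riem e c f b * t d f := by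
  simp only [nabla2, nabla3, riem, Fin.sum_univ_four, map_add, map_sub, Derivation.leibniz,
    smul_eq_mul, m.D_comm e c, m.Γ_symm _ e c]
  ring

theorem D_tr (t : Fin 4 → Fin 4 → R) (a : Fin 4) : m.D a (m.tr t) = m.tr (m.nabla2 t a) := by
  simp only [tr, nabla2, Fin.sum_univ_four, map_add, Derivation.leibniz, smul_eq_mul, m.D_gi]
  ring

/-- Metric compatibility lets traces pass through the covariant derivative. -/
theorem nabla1_trace (t : Fin 4 → Fin 4 → Fin 4 → R) (c d : Fin 4) :
    m.nabla1 (fun d => m.tr fun e b => t e d b) c d = m.tr fun e b => m.nabla3 t c e d b := by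
  simp only [tr, nabla1, nabla3, Fin.sum_univ_four, map_add, Derivation.leibniz, smul_eq_mul,
    m.D_gi]
  ring

theorem D_raise (u : Fin 4 → R) (a b : Fin 4) :
    m.D a (m.raise u b) = ∑ e, m.gi b e * m.nabla1 u a e - ∑ e, m.Γ b a e * m.raise u e := by
  simp only [raise, nabla1, Fin.sum_univ_four, map_add, Derivation.leibniz, smul_eq_mul, m.D_gi]
  ring

end MetricCalculus

/-! ### Traces, contracted Bianchi identities, and the Schouten and Cotton tensors. -/

namespace MetricCalculus

variable {R : Type*} [CommRing R] [Algebra ℝ R] (m : MetricCalculus R)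

theorem g_mul_gi (a b : Fin 4) : ∑ e, m.g a e * m.gi e b = if a = b then 1 else 0 := by
  have h1 : Matrix.of m.gi * Matrix.of m.g = 1 := by
    ext i j; simp [Matrix.mul_apply, m.gi_mul_g, Matrix.one_apply]
  have h2 := congrFun (congrFun ((mul_eq_one_comm (a := Matrix.of m.gi)).mp h1) a) b
  simpa [Matrix.mul_apply, Matrix.one_apply] using h2

theorem riem_eq_gi_mul_riemLow (a b c d : Fin 4) :
    m.riem a b c d = ∑ e, m.gi c e * m.riemLow a b e d := by
  simp only [riemLow, Finset.mul_sum]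
  rw [Finset.sum_comm]
  simp only [← mul_assoc, ← Finset.sum_mul, m.gi_mul_g]
  simp

theorem ric_eq_tr (b d : Fin 4) : m.ric b d = m.tr fun a e => m.riemLow a b e d := by
  simp only [ric, tr, riem_eq_gi_mul_riemLow]

theorem tr_swap (t : Fin 4 → Fin 4 → R) : (m.tr fun a b => t b a) = m.tr t := by
  unfold tr
  rw [Finset.sum_comm]
  simp only [m.gi_symm]

theorem ric_symm (b d : Fin 4) : m.ric b d = m.ric d b := by
  rw [ric_eq_tr, ric_eq_tr, ← m.tr_swap]
  simp only [m.riemLow_pair _ b]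

/-- The contraction `g^{jd} R_{jk}{}^c{}_d = -R_k{}^c`. -/
theorem tr_riem (c k : Fin 4) :
    (m.tr fun j d => m.riem j k c d) = -∑ e, m.gi c e * m.ric k e := by
  have h : ∀ e, m.ric k e = -m.tr fun j d => m.riemLow j k e d := by
    intro e
    rw [ric_eq_tr]
    simp only [tr, m.riemLow_antisymm_right _ k _ e, mul_neg, Finset.sum_neg_distrib]
  simp only [riem_eq_gi_mul_riemLow, h, tr, Fin.sum_univ_four]
  ring

/-- The Cotton tensor `A_{abc} = ∇_b P_{ca} - ∇_c P_{ba}` of the tensor `P`. -/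
def cot (P : Fin 4 → Fin 4 → R) (a b c : Fin 4) : R := m.nabla2 P b c a - m.nabla2 P c b a

theorem nabla2_g (a b c : Fin 4) : m.nabla2 m.g a b c = 0 := by
  simp only [nabla2, m.D_g]; ring

theorem nabla2_add (s t : Fin 4 → Fin 4 → R) (a b c : Fin 4) :
    m.nabla2 (fun b c => s b c + t b c) a b c = m.nabla2 s a b c + m.nabla2 t a b c := by
  simp only [nabla2, Fin.sum_univ_four, map_add]; ring

theorem nabla2_mul (f : R) (t : Fin 4 → Fin 4 → R) (a b c : Fin 4) :
    m.nabla2 (fun b c => f * t b c) a b c = f * m.nabla2 t a b c + m.D a f * t b c := by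
  simp only [nabla2, Fin.sum_univ_four, Derivation.leibniz, smul_eq_mul]; ring

theorem tr_add (s t : Fin 4 → Fin 4 → R) : (m.tr fun a b => s a b + t a b) = m.tr s + m.tr t := by
  simp only [tr, mul_add, Finset.sum_add_distrib]

theorem tr_sub (s t : Fin 4 → Fin 4 → R) : (m.tr fun a b => s a b - t a b) = m.tr s - m.tr t := by
  simp only [tr, mul_sub, Finset.sum_sub_distrib]

theorem tr_neg (t : Fin 4 → Fin 4 → R) : (m.tr fun a b => -t a b) = -m.tr t := by
  simp only [tr, mul_neg, Finset.sum_neg_distrib]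

theorem tr_mul (f : R) (t : Fin 4 → Fin 4 → R) : (m.tr fun a b => f * t a b) = f * m.tr t := by
  simp only [tr, Finset.mul_sum, mul_left_comm]

theorem tr_mul_g (u : Fin 4 → R) (c : Fin 4) : (m.tr fun a b => u a * m.g c b) = u c := by
  have : ∀ a, ∑ b, m.gi a b * (u a * m.g c b) = u a * if a = c then 1 else 0 := by
    intro a
    rw [← m.gi_mul_g, Finset.mul_sum]
    exact Finset.sum_congr rfl fun b _ => by rw [m.g_symm c]; ring
  simp [tr, this]

theorem tr_g : m.tr m.g = 4 := by
  have : ∀ a, ∑ b, m.gi a b * m.g a b = 1 := by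
    intro a
    simp only [m.g_symm a, m.gi_mul_g, if_true]
  simp [tr, this]

/-- The second Bianchi identity with the upper index contracted against one of the three cyclic
ones; the trace of the Riemann tensor commutes with `∇` because Kronecker deltas are parallel. -/
theorem nabla2_ric_of_bianchi (k j d : Fin 4) :
    m.nabla2 m.ric k j d - m.nabla2 m.ric j k d + ∑ c, m.nablaRiem c j k c d = 0 := by
  have h : ∑ c, (m.nablaRiem k c j c d + m.nablaRiem c j k c d + m.nablaRiem j k c c d) = 0 :=
    Finset.sum_eq_zero fun c _ => m.bianchi k c j c d
  rw [Finset.sum_add_distrib, Finset.sum_add_distrib] at h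
  have h1 : ∑ c, m.nablaRiem k c j c d = m.nabla2 m.ric k j d := by
    simp only [nablaRiem, nabla2, ric, Fin.sum_univ_four, map_add]; ring
  have h2 : ∑ c, m.nablaRiem j k c c d = -∑ c, m.nablaRiem j c k c d := by
    rw [← Finset.sum_neg_distrib]
    refine Finset.sum_congr rfl fun c _ => ?_
    simp only [nablaRiem, m.riem_antisymm k, map_neg, mul_neg, Finset.sum_neg_distrib,
      m.riem_antisymm _ c]
    simp only [m.riem_antisymm c, mul_neg, Finset.sum_neg_distrib]
    ring
  have h3 : ∑ c, m.nablaRiem j c k c d = m.nabla2 m.ric j k d := by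
    simp only [nablaRiem, nabla2, ric, Fin.sum_univ_four, map_add]; ring
  rw [h1, h2, h3] at h
  linear_combination h

theorem tr_nablaRiem (c c' k : Fin 4) :
    (m.tr fun j d => m.nablaRiem c j k c' d) = -∑ e, m.gi c' e * m.nabla2 m.ric c k e := by
  have h : (m.tr fun j d => m.nablaRiem c j k c' d) =
      m.D c (m.tr fun j d => m.riem j k c' d) + ∑ e, m.Γ c' c e * (m.tr fun j d => m.riem j k e d)
        - ∑ e, m.Γ e c k * (m.tr fun j d => m.riem j e c' d) := by
    simp only [nablaRiem, tr, Fin.sum_univ_four, map_add, Derivation.leibniz, smul_eq_mul, m.D_gi]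
    ring
  rw [h]
  simp only [tr_riem, nabla2, Fin.sum_univ_four, map_add, map_neg, Derivation.leibniz, smul_eq_mul,
    m.D_gi]
  ring

/-- The second contraction of the Bianchi identity: the divergence of the Riemann tensor contributes
another copy of the divergence of Ricci, whence the factor 2. -/
theorem D_scal (k : Fin 4) : m.D k (m.tr m.ric) = 2 * m.tr fun j d => m.nabla2 m.ric j k d := by
  have h : (m.tr fun j d => m.nabla2 m.ric k j d - m.nabla2 m.ric j k d
      + ∑ c, m.nablaRiem c j k c d) = 0 := by
    simp only [nabla2_ric_of_bianchi]; simp [tr]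
  have h1 : (m.tr fun j d => ∑ c, m.nablaRiem c j k c d)
      = ∑ c, m.tr fun j d => m.nablaRiem c j k c d := by
    simp only [tr, Fin.sum_univ_four]; ring
  have h2 : ∑ c, m.tr (fun j d => m.nablaRiem c j k c d)
      = -m.tr fun j d => m.nabla2 m.ric j k d := by
    simp only [tr_nablaRiem, Finset.sum_neg_distrib]; rfl
  rw [tr_add, tr_sub, h1, h2, ← D_tr] at h
  linear_combination h

theorem schouten_symm {P : Fin 4 → Fin 4 → R}
    (hP : ∀ a b, m.ric a b = 2 * P a b + m.tr P * m.g a b) (a b : Fin 4) : P a b = P b a := by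
  have h : 2 * (P a b - P b a) = 0 := by
    linear_combination m.ric_symm a b - hP a b + hP b a - m.tr P * m.g_symm a b
  exact sub_eq_zero.mp (eq_zero_of_two_mul h)

/-- With `J = tr P` the scalar curvature is `6J`, so the twice contracted Bianchi identity reads
`6∇J = 2(2 div P + ∇J)`. -/
theorem div_schouten {P : Fin 4 → Fin 4 → R}
    (hP : ∀ a b, m.ric a b = 2 * P a b + m.tr P * m.g a b) (c : Fin 4) : (m.tr fun a b => m.nabla2 P a c b) = m.D c (m.tr P) := by
  have hr : m.ric = fun a b => 2 * P a b + m.tr P * m.g a b := by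
    funext a b; exact hP a b
  have h := m.D_scal c
  have h1 : m.tr (fun a b => 2 * P a b + m.tr P * m.g a b) = 6 * m.tr P := by
    rw [tr_add, tr_mul, tr_mul, tr_g]; ring
  have h2 : ∀ a b d, m.nabla2 (fun a b => 2 * P a b + m.tr P * m.g a b) a b d
      = 2 * m.nabla2 P a b d + m.D a (m.tr P) * m.g b d := by
    intro a b d
    rw [nabla2_add, nabla2_mul, nabla2_mul, nabla2_g]
    have : m.D a (2 : R) = 0 := by
      simpa using (m.D a).map_natCast 2
    rw [this]; ring
  have h3 : m.D c (6 : R) = 0 := by simpa using (m.D c).map_natCast 6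
  rw [hr, h1, Derivation.leibniz, h3] at h
  simp only [h2, tr_add, tr_mul, tr_mul_g, smul_eq_mul] at h
  have h4 : 2 * (2 * ((m.tr fun a b => m.nabla2 P a c b) - m.D c (m.tr P))) = 0 := by
    linear_combination -h
  exact sub_eq_zero.mp (eq_zero_of_two_mul (eq_zero_of_two_mul h4))

theorem nabla2_schouten_symm {P : Fin 4 → Fin 4 → R}
    (hP : ∀ a b, m.ric a b = 2 * P a b + m.tr P * m.g a b) (a b c : Fin 4) : m.nabla2 P a b c = m.nabla2 P a c b := by
  simp only [nabla2, m.schouten_symm hP b c]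
  simp only [m.schouten_symm hP _ c, m.schouten_symm hP b]
  ring

/-- The two terms of the trace are `∇J` and `div P`, equal by `div_schouten`; the other traces of
the Cotton tensor follow by antisymmetry. -/
theorem tr_cot {P : Fin 4 → Fin 4 → R}
    (hP : ∀ a b, m.ric a b = 2 * P a b + m.tr P * m.g a b) (c : Fin 4) : (m.tr fun a b => m.cot P a b c) = 0 := by
  simp only [cot, tr_sub]
  rw [← m.tr_swap, m.div_schouten hP, m.D_tr, ← m.tr_swap (m.nabla2 P c)]
  ring

theorem cot_antisymm (P : Fin 4 → Fin 4 → R) (a b c : Fin 4) : m.cot P a b c = -m.cot P a c b := by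
  simp only [cot]; ring

end MetricCalculus

/-! ### The divergence of the Cotton tensor. -/

namespace MetricCalculus

variable {R : Type*} [CommRing R] [Algebra ℝ R] (m : MetricCalculus R)

/-- Raising both indices of `P` gives a symmetric matrix `Q`, and pair symmetry of the Riemann
tensor then exchanges `c` and `d`. -/
theorem tr_sum_riem_symm {P : Fin 4 → Fin 4 → R} (hs : ∀ a b, P a b = P b a) (c d : Fin 4) :
    (m.tr fun e b => ∑ f, m.riem e c f d * P f b) = m.tr fun e b => ∑ f, m.riem e d f c * P f b := by
  let Q : Fin 4 → Fin 4 → R := fun e h => ∑ b, ∑ f, m.gi e b * m.gi f h * P f b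
  have hQ : ∀ e h, Q e h = Q h e := by
    intro e h
    simp only [Q]
    rw [Finset.sum_comm]
    refine Finset.sum_congr rfl fun b _ => Finset.sum_congr rfl fun f _ => ?_
    rw [hs, m.gi_symm e f, m.gi_symm b h]; ring
  have h : ∀ c d, (m.tr fun e b => ∑ f, m.riem e c f d * P f b)
      = ∑ e, ∑ h, Q e h * m.riemLow e c h d := by
    intro c d
    simp only [tr, Q, riem_eq_gi_mul_riemLow, Finset.mul_sum, Finset.sum_mul]
    refine Finset.sum_congr rfl fun e _ => ?_
    simp only [Fin.sum_univ_four]; ring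
  rw [h, h, Finset.sum_comm]
  refine Finset.sum_congr rfl fun e _ => Finset.sum_congr rfl fun f _ => ?_
  rw [hQ, m.riemLow_pair]

theorem tr_sum_riem_mul {P : Fin 4 → Fin 4 → R}
    (hP : ∀ a b, m.ric a b = 2 * P a b + m.tr P * m.g a b) (c d : Fin 4) :
    (m.tr fun e b => ∑ f, m.riem e c f b * P d f)
      = -(2 * (m.tr fun f h => P d f * P c h) + m.tr P * P d c) := by
  have h : (m.tr fun e b => ∑ f, m.riem e c f b * P d f)
      = ∑ f, P d f * m.tr fun e b => m.riem e c f b := by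
    simp only [tr, Fin.sum_univ_four]; ring
  have h2 : m.tr (fun f h => P d f * (2 * P c h + m.tr P * m.g c h))
      = 2 * (m.tr fun f h => P d f * P c h) + m.tr P * P d c := by
    rw [← m.tr_mul_g (P d) c, ← m.tr_mul, ← m.tr_mul, ← m.tr_add]
    exact congrArg m.tr (by funext a b; ring)
  rw [h, ← h2]
  simp only [tr_riem, hP]
  generalize m.tr P = J
  simp only [tr, Fin.sum_univ_four]; ring

/-- The Cotton tensor is divergence-free in its first index. -/
theorem div_cot {P : Fin 4 → Fin 4 → R}
    (hP : ∀ a b, m.ric a b = 2 * P a b + m.tr P * m.g a b) (c d : Fin 4) :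
    (m.tr fun e b => m.nabla3 (m.cot P) e b c d) = 0 := by
  have hs := m.schouten_symm hP
  have h1 : ∀ e b c d, m.nabla3 (m.cot P) e b c d
      = m.nabla3 (m.nabla2 P) e c d b - m.nabla3 (m.nabla2 P) e d c b := by
    intro e b c d
    simp only [nabla3, cot, map_sub, Fin.sum_univ_four]; ring
  -- Move the divergence past `∇_c`: what appears is the Hessian of `tr P` and two curvature terms.
  -- Each of the three is symmetric in `c, d`, so the antisymmetrisation defining the Cotton tensor
  -- kills all of them.
  have h2 : ∀ c d, (m.tr fun e b => m.nabla3 (m.nabla2 P) e c d b)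
      = m.nabla1 (fun d => m.D d (m.tr P)) c d
        - (m.tr fun e b => ∑ f, m.riem e c f d * P f b)
        - (m.tr fun e b => ∑ f, m.riem e c f b * P d f) := by
    intro c d
    have : ∀ e b, m.nabla3 (m.nabla2 P) e c d b = m.nabla3 (m.nabla2 P) c e d b
        - (∑ f, m.riem e c f d * P f b) - ∑ f, m.riem e c f b * P d f := by
      intro e b
      linear_combination m.nabla2_comm P e c d b
    simp only [this, tr_sub]
    rw [← m.nabla1_trace]
    simp only [m.div_schouten hP]
  have h3 : m.nabla1 (fun d => m.D d (m.tr P)) c d = m.nabla1 (fun d => m.D d (m.tr P)) d c := by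
    simp only [nabla1, m.D_comm c d, m.Γ_symm _ c d]
  have h4 : (m.tr fun f h => P d f * P c h) = m.tr fun f h => P c f * P d h := by
    rw [← m.tr_swap]; exact congrArg m.tr (by funext a b; ring)
  simp only [h1, tr_sub]
  rw [h2, h2, h3, m.tr_sum_riem_symm hs, m.tr_sum_riem_mul hP, m.tr_sum_riem_mul hP, h4, hs c d]
  ring

end MetricCalculus

/-! ### The Weyl tensor, contraction rules, and the almost-Einstein system. -/

namespace MetricCalculus

variable {R : Type*} [CommRing R] [Algebra ℝ R] (m : MetricCalculus R)

/-- The Weyl tensor formed with a Schouten tensor `P`. -/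
def weylT (P : Fin 4 → Fin 4 → R) (a b c d : Fin 4) : R :=
  m.riemLow a b c d - (m.g c a * P b d - m.g c b * P a d + m.g d b * P a c - m.g d a * P b c)

theorem weylT_antisymm_left (P : Fin 4 → Fin 4 → R) (a b c d : Fin 4) :
    m.weylT P a b c d = -m.weylT P b a c d := by
  simp only [weylT]; linear_combination m.riemLow_antisymm_left a b c d

theorem weylT_antisymm_right (P : Fin 4 → Fin 4 → R) (a b c d : Fin 4) :
    m.weylT P a b c d = -m.weylT P a b d c := by
  simp only [weylT]; linear_combination m.riemLow_antisymm_right a b c d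

theorem weylT_pair {P : Fin 4 → Fin 4 → R} (hs : ∀ a b, P a b = P b a) (a b c d : Fin 4) :
    m.weylT P a b c d = m.weylT P c d a b := by
  simp only [weylT, m.g_symm a, m.g_symm b, hs a, hs b]
  linear_combination m.riemLow_pair a b c d

/-- The four Kulkarni-Nomizu terms contribute `4P - P + (tr P) g - P = 2P + (tr P) g`, which is the
Ricci tensor by the definition of `P` in dimension four. -/
theorem tr_weylT {P : Fin 4 → Fin 4 → R}
    (hP : ∀ a b, m.ric a b = 2 * P a b + m.tr P * m.g a b) (b d : Fin 4) :
    (m.tr fun a c => m.weylT P a b c d) = 0 := by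
  have hs := m.schouten_symm hP
  have h1 : (m.tr fun a c => m.g c a * P b d) = 4 * P b d := by
    rw [← m.tr_g, ← m.tr_swap, mul_comm, ← m.tr_mul]
    exact congrArg m.tr (by funext a b; ring)
  have h2 : (m.tr fun a c => m.g c b * P a d) = P b d := by
    rw [← m.tr_mul_g (fun a => P a d) b]
    exact congrArg m.tr (by funext a c; rw [m.g_symm c]; ring)
  have h3 : (m.tr fun a c => m.g d b * P a c) = m.g b d * m.tr P := by
    rw [m.tr_mul, m.g_symm]
  have h4 : (m.tr fun a c => m.g d a * P b c) = P b d := by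
    rw [← m.tr_mul_g (P b) d, ← m.tr_swap]
    exact congrArg m.tr (by funext a c; ring)
  have h5 : (m.tr fun a c => m.weylT P a b c d) = (m.tr fun a c => m.riemLow a b c d)
      - ((m.tr fun a c => m.g c a * P b d) - (m.tr fun a c => m.g c b * P a d)
        + (m.tr fun a c => m.g d b * P a c) - (m.tr fun a c => m.g d a * P b c)) := by
    simp only [weylT, tr_sub, tr_add]
  rw [h5, ← ric_eq_tr, h1, h2, h3, h4, hP]
  ring

theorem cot_cyclic {P : Fin 4 → Fin 4 → R}
    (hP : ∀ a b, m.ric a b = 2 * P a b + m.tr P * m.g a b) (a b c : Fin 4) :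
    m.cot P a b c + m.cot P b c a + m.cot P c a b = 0 := by
  simp only [cot, m.nabla2_schouten_symm hP a b c, m.nabla2_schouten_symm hP b a c,
    m.nabla2_schouten_symm hP c a b]
  ring

theorem g_mul_raise (u : Fin 4 → R) (a : Fin 4) : ∑ b, m.g a b * m.raise u b = u a := by
  simp only [raise, Finset.mul_sum]
  rw [Finset.sum_comm]
  simp only [← mul_assoc, ← Finset.sum_mul, m.g_mul_gi]
  simp

theorem D_inner (v w : Fin 4 → R) (a : Fin 4) :
    m.D a (∑ b, v b * m.raise w b)
      = ∑ b, m.nabla1 v a b * m.raise w b + ∑ b, m.nabla1 w a b * m.raise v b := by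
  have h : ∑ b, m.nabla1 w a b * m.raise v b = ∑ e, ∑ b, m.gi b e * m.nabla1 w a e * v b := by
    simp only [raise, Finset.mul_sum]
    refine Finset.sum_congr rfl fun e _ => Finset.sum_congr rfl fun b _ => ?_
    rw [m.gi_symm]; ring
  rw [h]
  simp only [map_sum, Derivation.leibniz, smul_eq_mul, D_raise, nabla1]
  simp only [Fin.sum_univ_four]
  ring

theorem nabla1_contract (t : Fin 4 → Fin 4 → R) (v : Fin 4 → R) (c a : Fin 4) :
    m.nabla1 (fun a => ∑ b, t a b * m.raise v b) c a
      = ∑ b, m.nabla2 t c a b * m.raise v b + ∑ b, t a b * m.raise (m.nabla1 v c) b := by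
  have h : ∀ b, m.D c (m.raise v b)
      = m.raise (m.nabla1 v c) b - ∑ e, m.Γ b c e * m.raise v e := by
    intro b; rw [D_raise]; rfl
  simp only [nabla1, nabla2, map_sum, Derivation.leibniz, smul_eq_mul] at h ⊢
  simp only [h]
  simp only [Fin.sum_univ_four]
  ring

theorem nabla2_contract (t : Fin 4 → Fin 4 → Fin 4 → R) (v : Fin 4 → R) (e b d : Fin 4) :
    m.nabla2 (fun b d => ∑ c, t b c d * m.raise v c) e b d
      = ∑ c, m.nabla3 t e b c d * m.raise v c + ∑ c, t b c d * m.raise (m.nabla1 v e) c := by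
  have h : ∀ b, m.D e (m.raise v b)
      = m.raise (m.nabla1 v e) b - ∑ f, m.Γ b e f * m.raise v f := by
    intro b; rw [D_raise]; rfl
  simp only [nabla2, nabla3, map_sum, Derivation.leibniz, smul_eq_mul, h]
  simp only [Fin.sum_univ_four]
  ring

/-- A solution of the almost-Einstein equations `∇_a∇_bσ + σ P_ab + ρ g_ab = σ^{r+2} E_ab`,
`|dσ|² + λ + 2σρ = 0` with a defining function `σ` which is not a zero divisor. -/
structure EinsteinScale where
  σ : R
  ρ : R
  lam : R
  P : Fin 4 → Fin 4 → R
  E : Fin 4 → Fin 4 → R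
  r : ℕ
  regular : ∀ f, σ * f = 0 → f = 0
  D_lam : ∀ a, m.D a lam = 0
  schouten : ∀ a b, m.ric a b = 2 * P a b + m.tr P * m.g a b
  hessian : ∀ a b, m.nabla1 (fun a => m.D a σ) a b + σ * P a b + ρ * m.g a b
    = σ ^ (r + 2) * E a b
  norm : ∑ a, m.D a σ * m.raise (fun a => m.D a σ) a + lam + 2 * σ * ρ = 0

namespace EinsteinScale

variable {m} (s : m.EinsteinScale)

/-- The gradient covector `σ_a`. -/
def u (a : Fin 4) : R := m.D a s.σ

/-- The gradient vector `σ^a`. -/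
def U : Fin 4 → R := m.raise s.u

/-- The squared norm of the gradient. -/
def nn : R := ∑ a, s.u a * s.U a

/-- `E_{ab} σ^b`. -/
def EU (a : Fin 4) : R := ∑ b, s.E a b * s.U b

theorem pow_regular (k : ℕ) (f : R) (h : s.σ ^ k * f = 0) : f = 0 := by
  induction k with
  | zero => simpa using h
  | succ k ih => exact ih (s.regular _ (by rw [← h]; ring))

theorem hess (a b : Fin 4) :
    m.nabla1 s.u a b = s.σ ^ (s.r + 2) * s.E a b + (-(s.σ * s.P a b) + -(s.ρ * m.g a b)) := by
  have := s.hessian a b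
  change m.nabla1 s.u a b + _ + _ = _ at this
  linear_combination this

theorem P_symm (a b : Fin 4) : s.P a b = s.P b a := m.schouten_symm s.schouten a b

/-- The Hessian, `P` and `g` are symmetric, so the antisymmetric part of `E` is annihilated by a
power of the regular element `σ`. -/
theorem E_symm (a b : Fin 4) : s.E a b = s.E b a := by
  have h : m.nabla1 s.u a b = m.nabla1 s.u b a := by
    simp only [nabla1, u, m.D_comm a b, m.Γ_symm _ a b]
  rw [hess, hess, s.P_symm a b, m.g_symm a b] at h
  refine sub_eq_zero.mp (s.pow_regular (s.r + 2) _ ?_)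
  linear_combination h

theorem norm_eq : s.nn = -s.lam - 2 * s.σ * s.ρ := by
  have h := s.norm
  change s.nn + _ + _ = 0 at h
  linear_combination h

theorem g_mul_U (a : Fin 4) : ∑ b, m.g a b * s.U b = s.u a := m.g_mul_raise s.u a

/-- Differentiate the norm equation and insert the Hessian equation: the terms in `ρ σ_a` cancel,
and the remainder is divisible by `2σ`. This closes the system, so that `ρ` can be eliminated after
one more derivative. -/
theorem D_ρ (a : Fin 4) :
    m.D a s.ρ = ∑ b, s.P a b * s.U b - s.σ ^ (s.r + 1) * s.EU a := by
  have h := congrArg (m.D a) s.norm_eq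
  have h2 : m.D a (2 : R) = 0 := by simpa using (m.D a).map_natCast 2
  rw [nn, U, D_inner] at h
  have h3 : ∑ b, m.nabla1 s.u a b * m.raise s.u b
      = s.σ ^ (s.r + 2) * s.EU a - s.σ * ∑ b, s.P a b * s.U b - s.ρ * s.u a := by
    rw [← s.g_mul_U a]
    simp only [hess, EU, U, Fin.sum_univ_four]
    ring
  rw [h3] at h
  simp only [map_sub, map_neg, Derivation.leibniz, s.D_lam, h2, smul_eq_mul] at h
  change _ = -0 - (2 * s.σ * m.D a s.ρ + s.ρ * (2 * s.u a + _)) at h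
  have h4 : 2 * (s.σ * (m.D a s.ρ - (∑ b, s.P a b * s.U b - s.σ ^ (s.r + 1) * s.EU a))) = 0 := by
    linear_combination h
  exact sub_eq_zero.mp (s.regular _ (eq_zero_of_two_mul h4))

theorem D_pow (k : ℕ) (c : Fin 4) :
    m.D c (s.σ ^ (k + 1)) = (k + 1 : R) * s.σ ^ k * s.u c := by
  rw [Derivation.leibniz_pow]
  simp [u, nsmul_eq_mul, mul_assoc]

/-- The antisymmetrised covariant derivative of the tensor `E`. -/
def curlE (c a b : Fin 4) : R := m.nabla2 s.E c a b - m.nabla2 s.E a c b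

/-- The integrability condition of the almost-Einstein equations. -/
theorem weylT_contract (c a b : Fin 4) :
    ∑ d, m.weylT s.P c a d b * s.U d = s.σ * m.cot s.P b c a
      - s.σ ^ (s.r + 1) * ((s.r + 2) * (s.u c * s.E a b - s.u a * s.E c b)
        + s.EU c * m.g a b - s.EU a * m.g c b) - s.σ ^ (s.r + 2) * s.curlE c a b := by
  have hn : m.nabla1 s.u = fun a b =>
      s.σ ^ (s.r + 2) * s.E a b + (-s.σ * s.P a b + -s.ρ * m.g a b) := by
    funext a b; rw [hess]; ring
  -- Differentiating the Hessian equation once; antisymmetrising in `c, a` turns the left side into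
  -- curvature and `∇P` into the Cotton tensor, while `D_ρ` supplies the Schouten terms that
  -- complete Riemann to Weyl.
  have hD : ∀ c a b, m.nabla2 (m.nabla1 s.u) c a b
      = s.σ ^ (s.r + 2) * m.nabla2 s.E c a b
        + (s.r + 2) * s.σ ^ (s.r + 1) * s.u c * s.E a b
        - s.σ * m.nabla2 s.P c a b - s.u c * s.P a b - m.D c s.ρ * m.g a b := by
    intro c a b
    rw [hn, nabla2_add, nabla2_add, nabla2_mul, nabla2_mul, nabla2_mul, nabla2_g, D_pow, map_neg,
      map_neg]
    push_cast
    change _ + (_ + -s.u c * _ + _) = _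
    ring
  have h := m.nabla1_comm s.u c a b
  rw [hD, hD, D_ρ, D_ρ] at h
  have h1 : ∑ d, m.riemLow c a d b * s.U d = ∑ d, m.riem c a d b * s.u d := by
    simp only [riemLow, ← s.g_mul_U, Finset.mul_sum, Finset.sum_mul]
    rw [Finset.sum_comm]
    refine Finset.sum_congr rfl fun d _ => Finset.sum_congr rfl fun e _ => ?_
    rw [m.g_symm e d]; ring
  have h2 : ∑ d, m.weylT s.P c a d b * s.U d = ∑ d, m.riemLow c a d b * s.U d
      - (s.u c * s.P a b - s.u a * s.P c b + m.g b a * ∑ d, s.P c d * s.U d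
        - m.g b c * ∑ d, s.P a d * s.U d) := by
    rw [← s.g_mul_U c, ← s.g_mul_U a]
    simp only [weylT, m.g_symm _ c, m.g_symm _ a, Fin.sum_univ_four]
    ring
  rw [h2, h1, m.g_symm b a, m.g_symm b c]
  simp only [cot, curlE]
  linear_combination h

/-- Contracting `weylT_contract` with a second gradient makes the Weyl side vanish by antisymmetry;
one factor `σ` is then cancelled. The metric terms in `weylT_contract` lower the coefficient from `r
+ 2` to `r + 1`. -/
theorem cot_contract (c a : Fin 4) :
    ∑ b, m.cot s.P b c a * s.U b = (s.r + 1) * s.σ ^ s.r * (s.u c * s.EU a - s.u a * s.EU c)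
      + s.σ ^ (s.r + 1) * ∑ b, s.curlE c a b * s.U b := by
  have h0 : ∑ b, ∑ d, m.weylT s.P c a d b * s.U d * s.U b = 0 := by
    have h : ∑ b, ∑ d, m.weylT s.P c a d b * s.U d * s.U b
        = -∑ b, ∑ d, m.weylT s.P c a d b * s.U d * s.U b := by
      conv_rhs => rw [Finset.sum_comm]
      simp only [← Finset.sum_neg_distrib]
      refine Finset.sum_congr rfl fun b _ => Finset.sum_congr rfl fun d _ => ?_
      rw [m.weylT_antisymm_right]; ring
    exact eq_zero_of_two_mul (by linear_combination h)
  simp only [← Finset.sum_mul, weylT_contract] at h0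
  have h1 : ∑ b, (s.σ * m.cot s.P b c a
      - s.σ ^ (s.r + 1) * ((s.r + 2) * (s.u c * s.E a b - s.u a * s.E c b)
        + s.EU c * m.g a b - s.EU a * m.g c b) - s.σ ^ (s.r + 2) * s.curlE c a b) * s.U b
      = s.σ * ∑ b, m.cot s.P b c a * s.U b
      - s.σ ^ (s.r + 1) * ((s.r + 2) * (s.u c * s.EU a - s.u a * s.EU c)
        + s.EU c * s.u a - s.EU a * s.u c) - s.σ ^ (s.r + 2) * ∑ b, s.curlE c a b * s.U b := by
    have ea : s.EU a = _ := Fin.sum_univ_four fun b => s.E a b * s.U b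
    have ec : s.EU c = _ := Fin.sum_univ_four fun b => s.E c b * s.U b
    have ga := s.g_mul_U a
    have gc := s.g_mul_U c
    simp only [Fin.sum_univ_four] at ga gc ⊢
    linear_combination s.σ ^ (s.r + 1) * ((s.r + 2) * (s.u c * ea - s.u a * ec)
      - s.EU c * ga + s.EU a * gc)
  rw [h1] at h0
  refine sub_eq_zero.mp (s.regular _ ?_)
  linear_combination h0

/-- The divergence `∇^c E_{ca}`. -/
def divE (a : Fin 4) : R := m.tr fun c b => m.nabla2 s.E c a b

/-- The trace of the integrability condition. -/
theorem conservation (a : Fin 4) :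
    (s.r - 1) * s.EU a - (s.r + 2) * s.u a * m.tr s.E
      + s.σ * (s.divE a - m.D a (m.tr s.E)) = 0 := by
  -- The Weyl tensor is trace-free, and so is the Cotton tensor; hence only the `E` terms of
  -- `weylT_contract` survive, with common factor `σ^(r+1)`. The coefficient of `E_ab σ^b` is `(r +
  -- 2) + 1 - 4`.
  have h0 : (m.tr fun c b => ∑ d, m.weylT s.P c a d b * s.U d) = 0 := by
    have h : (m.tr fun c b => ∑ d, m.weylT s.P c a d b * s.U d)
        = ∑ d, (m.tr fun c b => m.weylT s.P c a d b) * s.U d := by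
      simp only [tr, Fin.sum_univ_four]; ring
    have h2 : ∀ d, (m.tr fun c b => m.weylT s.P c a d b) = 0 := by
      intro d
      have : (m.tr fun c b => m.weylT s.P c a d b) = -m.tr fun c b => m.weylT s.P c a b d := by
        rw [← tr_neg]
        simp only [m.weylT_antisymm_right _ _ _ d]
      rw [this, m.tr_weylT s.schouten, neg_zero]
    rw [h]; simp [h2]
  simp only [weylT_contract] at h0
  have hcot : (m.tr fun c b => m.cot s.P b c a) = 0 := by
    rw [m.tr_swap (fun c b => m.cot s.P c b a), m.tr_cot s.schouten]
  have hE1 : (m.tr fun c b => s.u c * s.E a b) = s.EU a := by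
    simp only [tr, EU, U, raise, Finset.mul_sum]
    rw [Finset.sum_comm]
    refine Finset.sum_congr rfl fun b _ => Finset.sum_congr rfl fun c _ => ?_
    rw [m.gi_symm]; ring
  have hcurl : (m.tr fun c b => s.curlE c a b) = s.divE a - m.D a (m.tr s.E) := by
    rw [D_tr]; simp only [curlE, tr_sub, divE]
  have h1 : (m.tr fun c b => s.σ * m.cot s.P b c a
      - s.σ ^ (s.r + 1) * ((s.r + 2) * (s.u c * s.E a b - s.u a * s.E c b)
        + s.EU c * m.g a b - s.EU a * m.g c b) - s.σ ^ (s.r + 2) * s.curlE c a b)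
      = s.σ * 0 - s.σ ^ (s.r + 1) * ((s.r + 2) * (s.EU a - s.u a * m.tr s.E)
        + s.EU a - s.EU a * 4) - s.σ ^ (s.r + 2) * (s.divE a - m.D a (m.tr s.E)) := by
    simp only [tr_sub, tr_mul, tr_add, hcot, hE1, hcurl, tr_mul_g]
    rw [show (m.tr fun a b => m.g a b) = 4 from m.tr_g]
  rw [h1] at h0
  refine s.pow_regular (s.r + 1) _ ?_
  linear_combination -h0

/-- `B_{bd} = A_{bcd} σ^c`. -/
def B (b d : Fin 4) : R := ∑ c, m.cot s.P b c d * s.U c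

/-- `W_d = A_{bcd} σ^b σ^c`. -/
def W (d : Fin 4) : R := ∑ b, s.B b d * s.U b

theorem W_eq (a : Fin 4) :
    s.W a = (s.r + 1) * s.σ ^ s.r * (s.nn * s.EU a - s.u a * ∑ c, s.EU c * s.U c)
      + s.σ ^ (s.r + 1) * ∑ c, (∑ b, s.curlE c a b * s.U b) * s.U c := by
  have h : s.W a = ∑ c, (∑ b, m.cot s.P b c a * s.U b) * s.U c := by
    simp only [W, B, Finset.sum_mul]
    rw [Finset.sum_comm]
    exact Finset.sum_congr rfl fun b _ => Finset.sum_congr rfl fun c _ => by ring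
  rw [h]
  simp only [cot_contract]
  simp only [nn, Fin.sum_univ_four]
  ring

theorem B_contract_right (b : Fin 4) : ∑ e, s.B b e * s.U e = 0 := by
  have h : ∑ e, s.B b e * s.U e = -∑ e, s.B b e * s.U e := by
    simp only [B, Finset.sum_mul]
    conv_rhs => rw [Finset.sum_comm]
    simp only [← Finset.sum_neg_distrib]
    refine Finset.sum_congr rfl fun e _ => Finset.sum_congr rfl fun c _ => ?_
    rw [m.cot_antisymm]; ring
  exact eq_zero_of_two_mul (by linear_combination h)

/-- The cyclic identity moves the antisymmetric part of `B` to a contraction in the first Cotton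
index, which `cot_contract` controls. -/
theorem B_sub_B (a b : Fin 4) : s.B a b - s.B b a = -∑ c, m.cot s.P c b a * s.U c := by
  simp only [B, ← Finset.sum_neg_distrib, ← Finset.sum_sub_distrib]
  refine Finset.sum_congr rfl fun c _ => ?_
  have h := m.cot_cyclic s.schouten a c b
  rw [m.cot_antisymm s.P b a c] at h
  linear_combination s.U c * h

/-! Evaluation at a point of the zero set of `σ`, encoded by a ring homomorphism `φ`. -/

theorem map_nn {φ : R →+* ℝ} (hφ : φ s.σ = 0) : φ s.nn = -φ s.lam := by
  rw [norm_eq]; simp [hφ]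

theorem map_hess {φ : R →+* ℝ} (hφ : φ s.σ = 0) (a b : Fin 4) :
    φ (m.nabla1 s.u a b) = -(φ s.ρ * φ (m.g a b)) := by
  rw [hess]; simp [hφ]

/-- Umbilicity: on the zero set of `σ` the Hessian is pure trace, so `∇_aσ^b = -ρ δ_a^b` there. -/
theorem map_raise_hess {φ : R →+* ℝ} (hφ : φ s.σ = 0) (a b : Fin 4) :
    φ (m.raise (m.nabla1 s.u a) b) = -(φ s.ρ * if b = a then 1 else 0) := by
  have h := congrArg φ (m.gi_mul_g b a)
  rw [apply_ite φ] at h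
  simp only [map_one, map_zero] at h
  rw [← h]
  simp only [raise, map_sum, map_mul, s.map_hess hφ, m.g_symm a]
  simp only [Fin.sum_univ_four]
  ring

theorem map_weylT_contract {φ : R →+* ℝ} (hφ : φ s.σ = 0) (c a b : Fin 4) :
    ∑ d, φ (m.weylT s.P c a d b) * φ (s.U d) = 0 := by
  have h := congrArg φ (s.weylT_contract c a b)
  simpa [hφ] using h

/-- At `σ = 0` every surviving term of `cot_contract` carries a factor `σ_a` or `σ_b`, which
vanishes in tangential directions, also when `r = 0`. -/
theorem map_B_symm {φ : R →+* ℝ} (hφ : φ s.σ = 0) {a b : Fin 4} (ha : φ (s.u a) = 0)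
    (hb : φ (s.u b) = 0) : φ (s.B a b) = φ (s.B b a) := by
  have h := congrArg φ (s.B_sub_B a b)
  rw [cot_contract] at h
  simp only [map_sub, map_neg, map_add, map_mul, map_pow, ha, hb, hφ] at h
  simp at h
  linarith

/-- For `r > 0` a power of `σ` is explicit in `W_eq`. For `r = 0` it is not, but conservation at `σ
= 0` makes `E_ab σ^b` a multiple of `σ_a`, and the bracket in `W_eq` is the part of it orthogonal to
`σ_a`. -/
theorem map_W {φ : R →+* ℝ} (hφ : φ s.σ = 0) (a : Fin 4) : φ (s.W a) = 0 := by
  rcases Nat.eq_zero_or_pos s.r with hr | hr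
  · have h : ∀ a, φ (s.EU a) = -2 * φ (s.u a) * φ (m.tr s.E) := by
      intro a
      have h := congrArg φ (s.conservation a)
      simp only [hr, map_add, map_sub, map_mul, map_one, Nat.cast_zero, hφ,
        map_ofNat, map_zero] at h
      linear_combination -h
    rw [W_eq, hr]
    simp only [map_add, map_sub, map_mul, map_one, Nat.cast_zero, hφ, map_pow,
      map_sum, h, nn]
    simp only [Fin.sum_univ_four]
    ring
  · rw [W_eq]; simp [hφ, hr.ne']

/-- Used at `σ = 0`, where the normal derivative of `σ f` is `|dσ|² f`: a factor `σ` suffices to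
compute it without differentiating `f`. -/
theorem sum_U_D_mul (f : R) : ∑ e, s.U e * m.D e (s.σ * f)
    = s.nn * f + s.σ * ∑ e, s.U e * m.D e f := by
  simp only [Derivation.leibniz, smul_eq_mul, nn, u, Fin.sum_univ_four]; ring

theorem map_normal_deriv_W_of_pos {φ : R →+* ℝ} (hφ : φ s.σ = 0) (hr : s.r = 1) {a : Fin 4}
    (ha : φ (s.u a) = 0) :
    φ (∑ e, s.U e * m.D e (s.W a)) = 2 * φ s.lam ^ 2 * φ (s.EU a) := by
  have h : s.W a = s.σ * (2 * (s.nn * s.EU a - s.u a * ∑ c, s.EU c * s.U c)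
      + s.σ * ∑ c, (∑ b, s.curlE c a b * s.U b) * s.U c) := by
    rw [W_eq, hr]; push_cast; ring
  rw [h, sum_U_D_mul]
  simp only [map_add, map_mul, map_sub, hφ, ha, s.map_nn hφ, map_ofNat]
  ring

/-- For `r = 0`: `E_{ab}σ^b = -2 e σ_a + σ Z_a` with `e` the trace of `E`. -/
def Z (a : Fin 4) : R := s.divE a - m.D a (m.tr s.E)

theorem EU_eq (hr : s.r = 0) : s.EU = fun a => -2 * m.tr s.E * s.u a + s.σ * s.Z a := by
  funext a
  have h := s.conservation a
  simp only [hr, Nat.cast_zero] at h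
  simp only [Z]
  linear_combination -h

/-- Differentiate `EU_eq` and subtract the term where the derivative hits the gradient, known by
umbilicity. For `r = 0` the curl of `E` enters `W` at the same order in `σ` as the algebraic terms,
and this determines its normal contraction. -/
theorem map_nabla2_E_contract {φ : R →+* ℝ} (hφ : φ s.σ = 0) (hr : s.r = 0) (c a : Fin 4) :
    φ (∑ b, m.nabla2 s.E c a b * s.U b) = φ s.ρ * φ (s.E a c)
      + 2 * φ s.ρ * φ (m.tr s.E) * φ (m.g c a)
      - 2 * φ (s.u a) * φ (m.D c (m.tr s.E)) + φ (s.u c) * φ (s.Z a) := by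
  have h1 := m.nabla1_contract s.E s.u c a
  change m.nabla1 s.EU c a = ∑ b, m.nabla2 s.E c a b * s.U b + _ at h1
  have h2 : φ (∑ b, s.E a b * m.raise (m.nabla1 s.u c) b) = -(φ s.ρ * φ (s.E a c)) := by
    simp [s.map_raise_hess hφ, mul_comm]
  have h3 : m.nabla1 s.EU c a = -2 * m.tr s.E * m.nabla1 s.u c a
      - 2 * s.u a * m.D c (m.tr s.E) + s.u c * s.Z a + s.σ * m.nabla1 s.Z c a := by
    have hD2 : m.D c (2 : R) = 0 := by simpa using (m.D c).map_natCast 2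
    rw [s.EU_eq hr]
    simp only [nabla1, map_add, Derivation.leibniz, smul_eq_mul, map_neg, hD2, u,
      Fin.sum_univ_four]
    ring
  rw [h3] at h1
  have h4 := congrArg φ h1
  rw [map_add _ (Finset.sum _ _), h2] at h4
  simp only [map_add, map_sub, map_mul, map_neg, map_ofNat, hφ, s.map_hess hφ] at h4
  linear_combination -h4

theorem map_normal_deriv_W_of_zero {φ : R →+* ℝ} (hφ : φ s.σ = 0) (hr : s.r = 0) {a : Fin 4}
    (ha : φ (s.u a) = 0) :
    φ (∑ e, s.U e * m.D e (s.W a)) = 2 * φ s.lam ^ 2 * φ (s.divE a) := by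
  have h : s.W a = s.σ * (s.nn * s.Z a - s.u a * ∑ c, s.Z c * s.U c
      + ∑ c, (∑ b, s.curlE c a b * s.U b) * s.U c) := by
    rw [W_eq, hr, s.EU_eq hr]
    simp only [nn, Fin.sum_univ_four, Nat.cast_zero]; ring
  -- For tangential `a` the terms with `ρ` are symmetric in `c, a` and drop out; the rest is
  -- proportional to `σ_c`. Together with `Z` the derivatives of the trace of `E` cancel, leaving
  -- only `divE`.
  have hc : ∀ c, φ (∑ b, s.curlE c a b * s.U b)
      = φ (s.u c) * φ (s.Z a) + 2 * φ (s.u c) * φ (m.D a (m.tr s.E)) := by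
    intro c
    simp only [curlE, sub_mul, Finset.sum_sub_distrib, map_sub]
    rw [s.map_nabla2_E_contract hφ hr, s.map_nabla2_E_contract hφ hr, s.E_symm a c, m.g_symm c a,
      ha]
    ring
  have hn : ∑ c, φ (s.u c) * φ (s.U c) = -φ s.lam := by
    rw [← s.map_nn hφ, nn]; simp
  rw [h, sum_U_D_mul]
  have hs : φ (∑ c, (∑ b, s.curlE c a b * s.U b) * s.U c)
      = -φ s.lam * (φ (s.Z a) + 2 * φ (m.D a (m.tr s.E))) := by
    rw [← hn, map_sum]
    simp only [map_mul, hc]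
    simp only [Fin.sum_univ_four]; ring
  rw [map_add, map_mul, map_add, hs]
  simp only [map_sub, map_mul, hφ, ha, s.map_nn hφ, Z]
  ring

/-- By the product rule, one term is the divergence of the Cotton tensor in its first index, and in
the other umbilicity replaces `∇^bσ^c` by `-ρ g^bc`, giving a trace of the Cotton tensor. -/
theorem map_div_B {φ : R →+* ℝ} (hφ : φ s.σ = 0) (d : Fin 4) :
    φ (m.tr fun e b => m.nabla2 s.B e b d) = 0 := by
  have h : ∀ e b, m.nabla2 s.B e b d = ∑ c, m.nabla3 (m.cot s.P) e b c d * s.U c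
      + ∑ c, m.cot s.P b c d * m.raise (m.nabla1 s.u e) c :=
    fun e b => m.nabla2_contract (m.cot s.P) s.u e b d
  have h1 : (m.tr fun e b => ∑ c, m.nabla3 (m.cot s.P) e b c d * s.U c) = 0 := by
    have : (m.tr fun e b => ∑ c, m.nabla3 (m.cot s.P) e b c d * s.U c)
        = ∑ c, (m.tr fun e b => m.nabla3 (m.cot s.P) e b c d) * s.U c := by
      simp only [tr, Fin.sum_univ_four]; ring
    rw [this]
    simp [m.div_cot s.schouten]
  simp only [h, tr_add, h1, zero_add]
  have h2 := congrArg φ (m.tr_cot s.schouten d)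
  rw [← m.tr_swap] at h2
  simp only [tr, map_sum, map_mul, map_zero, s.map_raise_hess hφ] at h2 ⊢
  have : ∀ e b : Fin 4, ∑ c, φ (m.cot s.P b c d) * -(φ s.ρ * if c = e then 1 else 0)
      = -φ s.ρ * φ (m.cot s.P b e d) := by
    intro e b; simp [mul_comm]
  simp only [this, mul_left_comm _ (-φ s.ρ), ← Finset.mul_sum, h2, mul_zero]

/-- Since `W_d = B_bd σ^b`, moving the gradient inside the derivative costs `-ρ B_ed σ^e = -ρ W_d`,
which is zero on the boundary, as are the Christoffel corrections for `W`. -/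
theorem map_normal_nabla2_B {φ : R →+* ℝ} (hφ : φ s.σ = 0) (d : Fin 4) :
    ∑ e, ∑ b, φ (s.U e) * φ (s.U b) * φ (m.nabla2 s.B e b d)
      = φ (∑ e, s.U e * m.D e (s.W d)) := by
  have h : ∀ e, m.nabla1 s.W e d = ∑ b, m.nabla2 s.B e b d * s.U b
      + ∑ b, s.B b d * m.raise (m.nabla1 s.u e) b := by
    intro e
    have h1 := m.nabla1_contract (fun d b => s.B b d) s.u e d
    have h2 : ∀ b, m.nabla2 (fun d b => s.B b d) e d b = m.nabla2 s.B e b d := by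
      intro b; simp only [nabla2]; ring
    simp only [h2] at h1
    exact h1
  have h1 : ∀ e, φ (m.D e (s.W d)) = ∑ b, φ (m.nabla2 s.B e b d) * φ (s.U b)
      - φ s.ρ * φ (s.B e d) := by
    intro e
    have h2 := congrArg φ (h e)
    simp only [nabla1, map_sub, map_add, map_sum, map_mul, s.map_W hφ, mul_zero,
      Finset.sum_const_zero, sub_zero, s.map_raise_hess hφ] at h2
    rw [h2]
    simp [mul_comm, sub_eq_add_neg]
  have h3 : ∑ e, φ (s.B e d) * φ (s.U e) = 0 := by
    rw [← s.map_W hφ d, W]; simp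
  simp only [map_sum, map_mul, h1]
  simp only [Fin.sum_univ_four] at h3 ⊢
  linear_combination φ s.ρ * h3

end EinsteinScale
end MetricCalculus

/-! ### Change of connection and the conformal transformation of the Ricci tensor. -/

namespace MetricCalculus

variable {R : Type*} [CommRing R] [Algebra ℝ R] (m : MetricCalculus R)

/-- The covariant derivative `∇_a Q^c_{bd}`. -/
def nablaQ (Q : Fin 4 → Fin 4 → Fin 4 → R) (a c b d : Fin 4) : R :=
  m.D a (Q c b d) + ∑ e, m.Γ c a e * Q e b d - ∑ e, m.Γ e a b * Q c e d - ∑ e, m.Γ e a d * Q c b e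

/-- The general formula for the curvature of `∇ + Q`; torsion-freeness removes the remaining
Christoffel term, and no smallness or symmetry of `Q` is involved. -/
theorem riem_add (m' : MetricCalculus R) (hD : m'.D = m.D) (Q : Fin 4 → Fin 4 → Fin 4 → R)
    (hΓ : ∀ c a b, m'.Γ c a b = m.Γ c a b + Q c a b) (a b c d : Fin 4) :
    m'.riem a b c d = m.riem a b c d + m.nablaQ Q a c b d - m.nablaQ Q b c a d
      + ∑ e, (Q c a e * Q e b d - Q c b e * Q e a d) := by
  simp only [riem, nablaQ, hD, hΓ, map_add, Fin.sum_univ_four, m.Γ_symm _ b a]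
  ring

/-- The change of the Christoffel symbols under a conformal change `g ↦ ω² g` with
`v = -ω⁻¹ dω`. -/
def confQ (v : Fin 4 → R) (c a b : Fin 4) : R :=
  m.g a b * m.raise v c - (if c = a then 1 else 0) * v b - (if c = b then 1 else 0) * v a

theorem nablaQ_confQ (v : Fin 4 → R) (a c b d : Fin 4) :
    m.nablaQ (m.confQ v) a c b d = m.g b d * m.raise (m.nabla1 v a) c
      - (if c = b then 1 else 0) * m.nabla1 v a d - (if c = d then 1 else 0) * m.nabla1 v a b := by
  have hδ : ∀ i j : Fin 4, m.D a (if i = j then (1 : R) else 0) = 0 := by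
    intro i j; split_ifs <;> simp
  have hr : m.D a (m.raise v c) = m.raise (m.nabla1 v a) c - ∑ e, m.Γ c a e * m.raise v e := by
    rw [D_raise]; rfl
  have s1 : ∑ e, m.Γ c a e * m.confQ v e b d
      = m.g b d * (∑ e, m.Γ c a e * m.raise v e) - m.Γ c a b * v d - m.Γ c a d * v b := by
    simp only [confQ, mul_sub, Finset.sum_sub_distrib, Finset.mul_sum]
    simp [mul_left_comm]
  have s2 : ∑ e, m.Γ e a b * m.confQ v c e d
      = (∑ e, m.Γ e a b * m.g e d) * m.raise v c - m.Γ c a b * v d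
        - (if c = d then 1 else 0) * ∑ e, m.Γ e a b * v e := by
    simp only [confQ, mul_sub, Finset.sum_sub_distrib, Finset.mul_sum, Finset.sum_mul]
    simp [mul_assoc]
  have s3 : ∑ e, m.Γ e a d * m.confQ v c b e
      = (∑ e, m.Γ e a d * m.g b e) * m.raise v c - m.Γ c a d * v b
        - (if c = b then 1 else 0) * ∑ e, m.Γ e a d * v e := by
    simp only [confQ, mul_sub, Finset.sum_sub_distrib, Finset.mul_sum, Finset.sum_mul]
    simp [mul_assoc]
    ring
  rw [nablaQ, s1, s2, s3]
  simp only [confQ, map_sub, Derivation.leibniz, smul_eq_mul, hδ, hr, m.D_g, nabla1]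
  ring

/-- The transformation of the Ricci tensor under a conformal change of the metric. -/
theorem ric_conformal (m' : MetricCalculus R) (hD : m'.D = m.D) (v : Fin 4 → R)
    (hΓ : ∀ c a b, m'.Γ c a b = m.Γ c a b + m.confQ v c a b)
    (hv : ∀ a b, m.nabla1 v a b = m.nabla1 v b a) (b d : Fin 4) :
    m'.ric b d = m.ric b d + 2 * m.nabla1 v b d + m.g b d * m.tr (m.nabla1 v) + 2 * v b * v d
      - 2 * m.g b d * ∑ e, v e * m.raise v e := by
  -- `t1` to `t4` are the traces of the two derivative terms and of the two quadratic terms in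
  -- `riem_add`; the coefficients come from dimension four.
  have t1 : ∑ a, m.nablaQ (m.confQ v) a a b d
      = m.g b d * m.tr (m.nabla1 v) - m.nabla1 v b d - m.nabla1 v d b := by
    simp only [nablaQ_confQ, Finset.sum_sub_distrib, ← Finset.mul_sum]
    have : ∑ a, m.raise (m.nabla1 v a) a = m.tr (m.nabla1 v) := rfl
    rw [this]; simp
  have hg : ∑ a, m.g a d * m.raise (m.nabla1 v b) a = m.nabla1 v b d := by
    simp only [m.g_symm _ d, g_mul_raise]
  have t2 : ∑ a, m.nablaQ (m.confQ v) b a a d = -4 * m.nabla1 v b d := by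
    simp only [nablaQ_confQ, Finset.sum_sub_distrib, hg]
    simp
  have hgv : ∀ d, ∑ a, m.g a d * m.raise v a = v d := by
    intro d; simp only [m.g_symm _ d, g_mul_raise]
  have q1 : ∀ e, ∑ a, m.confQ v a a e = -4 * v e := by
    intro e
    simp only [confQ, Finset.sum_sub_distrib, hgv]
    simp
  have hq : ∀ w : Fin 4 → R, ∑ e, w e * m.confQ v e b d
      = m.g b d * (∑ e, w e * m.raise v e) - w b * v d - w d * v b := by
    intro w
    simp only [confQ, mul_sub, Finset.sum_sub_distrib, Finset.mul_sum]
    simp [mul_left_comm]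
  have t3 : ∑ a, ∑ e, m.confQ v a a e * m.confQ v e b d
      = -4 * (m.g b d * (∑ e, v e * m.raise v e) - v b * v d - v d * v b) := by
    rw [Finset.sum_comm]
    simp only [← Finset.sum_mul, q1]
    simp only [mul_assoc, ← Finset.mul_sum, hq]
  have t4 : ∑ a, ∑ e, m.confQ v a b e * m.confQ v e a d
      = 6 * v b * v d - 2 * m.g b d * ∑ e, v e * m.raise v e := by
    have h1 : ∀ a, ∑ e, m.confQ v a b e * m.confQ v e a d
        = -(if a = b then 1 else 0) * (m.g a d * ∑ e, v e * m.raise v e)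
          - (m.g b a * m.raise v a - (if a = b then 1 else 0) * v a - v b) * v d
          - (m.g b d * (v a * m.raise v a) - (if a = b then 1 else 0) * (v d * v a)
            - (if a = d then 1 else 0) * (v b * v a)) := by
      intro a
      have h2 : ∀ w : Fin 4 → R, ∑ e, w e * m.confQ v e a d
          = m.g a d * (∑ e, w e * m.raise v e) - w a * v d - w d * v a := by
        intro w
        simp only [confQ, mul_sub, Finset.sum_sub_distrib, Finset.mul_sum]
        simp [mul_left_comm]
      have h3 : ∑ e, m.confQ v a b e * m.raise v e
          = -(if a = b then 1 else 0) * (∑ e, v e * m.raise v e) := by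
        simp only [confQ, sub_mul, Finset.sum_sub_distrib]
        have : ∑ e, m.g b e * m.raise v a * m.raise v e = v b * m.raise v a := by
          conv_rhs => rw [← m.g_mul_raise v b, Finset.sum_mul]
          exact Finset.sum_congr rfl fun e _ => by ring
        rw [this]
        simp [Finset.mul_sum, mul_comm]
      rw [h2, h3]
      simp only [confQ, if_true]
      ring
    simp only [h1, Finset.sum_sub_distrib, ← Finset.mul_sum, ← Finset.sum_mul, m.g_mul_raise]
    simp
    ring
  have h : m'.ric b d = m.ric b d + ∑ a, m.nablaQ (m.confQ v) a a b d
      - ∑ a, m.nablaQ (m.confQ v) b a a d + ∑ a, ∑ e, m.confQ v a a e * m.confQ v e b d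
      - ∑ a, ∑ e, m.confQ v a b e * m.confQ v e a d := by
    simp only [ric, m.riem_add m' hD _ hΓ, Finset.sum_add_distrib, Finset.sum_sub_distrib]
    ring
  rw [h, t1, t2, t3, t4, hv d b]
  ring

end MetricCalculus

/-! ### The algebra of smooth functions on a coordinate domain -/

section SmoothAlgebra

variable {n : ℕ}

/-- The smooth functions on `S`, up to the part of the boundary contained in `S`. -/
def smoothFun (S : Set (Coord n)) : Subalgebra ℝ (S → ℝ) where
  carrier := {f | ∃ F : Coord n → ℝ, ContDiffOn ℝ ∞ F S ∧ ∀ x : S, F x = f x}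
  mul_mem' := by
    rintro f g ⟨F, hF, hf⟩ ⟨G, hG, hg⟩
    exact ⟨fun x => F x * G x, hF.mul hG, fun x => by simp [hf, hg]⟩
  add_mem' := by
    rintro f g ⟨F, hF, hf⟩ ⟨G, hG, hg⟩
    exact ⟨fun x => F x + G x, hF.add hG, fun x => by simp [hf, hg]⟩
  algebraMap_mem' c := ⟨fun _ => c, contDiffOn_const, fun _ => rfl⟩

/-- A coordinate domain: derivatives within `S` are well defined, and commute. -/
structure IsCoordDomain (S : Set (Coord n)) : Prop where
  uniqueDiffOn : UniqueDiffOn ℝ S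
  subset_closure : S ⊆ closure (interior S)

namespace smoothFun

variable {S : Set (Coord n)}

/-- The smooth function with a given extension. -/
def mk (F : Coord n → ℝ) (hF : ContDiffOn ℝ ∞ F S) : smoothFun S :=
  ⟨fun x => F x, F, hF, fun _ => rfl⟩

/-- Evaluation at a point. -/
def ev (x : S) : smoothFun S →+* ℝ := (Pi.evalRingHom _ x).comp (smoothFun S).val.toRingHom

@[simp] theorem ev_mk (F : Coord n → ℝ) (hF : ContDiffOn ℝ ∞ F S) (x : S) : ev x (mk F hF) = F x :=
  rfl

@[simp] theorem ev_smul (c : ℝ) (f : smoothFun S) (x : S) : ev x (c • f) = c * ev x f := rfl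

theorem ext_ev {f g : smoothFun S} (h : ∀ x, ev x f = ev x g) : f = g :=
  Subtype.ext (funext h)

/-- An extension of a smooth function to the whole space. -/
def rep (f : smoothFun S) : Coord n → ℝ := f.2.choose

theorem contDiffOn_rep (f : smoothFun S) : ContDiffOn ℝ ∞ (rep f) S := f.2.choose_spec.1

theorem rep_apply (f : smoothFun S) (x : S) : (rep f) x = ev x f := f.2.choose_spec.2 x

theorem contDiffOn_pd (hS : IsCoordDomain S) {F : Coord n → ℝ} (hF : ContDiffOn ℝ ∞ F S)
    (i : Fin n) : ContDiffOn ℝ ∞ (fun x => pd S F x i) S :=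
  (hF.fderivWithin hS.uniqueDiffOn (by simp)).clm_apply contDiffOn_const

theorem pd_congr {F G : Coord n → ℝ} (h : ∀ y ∈ S, F y = G y) {x : Coord n} (hx : x ∈ S)
    (i : Fin n) : pd S F x i = pd S G x i := by
  unfold pd
  rw [fderivWithin_congr h (h x hx)]

theorem pd_add (hS : IsCoordDomain S) {F G : Coord n → ℝ} (hF : ContDiffOn ℝ ∞ F S)
    (hG : ContDiffOn ℝ ∞ G S) {x : Coord n} (hx : x ∈ S) (i : Fin n) :
    pd S (fun y => F y + G y) x i = pd S F x i + pd S G x i := by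
  unfold pd
  rw [fderivWithin_fun_add (hS.uniqueDiffOn x hx) (hF.differentiableOn (by simp) x hx)
    (hG.differentiableOn (by simp) x hx)]
  simp

theorem pd_mul (hS : IsCoordDomain S) {F G : Coord n → ℝ} (hF : ContDiffOn ℝ ∞ F S)
    (hG : ContDiffOn ℝ ∞ G S) {x : Coord n} (hx : x ∈ S) (i : Fin n) :
    pd S (fun y => F y * G y) x i = F x * pd S G x i + G x * pd S F x i := by
  unfold pd
  rw [fderivWithin_fun_mul (hS.uniqueDiffOn x hx) (hF.differentiableOn (by simp) x hx)
    (hG.differentiableOn (by simp) x hx)]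
  simp

theorem pd_const (c : ℝ) (x : Coord n) (i : Fin n) : pd S (fun _ => c) x i = 0 := by
  simp [pd]

/-- Symmetry of second derivatives holds up to boundary points because every point of `S` is a limit
of interior points. -/
theorem pd_comm (hS : IsCoordDomain S) {F : Coord n → ℝ} (hF : ContDiffOn ℝ ∞ F S)
    {x : Coord n} (hx : x ∈ S) (i j : Fin n) :
    pd S (fun y => pd S F y j) x i = pd S (fun y => pd S F y i) x j := by
  have h : ∀ i j, pd S (fun y => pd S F y j) x i = fderivWithin ℝ (fderivWithin ℝ F S) S x
      (EuclideanSpace.single i 1) (EuclideanSpace.single j 1) := by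
    intro i j
    have hd : DifferentiableWithinAt ℝ (fderivWithin ℝ F S) S x :=
      (hF.fderivWithin (m := ∞) hS.uniqueDiffOn (by simp)).differentiableOn (by simp) x hx
    unfold pd
    rw [fderivWithin_clm_apply (hS.uniqueDiffOn x hx) hd (differentiableWithinAt_const _)]
    simp
  rw [h, h]
  exact (hF x hx).isSymmSndFDerivWithinAt (by
    rw [minSmoothness_of_isRCLikeNormedField]; exact WithTop.coe_le_coe.2 le_top) hS.uniqueDiffOn (hS.subset_closure hx) hx _ _

/-- The partial derivatives, as derivations of the algebra of smooth functions. -/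
def D (hS : IsCoordDomain S) (i : Fin n) : Derivation ℝ (smoothFun S) (smoothFun S) :=
  Derivation.mk'
    { toFun := fun f => mk (fun x => pd S (rep f) x i) (contDiffOn_pd hS (contDiffOn_rep f) i)
      map_add' := fun f g => ext_ev fun x => by
        rw [map_add, ev_mk, ev_mk, ev_mk, ← pd_add hS (contDiffOn_rep f) (contDiffOn_rep g) x.2]
        exact pd_congr (fun y hy => by
          rw [rep_apply _ ⟨y, hy⟩, rep_apply _ ⟨y, hy⟩, rep_apply _ ⟨y, hy⟩, map_add]) x.2 i
      map_smul' := fun c f => ext_ev fun x => by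
        have h := pd_mul hS (contDiffOn_const (c := c)) (contDiffOn_rep f) x.2 i
        rw [pd_const, mul_zero, add_zero] at h
        rw [RingHom.id_apply, ev_smul, ev_mk, ev_mk, ← h]
        exact pd_congr (fun y hy => by
          rw [rep_apply _ ⟨y, hy⟩, rep_apply _ ⟨y, hy⟩, ev_smul]) x.2 i }
    fun f g => ext_ev fun x => by
      have h := pd_mul hS (contDiffOn_rep f) (contDiffOn_rep g) x.2 i
      simp only [LinearMap.coe_mk, AddHom.coe_mk, smul_eq_mul, map_add, map_mul, ev_mk]
      rw [← rep_apply f, ← rep_apply g, ← h]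
      exact pd_congr (fun y hy => by
          rw [rep_apply _ ⟨y, hy⟩, rep_apply _ ⟨y, hy⟩, rep_apply _ ⟨y, hy⟩, map_mul]) x.2 i

/-- Derivatives within `S` see only values on `S`, so the arbitrary extension chosen by `rep` may be
replaced by any other one. -/
theorem ev_D (hS : IsCoordDomain S) (f : smoothFun S) {F : Coord n → ℝ}
    (h : ∀ y : S, F y = ev y f) (x : S) (i : Fin n) : ev x (D hS i f) = pd S F x i :=
  pd_congr (fun y hy => by rw [rep_apply _ ⟨y, hy⟩, ← h]) x.2 i

theorem D_comm (hS : IsCoordDomain S) (i j : Fin n) (f : smoothFun S) :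
    D hS i (D hS j f) = D hS j (D hS i f) := by
  refine ext_ev fun x => ?_
  have h : ∀ i (y : S), pd S (rep f) y i = ev y (D hS i f) := fun i y => rfl
  rw [ev_D hS _ (F := fun y => pd S (rep f) y j) (h j),
    ev_D hS _ (F := fun y => pd S (rep f) y i) (h i)]
  exact pd_comm hS (contDiffOn_rep f) x.2 i j

theorem isUnit_of_ev_ne_zero {f : smoothFun S} (h : ∀ x, ev x f ≠ 0) : IsUnit f := by
  refine IsUnit.of_mul_eq_one (mk (fun x => ((rep f) x)⁻¹) ((contDiffOn_rep f).inv fun x hx => by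
    rw [rep_apply f ⟨x, hx⟩]; exact h _)) (ext_ev fun x => ?_)
  rw [map_mul, ev_mk, rep_apply, map_one]
  exact mul_inv_cancel₀ (h x)

end smoothFun
end SmoothAlgebra

/-! ### The metric calculus of a smooth metric in a coordinate domain -/

open smoothFun

/-- A smooth nondegenerate symmetric bilinear form on a coordinate domain. -/
structure IsSmoothMetric (S : Set (Coord 4)) (g : Coord 4 → Fin 4 → Fin 4 → ℝ) : Prop where
  smooth : ∀ a b, ContDiffOn ℝ ∞ (fun x => g x a b) S
  symm : ∀ x ∈ S, ∀ a b, g x a b = g x b a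
  det_ne_zero : ∀ x ∈ S, (Matrix.of (g x)).det ≠ 0

variable {S : Set (Coord 4)} {g : Coord 4 → Fin 4 → Fin 4 → ℝ}

namespace IsSmoothMetric

/-- The matrix of a metric, over the algebra of smooth functions. -/
def mat (hg : IsSmoothMetric S g) : Matrix (Fin 4) (Fin 4) (smoothFun S) :=
  Matrix.of fun a b => smoothFun.mk (fun x => g x a b) (hg.smooth a b)

theorem map_mat (hg : IsSmoothMetric S g) (x : S) : (ev x).mapMatrix hg.mat = Matrix.of (g x) := by
  ext a b; simp [mat]

theorem isUnit_det (hg : IsSmoothMetric S g) : IsUnit hg.mat.det :=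
  isUnit_of_ev_ne_zero fun x => by
    rw [RingHom.map_det, map_mat]; exact hg.det_ne_zero x x.2

theorem ev_inv (hg : IsSmoothMetric S g) (x : S) (a b : Fin 4) :
    ev x (hg.mat⁻¹ a b) = ginv g x a b := by
  have h : (ev x).mapMatrix hg.mat⁻¹ * Matrix.of (g x) = 1 := by
    rw [← hg.map_mat, ← map_mul, Matrix.nonsing_inv_mul _ hg.isUnit_det, map_one]
  rw [ginv, Matrix.inv_eq_left_inv h]; rfl

/-- The lowered Christoffel symbols. -/
def lowChristoffel (hS : IsCoordDomain S) (hg : IsSmoothMetric S g) (c a b : Fin 4) : smoothFun S :=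
  (1 / 2 : ℝ) • (D hS a (hg.mat b c) + D hS b (hg.mat a c) - D hS c (hg.mat a b))

theorem mat_symm (hg : IsSmoothMetric S g) (a b : Fin 4) : hg.mat a b = hg.mat b a :=
  ext_ev fun x => hg.symm x x.2 a b

/-- The metric calculus of a smooth metric. -/
def calculus (hS : IsCoordDomain S) (hg : IsSmoothMetric S g) : MetricCalculus (smoothFun S) where
  D := D hS
  D_comm := D_comm hS
  g := hg.mat
  gi := fun a b => hg.mat⁻¹ a b
  Γ := fun c a b => ∑ d, hg.mat⁻¹ c d * hg.lowChristoffel hS d a b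
  g_symm := hg.mat_symm
  gi_symm := fun a b => by
    have h : hg.mat.transpose = hg.mat := by ext i j; rw [Matrix.transpose_apply, hg.mat_symm]
    conv_lhs => rw [← h, ← Matrix.transpose_nonsing_inv, Matrix.transpose_apply]
  gi_mul_g := fun a b => by
    have h := congrFun (congrFun (Matrix.nonsing_inv_mul _ hg.isUnit_det) a) b
    rwa [Matrix.mul_apply, Matrix.one_apply] at h
  Γ_symm := fun c a b => by
    refine Finset.sum_congr rfl fun d _ => ?_
    simp only [lowChristoffel, hg.mat_symm a b, add_comm (D hS a _)]
  D_g := fun a b c => by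
    -- Lowering the upper index cancels the inverse metric; compatibility is then the identity
    -- `Γ_{c,ab} + Γ_{b,ac} = ∂_a g_bc` for the lowered symbols.
    have h : ∀ a b c, ∑ e, hg.mat c e * ∑ d, hg.mat⁻¹ e d * hg.lowChristoffel hS d a b
        = hg.lowChristoffel hS c a b := by
      intro a b c
      have h1 : ∀ d, ∑ e, hg.mat c e * hg.mat⁻¹ e d = if c = d then 1 else 0 := by
        intro d
        have h := congrFun (congrFun (Matrix.mul_nonsing_inv _ hg.isUnit_det) c) d
        rwa [Matrix.mul_apply, Matrix.one_apply] at h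
      simp only [Finset.mul_sum]
      rw [Finset.sum_comm]
      simp only [← mul_assoc, ← Finset.sum_mul, h1]
      simp
    have h2 : ∑ e, (∑ d, hg.mat⁻¹ e d * hg.lowChristoffel hS d a b) * hg.mat e c
        = hg.lowChristoffel hS c a b := by
      rw [← h]
      exact Finset.sum_congr rfl fun e _ => by rw [hg.mat_symm, mul_comm]
    have h3 : ∑ e, (∑ d, hg.mat⁻¹ e d * hg.lowChristoffel hS d a c) * hg.mat b e
        = hg.lowChristoffel hS b a c := by
      rw [← h]
      exact Finset.sum_congr rfl fun e _ => mul_comm _ _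
    rw [h2, h3]
    simp only [lowChristoffel, hg.mat_symm c b, hg.mat_symm a c, hg.mat_symm a b]
    module

section Evaluation

variable (hS : IsCoordDomain S) (hg : IsSmoothMetric S g)

theorem ev_g (x : S) (a b : Fin 4) : ev x ((hg.calculus hS).g a b) = g x a b := rfl

theorem ev_gi (x : S) (a b : Fin 4) : ev x ((hg.calculus hS).gi a b) = ginv g x a b := hg.ev_inv x a b

theorem ev_D' (f : smoothFun S) {F : Coord 4 → ℝ} (h : ∀ y : S, F y = ev y f) (x : S) (i : Fin 4) :
    ev x ((hg.calculus hS).D i f) = pd S F x i := ev_D hS f h x i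

theorem ev_Γ (x : S) (c a b : Fin 4) : ev x ((hg.calculus hS).Γ c a b) = christoffel S g x c a b := by
  have h : ∀ i a b, ev x (D hS i (hg.mat a b)) = pd S (fun y => g y a b) x i :=
    fun i a b => ev_D hS _ (fun _ => rfl) x i
  simp only [calculus, lowChristoffel, map_sum, map_mul, ev_smul, map_add, map_sub, h, hg.ev_inv,
    christoffel, Finset.mul_sum]
  exact Finset.sum_congr rfl fun d _ => by ring

theorem ev_nabla1 {u : Fin 4 → smoothFun S} {η : Coord 4 → Fin 4 → ℝ}
    (h : ∀ (y : S) b, η y b = ev y (u b)) (x : S) (a b : Fin 4) :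
    ev x ((hg.calculus hS).nabla1 u a b) = cov1 S g η x a b := by
  simp only [MetricCalculus.nabla1, cov1, map_sub, map_sum, map_mul, ev_Γ, h]
  rw [hg.ev_D' hS (u b) (F := fun y => η y b) (fun y => h y b)]

theorem ev_nabla2 {t : Fin 4 → Fin 4 → smoothFun S} {T : Coord 4 → Fin 4 → Fin 4 → ℝ}
    (h : ∀ (y : S) b c, T y b c = ev y (t b c)) (x : S) (a b c : Fin 4) :
    ev x ((hg.calculus hS).nabla2 t a b c) = cov2 S g T x a b c := by
  simp only [MetricCalculus.nabla2, cov2, map_sub, map_sum, map_mul, ev_Γ, h]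
  rw [hg.ev_D' hS (t b c) (F := fun y => T y b c) (fun y => h y b c)]

theorem ev_tr {t : Fin 4 → Fin 4 → smoothFun S} {T : Coord 4 → Fin 4 → Fin 4 → ℝ} (x : S)
    (h : ∀ b c, T x b c = ev x (t b c)) :
    ev x ((hg.calculus hS).tr t) = trace g T x := by
  simp only [MetricCalculus.tr, trace, map_sum, map_mul, ev_gi, h]

theorem ev_riem (x : S) (a b c d : Fin 4) :
    ev x ((hg.calculus hS).riem a b c d) = riemannUp S g x a b c d := by
  simp only [MetricCalculus.riem, riemannUp, map_sub, map_add, map_sum, map_mul, ev_Γ]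
  rw [hg.ev_D' hS _ (F := fun y => christoffel S g y c b d) (fun y => (hg.ev_Γ hS y c b d).symm),
    hg.ev_D' hS _ (F := fun y => christoffel S g y c a d) (fun y => (hg.ev_Γ hS y c a d).symm)]

theorem ev_riemLow (x : S) (a b c d : Fin 4) :
    ev x ((hg.calculus hS).riemLow a b c d) = riemann S g x a b c d := by
  simp only [MetricCalculus.riemLow, riemann, map_sum, map_mul, ev_riem, ev_g]

theorem ev_ric (x : S) (b d : Fin 4) : ev x ((hg.calculus hS).ric b d) = ricci S g x b d := by
  simp only [MetricCalculus.ric, ricci, map_sum, ev_riem]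

theorem ev_algebraMap (c : ℝ) (x : S) : ev x (algebraMap ℝ (smoothFun S) c) = c := rfl

/-- The Schouten tensor. -/
def P (a b : Fin 4) : smoothFun S :=
  algebraMap ℝ _ (1 / 2) * ((hg.calculus hS).ric a b
    - algebraMap ℝ _ (1 / 6) * (hg.calculus hS).tr (hg.calculus hS).ric * (hg.calculus hS).g a b)

theorem ev_P (x : S) (a b : Fin 4) : ev x (hg.P hS a b) = schouten S g x a b := by
  simp only [P, ev_algebraMap, map_sub, map_mul, ev_ric, ev_g, schouten, scalarCurv,
    hg.ev_tr hS (T := ricci S g) x (fun b c => (hg.ev_ric hS x b c).symm)]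
  norm_num
  left
  ring

theorem ric_eq (a b : Fin 4) : (hg.calculus hS).ric a b
    = 2 * hg.P hS a b + (hg.calculus hS).tr (hg.P hS) * (hg.calculus hS).g a b := by
  set m := hg.calculus hS
  have h1 : m.tr (hg.P hS) = algebraMap ℝ _ (1 / 2) * (m.tr m.ric
      - algebraMap ℝ _ (1 / 6) * m.tr m.ric * 4) := by
    rw [← m.tr_g, ← m.tr_mul, ← m.tr_sub, ← m.tr_mul]
    rfl
  refine ext_ev fun x => ?_
  rw [h1]
  simp only [P, ev_algebraMap, map_sub, map_add, map_mul, map_ofNat]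
  ring

theorem ev_weylT (x : S) (a b c d : Fin 4) :
    ev x ((hg.calculus hS).weylT (hg.P hS) a b c d) = weyl S g x a b c d := by
  simp only [MetricCalculus.weylT, weyl, map_sub, map_add, map_mul, ev_riemLow, ev_g, ev_P]

theorem ev_cot (x : S) (a b c : Fin 4) :
    ev x ((hg.calculus hS).cot (hg.P hS) a b c) = cotton S g x a b c := by
  simp only [MetricCalculus.cot, cotton, map_sub,
    hg.ev_nabla2 hS (T := schouten S g) (fun y b c => (hg.ev_P hS y b c).symm)]

end Evaluation

end IsSmoothMetric

/-! ### The Ricci tensor of `σ⁻² g` in coordinates. -/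

open smoothFun

variable {S : Set (Coord 4)} {g : Coord 4 → Fin 4 → Fin 4 → ℝ}

namespace IsSmoothMetric

/-- The metric `σ⁻² g`. -/
def rescale (g : Coord 4 → Fin 4 → Fin 4 → ℝ) (σ : Coord 4 → ℝ) (x : Coord 4) (a b : Fin 4) : ℝ :=
  (σ x ^ 2)⁻¹ * g x a b

variable {σ : Coord 4 → ℝ}

theorem rescale_metric (hg : IsSmoothMetric S g) (hσ : ContDiffOn ℝ ∞ σ S)
    (h0 : ∀ x ∈ S, σ x ≠ 0) : IsSmoothMetric S (rescale g σ) where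
  smooth a b := ((hσ.pow 2).inv fun x hx => pow_ne_zero 2 (h0 x hx)).mul (hg.smooth a b)
  symm x hx a b := by rw [rescale, rescale, hg.symm x hx]
  det_ne_zero x hx := by
    have : Matrix.of (rescale g σ x) = (σ x ^ 2)⁻¹ • Matrix.of (g x) := by
      ext a b; simp [rescale]
    rw [this, Matrix.det_smul]
    exact mul_ne_zero (pow_ne_zero _ (inv_ne_zero (pow_ne_zero 2 (h0 x hx))))
      (hg.det_ne_zero x hx)

theorem ginv_rescale (hg : IsSmoothMetric S g) {x : Coord 4} (hx : x ∈ S) (h0 : σ x ≠ 0)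
    (a b : Fin 4) : ginv (rescale g σ) x a b = σ x ^ 2 * ginv g x a b := by
  have h1 : Matrix.of (rescale g σ x) = (σ x ^ 2)⁻¹ • Matrix.of (g x) := by
    ext a b; simp [rescale]
  have h2 : (σ x ^ 2 • (Matrix.of (g x))⁻¹) * Matrix.of (rescale g σ x) = 1 := by
    rw [h1, Matrix.smul_mul, Matrix.mul_smul, Matrix.nonsing_inv_mul, smul_smul,
      mul_inv_cancel₀ (pow_ne_zero 2 h0), one_smul]
    exact isUnit_iff_ne_zero.mpr (hg.det_ne_zero x hx)
  rw [ginv, Matrix.inv_eq_left_inv h2]; rfl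

theorem christoffel_rescale (hS : IsCoordDomain S) (hg : IsSmoothMetric S g)
    (hσ : ContDiffOn ℝ ∞ σ S) (h0 : ∀ x ∈ S, σ x ≠ 0) {v : Fin 4 → smoothFun S}
    (hv : ∀ (x : S) a, ev x (v a) = (σ x)⁻¹ * pd S σ x a) (c a b : Fin 4) :
    ((hg.rescale_metric hσ h0).calculus hS).Γ c a b
      = (hg.calculus hS).Γ c a b + (hg.calculus hS).confQ v c a b := by
  refine ext_ev fun x => ?_
  rw [map_add, ev_Γ, ev_Γ]
  have hσx := h0 x x.2
  -- Obtained by differentiating the product `σ² (σ⁻² g) = g`, which avoids the derivative of an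
  -- inverse.
  have hpd : ∀ i a b, pd S (fun y => rescale g σ y a b) x i
      = (σ x ^ 2)⁻¹ * (pd S (fun y => g y a b) x i - 2 * ev x (v i) * g x a b) := by
    intro i a b
    have hr := (hg.rescale_metric hσ h0).smooth a b
    have h := pd_mul hS (hσ.mul hσ) hr x.2 i
    have h2 := pd_mul hS hσ hσ x.2 i
    have h3 : pd S (fun y => σ y * σ y * rescale g σ y a b) x i = pd S (fun y => g y a b) x i := by
      refine pd_congr (fun y hy => ?_) x.2 i
      have := h0 y hy
      simp only [rescale]; field_simp
    rw [h3, h2] at h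
    have hd := (hv x i)
    rw [hd, h, rescale]
    field_simp
    ring
  have hconf : ev x ((hg.calculus hS).confQ v c a b) = g x a b * (∑ e, ginv g x c e * ev x (v e))
      - (if c = a then 1 else 0) * ev x (v b) - (if c = b then 1 else 0) * ev x (v a) := by
    simp only [MetricCalculus.confQ, MetricCalculus.raise, map_sub, map_mul, map_sum, ev_g, ev_gi,
      apply_ite (ev x), map_one, map_zero]
  have hδ : ∀ a, ∑ e, ginv g x c e * g x a e = if c = a then 1 else 0 := by
    intro a
    have h := congrArg (ev x) ((hg.calculus hS).gi_mul_g c a)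
    simp only [(hg.calculus hS).g_symm _ a] at h
    simpa only [map_sum, map_mul, ev_g, ev_gi, apply_ite (ev x), map_one, map_zero] using h
  rw [hconf, ← hδ, ← hδ]
  simp only [christoffel, hpd, hg.ginv_rescale x.2 hσx]
  simp only [Fin.sum_univ_four]
  field_simp
  ring

/-- The squared norm of the differential of `σ`. -/
def gradSq (S : Set (Coord 4)) (g : Coord 4 → Fin 4 → Fin 4 → ℝ) (σ : Coord 4 → ℝ)
    (x : Coord 4) : ℝ := ∑ a, ∑ b, ginv g x a b * (pd S σ x a * pd S σ x b)

/-- The Hessian of `σ`. -/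
def hessian (S : Set (Coord 4)) (g : Coord 4 → Fin 4 → Fin 4 → ℝ) (σ : Coord 4 → ℝ) :
    Coord 4 → Fin 4 → Fin 4 → ℝ := cov1 S g (pd S σ)

/-- This is `ric_conformal` with `v = σ⁻¹ dσ`: from `∇v = σ⁻¹∇∇σ - v ⊗ v` the terms quadratic in `v`
cancel except for the one along the metric. -/
theorem ricci_rescale (hS : IsCoordDomain S) (hg : IsSmoothMetric S g)
    (hσ : ContDiffOn ℝ ∞ σ S) (h0 : ∀ x ∈ S, σ x ≠ 0) {x : Coord 4} (hx : x ∈ S) (b d : Fin 4) :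
    ricci S (rescale g σ) x b d = ricci S g x b d + 2 * (σ x)⁻¹ * hessian S g σ x b d
      + g x b d * ((σ x)⁻¹ * trace g (hessian S g σ) x - 3 * (σ x)⁻¹ ^ 2 * gradSq S g σ x) := by
  let m := hg.calculus hS
  let s : smoothFun S := smoothFun.mk σ hσ
  let si : smoothFun S := smoothFun.mk (fun x => (σ x)⁻¹) (hσ.inv h0)
  have hsi : si * s = 1 := ext_ev fun x => by
    rw [map_mul, ev_mk, ev_mk, map_one]; exact inv_mul_cancel₀ (h0 x x.2)
  let u : Fin 4 → smoothFun S := fun a => m.D a s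
  let v : Fin 4 → smoothFun S := fun a => si * u a
  have hu : ∀ (x : S) a, pd S σ x a = ev x (u a) := fun x a => (hg.ev_D' hS s (fun _ => rfl) x a).symm
  have hv : ∀ (x : S) a, ev x (v a) = (σ x)⁻¹ * pd S σ x a := fun x a => by
    rw [map_mul, hu]; rfl
  have hDsi : ∀ a, m.D a si = -(si * si * u a) := by
    intro a
    have h := congrArg (m.D a) hsi
    rw [Derivation.leibniz, Derivation.map_one_eq_zero, smul_eq_mul, smul_eq_mul] at h
    linear_combination si * h - m.D a si * hsi
  have hnv : ∀ a b, m.nabla1 v a b = si * m.nabla1 u a b - v a * v b := by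
    intro a b
    simp only [MetricCalculus.nabla1, v, Derivation.leibniz, smul_eq_mul, hDsi, Fin.sum_univ_four]
    ring
  have hus : ∀ a b, m.nabla1 u a b = m.nabla1 u b a := by
    intro a b
    simp only [MetricCalculus.nabla1, u, m.D_comm a b, m.Γ_symm _ a b]
  have h := m.ric_conformal ((hg.rescale_metric hσ h0).calculus hS) rfl v
    (hg.christoffel_rescale hS hσ h0 hv) (fun a b => by rw [hnv, hnv, hus a b]; ring) b d
  have htr : m.tr (m.nabla1 v) = si * m.tr (m.nabla1 u) - ∑ e, v e * m.raise v e := by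
    have h1 : ∑ e, v e * m.raise v e = m.tr fun a b => v a * v b := by
      simp only [MetricCalculus.tr, MetricCalculus.raise, Finset.mul_sum]
      exact Finset.sum_congr rfl fun a _ => Finset.sum_congr rfl fun b _ => by ring
    rw [h1, ← m.tr_mul, ← m.tr_sub]
    exact congrArg m.tr (by funext a b; exact hnv a b)
  have hN : ∑ e, v e * m.raise v e = si ^ 2 * ∑ a, ∑ b, m.gi a b * (u a * u b) := by
    simp only [MetricCalculus.raise, Finset.mul_sum, v]
    exact Finset.sum_congr rfl fun a _ => Finset.sum_congr rfl fun b _ => by ring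
  rw [htr, hnv, hN] at h
  have h2 := congrArg (ev ⟨x, hx⟩) h
  have hH : ∀ (y : S) b c, hessian S g σ y b c = ev y (m.nabla1 u b c) :=
    fun y b c => (hg.ev_nabla1 hS hu y b c).symm
  have hsix : ev ⟨x, hx⟩ si = (σ x)⁻¹ := rfl
  have hN2 : ev ⟨x, hx⟩ (∑ a, ∑ b, m.gi a b * (u a * u b)) = gradSq S g σ x := by
    simp only [map_sum, map_mul, ← hu, gradSq]
    simp only [m, ev_gi]
  simp only [map_add, map_sub, map_mul, map_pow, map_ofNat, hN2, hsix] at h2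
  rw [ev_ric, ev_ric, hg.ev_tr hS (T := hessian S g σ) _ (hH _), ← hH, hv, hv] at h2
  simp only [m, ev_g] at h2
  rw [h2]
  ring

end IsSmoothMetric

/-! ### Locality of curvature, and the almost-Einstein equations away from the boundary. -/

open smoothFun

section Locality

variable {n : ℕ} {S U : Set (Coord n)}

theorem IsCoordDomain.of_isOpen (hU : IsOpen U) : IsCoordDomain U where
  uniqueDiffOn := hU.uniqueDiffOn
  subset_closure := by rw [hU.interior_eq]; exact _root_.subset_closure

theorem pd_eq_of_isOpen (hU : IsOpen U) (hUS : U ⊆ S) (f : Coord n → ℝ) {x : Coord n} (hx : x ∈ U)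
    (i : Fin n) : pd S f x i = pd U f x i := by
  unfold pd
  rw [fderivWithin_of_mem_nhds (hU.mem_nhds hx),
    fderivWithin_of_mem_nhds (Filter.mem_of_superset (hU.mem_nhds hx) hUS)]

variable {g : Coord n → Fin n → Fin n → ℝ}

theorem christoffel_eq_of_isOpen (hU : IsOpen U) (hUS : U ⊆ S) {x : Coord n} (hx : x ∈ U)
    (c a b : Fin n) : christoffel S g x c a b = christoffel U g x c a b := by
  simp only [christoffel, pd_eq_of_isOpen hU hUS _ hx]

theorem riemannUp_eq_of_isOpen (hU : IsOpen U) (hUS : U ⊆ S) {x : Coord n} (hx : x ∈ U)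
    (a b c d : Fin n) : riemannUp S g x a b c d = riemannUp U g x a b c d := by
  have h : ∀ i c a b, pd S (fun y => christoffel S g y c a b) x i
      = pd U (fun y => christoffel U g y c a b) x i := by
    intro i c a b
    rw [pd_eq_of_isOpen hU hUS _ hx]
    exact pd_congr (fun y hy => christoffel_eq_of_isOpen hU hUS hy c a b) hx i
  simp only [riemannUp, h, christoffel_eq_of_isOpen hU hUS hx]

theorem ricci_eq_of_isOpen (hU : IsOpen U) (hUS : U ⊆ S) {x : Coord n} (hx : x ∈ U)
    (b d : Fin n) : ricci S g x b d = ricci U g x b d := by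
  simp only [ricci, riemannUp_eq_of_isOpen hU hUS hx]

theorem scalarCurv_eq_of_isOpen (hU : IsOpen U) (hUS : U ⊆ S) {x : Coord n} (hx : x ∈ U) :
    scalarCurv S g x = scalarCurv U g x := by
  simp only [scalarCurv, trace, ricci_eq_of_isOpen hU hUS hx]

theorem cov1_eq_of_isOpen (hU : IsOpen U) (hUS : U ⊆ S) (η : Coord n → Fin n → ℝ) {x : Coord n}
    (hx : x ∈ U) (a b : Fin n) : cov1 S g η x a b = cov1 U g η x a b := by
  simp only [cov1, pd_eq_of_isOpen hU hUS _ hx, christoffel_eq_of_isOpen hU hUS hx]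

end Locality

variable {S U : Set (Coord 4)} {g τ : Coord 4 → Fin 4 → Fin 4 → ℝ} {σ : Coord 4 → ℝ} {l : ℝ} {r : ℕ}

namespace IsSmoothMetric

theorem mono (hg : IsSmoothMetric S g) (h : U ⊆ S) : IsSmoothMetric U g where
  smooth a b := (hg.smooth a b).mono h
  symm x hx := hg.symm x (h hx)
  det_ne_zero x hx := hg.det_ne_zero x (h hx)

theorem hessian_eq_of_isOpen (hU : IsOpen U) (hUS : U ⊆ S) {x : Coord 4}
    (hx : x ∈ U) (a b : Fin 4) : hessian S g σ x a b = hessian U g σ x a b := by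
  rw [hessian, hessian, cov1_eq_of_isOpen hU hUS _ hx]
  simp only [cov1, pd_eq_of_isOpen hU hUS σ hx]
  congr 1
  exact pd_congr (fun y hy => pd_eq_of_isOpen hU hUS σ hy b) hx a

theorem gradSq_eq_of_isOpen (hU : IsOpen U) (hUS : U ⊆ S) {x : Coord 4}
    (hx : x ∈ U) : gradSq S g σ x = gradSq U g σ x := by
  simp only [gradSq, pd_eq_of_isOpen hU hUS σ hx]

theorem schouten_eq_of_isOpen (hU : IsOpen U) (hUS : U ⊆ S) {x : Coord 4}
    (hx : x ∈ U) (a b : Fin 4) : schouten S g x a b = schouten U g x a b := by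
  simp only [schouten, ricci_eq_of_isOpen hU hUS hx, scalarCurv_eq_of_isOpen hU hUS hx]

theorem trace_metric (hg : IsSmoothMetric S g) {x : Coord 4} (hx : x ∈ S) : trace g g x = 4 := by
  have h : Matrix.trace ((Matrix.of (g x))⁻¹ * Matrix.of (g x)) = 4 := by
    rw [Matrix.nonsing_inv_mul _ (isUnit_iff_ne_zero.mpr (hg.det_ne_zero x hx)), Matrix.trace_one]
    simp
  rw [← h, trace, Matrix.trace]
  refine Finset.sum_congr rfl fun a _ => ?_
  rw [Matrix.diag_apply, Matrix.mul_apply]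
  exact Finset.sum_congr rfl fun b _ => by rw [hg.symm x hx]; rfl

/-- The Einstein equations of `σ⁻² g`, with stress-energy tensor `σ^{r+1} τ` and `Λ = 3l`, in the
domain of positivity of `σ`. -/
theorem almost_einstein_of_einstein (hU : IsOpen U) (hg : IsSmoothMetric U g)
    (hσ : ContDiffOn ℝ ∞ σ U) (h0 : ∀ x ∈ U, σ x ≠ 0) {x : Coord 4} (hx : x ∈ U)
    (hE : ∀ a b, ricci U (rescale g σ) x a b
      - 1 / 2 * scalarCurv U (rescale g σ) x * rescale g σ x a b
      + 3 * l * rescale g σ x a b = σ x ^ (r + 1) * τ x a b) :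
    (∀ a b, hessian U g σ x a b + σ x * schouten U g x a b
      - 1 / 4 * (trace g (hessian U g σ) x + σ x * trace g (schouten U g) x
          + 1 / 6 * σ x ^ (r + 2) * trace g τ x) * g x a b
      = σ x ^ (r + 2) * (1 / 2 * (τ x a b - 1 / 3 * trace g τ x * g x a b))) ∧
    gradSq U g σ x + l
      - 1 / 2 * σ x * (trace g (hessian U g σ) x + σ x * trace g (schouten U g) x
          + 1 / 6 * σ x ^ (r + 2) * trace g τ x) = 0 := by
  have hS := IsCoordDomain.of_isOpen hU
  have hx0 := h0 x hx
  have hric := fun b d => hg.ricci_rescale hS hσ h0 hx b d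
  have hP : ∀ a b, ricci U g x a b
      = 2 * schouten U g x a b + trace g (schouten U g) x * g x a b := by
    intro a b
    have h := congrArg (ev ⟨x, hx⟩) (hg.ric_eq hS a b)
    rw [map_add, map_mul, map_mul, map_ofNat, ev_ric, ev_P, ev_g,
      hg.ev_tr hS (T := schouten U g) _ (fun b c => (hg.ev_P hS _ b c).symm)] at h
    exact h
  have hgi : ∀ a b, ginv (rescale g σ) x a b = σ x ^ 2 * ginv g x a b :=
    hg.ginv_rescale hx hx0
  have t4 := hg.trace_metric hx
  -- The scalar curvature is computed twice: here from the conformal transformation law, and in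
  -- `htr` from the trace of the Einstein equations. Equating the two is the norm equation `hn`.
  have hscal : scalarCurv U (rescale g σ) x = σ x ^ 2 * (6 * trace g (schouten U g) x
      + 6 * (σ x)⁻¹ * trace g (hessian U g σ) x - 12 * (σ x)⁻¹ ^ 2 * gradSq U g σ x) := by
    have h1 : scalarCurv U (rescale g σ) x = σ x ^ 2 * (2 * trace g (schouten U g) x
        + trace g (schouten U g) x * trace g g x
        + 2 * (σ x)⁻¹ * trace g (hessian U g σ) x
        + trace g g x * ((σ x)⁻¹ * trace g (hessian U g σ) x
          - 3 * (σ x)⁻¹ ^ 2 * gradSq U g σ x)) := by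
      have key : ∀ J k c : ℝ, ∑ a, ∑ b, σ x ^ 2 * ginv g x a b * (2 * schouten U g x a b
          + J * g x a b + c * hessian U g σ x a b + g x a b * k)
          = σ x ^ 2 * (2 * trace g (schouten U g) x + J * trace g g x
            + c * trace g (hessian U g σ) x + trace g g x * k) := by
        intro J k c
        simp only [trace, Fin.sum_univ_four]; ring
      rw [← key, scalarCurv, trace]
      simp only [hgi, hric, hP]
    rw [h1, t4]; ring
  have htr : scalarCurv U (rescale g σ) x = 12 * l - σ x ^ (r + 3) * trace g τ x := by
    have key : ∀ c : ℝ, ∑ a, ∑ b, ginv (rescale g σ) x a b * (ricci U (rescale g σ) x a b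
        - c * rescale g σ x a b + 3 * l * rescale g σ x a b)
        = scalarCurv U (rescale g σ) x - c * trace g g x + 3 * l * trace g g x := by
      intro c
      have hm : ∀ a b, rescale g σ x a b = (σ x ^ 2)⁻¹ * g x a b := fun _ _ => rfl
      have hσσ : σ x ^ 2 * (σ x ^ 2)⁻¹ = 1 := mul_inv_cancel₀ (pow_ne_zero 2 hx0)
      have hmul : ∀ a b, ginv (rescale g σ) x a b * rescale g σ x a b
          = ginv g x a b * g x a b := by
        intro a b; rw [hgi, hm]; linear_combination ginv g x a b * g x a b * hσσ
      simp only [scalarCurv, trace, mul_add, mul_sub, mul_left_comm (ginv _ x _ _), hmul,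
        Finset.sum_add_distrib, Finset.sum_sub_distrib, ← Finset.mul_sum]
    have h := key (1 / 2 * scalarCurv U (rescale g σ) x)
    simp only [hE, hgi] at h
    have h2 : ∑ a, ∑ b, σ x ^ 2 * ginv g x a b * (σ x ^ (r + 1) * τ x a b)
        = σ x ^ (r + 3) * trace g τ x := by
      simp only [trace, Finset.mul_sum]
      exact Finset.sum_congr rfl fun a _ => Finset.sum_congr rfl fun b _ => by ring
    rw [h2, t4] at h
    linarith
  have hn : gradSq U g σ x + l = 1 / 2 * σ x * (trace g (hessian U g σ) x
      + σ x * trace g (schouten U g) x + 1 / 6 * σ x ^ (r + 2) * trace g τ x) := by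
    rw [htr] at hscal
    field_simp at hscal
    ring_nf at hscal ⊢
    linarith
  refine ⟨fun a b => ?_, by rw [hn]; ring⟩
  -- With the scalar curvature and `|dσ|²` eliminated, the Einstein equations multiplied by powers
  -- of `σ` become `σ` times the Hessian equation.
  have h := hE a b
  rw [hric, hP, htr, rescale] at h
  have h2 : gradSq U g σ x = 1 / 2 * σ x * (trace g (hessian U g σ) x
      + σ x * trace g (schouten U g) x + 1 / 6 * σ x ^ (r + 2) * trace g τ x) - l := by
    linarith
  rw [h2] at h
  field_simp at h
  have h3 := mul_left_cancel₀ hx0 (a := σ x) (b := hessian U g σ x a b + σ x * schouten U g x a b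
      - 1 / 4 * (trace g (hessian U g σ) x + σ x * trace g (schouten U g) x
          + 1 / 6 * σ x ^ (r + 2) * trace g τ x) * g x a b)
    (c := σ x ^ (r + 2) * (1 / 2 * (τ x a b - 1 / 3 * trace g τ x * g x a b))) ?_
  · exact h3
  ring_nf at h ⊢
  linarith

end IsSmoothMetric

open smoothFun

/-! ### Half-space domains and their boundary -/

/-- A relatively open subset of the half-space `{x⁰ ≥ 0}`. -/
def IsHalfDomain (S : Set (Coord 4)) : Prop := ∃ O : Set (Coord 4), IsOpen O ∧ S = O ∩ {x | 0 ≤ x 0}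

/-- The part of a half-space domain away from the boundary. -/
def posPart (S : Set (Coord 4)) : Set (Coord 4) := S ∩ {x | 0 < x 0}

/-- The inclusion of the boundary as a continuous linear map. -/
def sliceL : Coord 3 →L[ℝ] Coord 4 :=
  LinearMap.toContinuousLinearMap
    { toFun := slice
      map_add' := fun x y => by
        ext i; refine Fin.cases ?_ (fun i => ?_) i <;> simp [slice]
      map_smul' := fun c x => by
        ext i; refine Fin.cases ?_ (fun i => ?_) i <;> simp [slice] }

theorem sliceL_apply (z : Coord 3) : sliceL z = slice z := rfl

theorem sliceL_single (α : Fin 3) :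
    sliceL (EuclideanSpace.single α 1) = EuclideanSpace.single α.succ 1 := by
  ext i
  refine Fin.cases ?_ (fun i => ?_) i
  · simp [sliceL_apply, slice, (Fin.succ_ne_zero α).symm]
  · simp [sliceL_apply, slice]

theorem slice_zero (z : Coord 3) : slice z 0 = 0 := rfl

theorem slice_bdryCoord {x : Coord 4} (hx : x 0 = 0) : slice (bdryCoord x) = x := by
  ext i
  refine Fin.cases ?_ (fun i => ?_) i
  · simp [slice, hx]
  · simp [slice, bdryCoord]

namespace IsHalfDomain

variable {S : Set (Coord 4)}

theorem isOpen_posPart (hS : IsHalfDomain S) : IsOpen (posPart S) := by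
  obtain ⟨O, hO, rfl⟩ := hS
  have : posPart (O ∩ {x | 0 ≤ x 0}) = O ∩ {x : Coord 4 | 0 < x 0} := by
    ext x; simp only [posPart, mem_inter_iff, mem_ofPred_eq]
    exact ⟨fun h => ⟨h.1.1, h.2⟩, fun h => ⟨⟨h.1, h.2.le⟩, h.2⟩⟩
  rw [this]
  exact hO.inter (isOpen_lt continuous_const (by fun_prop))

theorem nonneg (hS : IsHalfDomain S) {x : Coord 4} (hx : x ∈ S) : 0 ≤ x 0 := by
  obtain ⟨O, hO, rfl⟩ := hS
  exact hx.2

/-- Push a point inward along `∂_0`; for small times it stays in the open set and has positive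
zeroth coordinate. -/
theorem subset_closure_posPart (hS : IsHalfDomain S) : S ⊆ closure (posPart S) := by
  obtain ⟨O, hO, rfl⟩ := hS
  intro x hx
  let c : ℝ → Coord 4 := fun t => x + t • EuclideanSpace.single 0 1
  have hc : Continuous c := by fun_prop
  have hc0 : c 0 = x := by simp [c]
  have hO' : ∀ᶠ t in 𝓝[>] (0 : ℝ), c t ∈ O := by
    have : c ⁻¹' O ∈ 𝓝 (0 : ℝ) := hc.continuousAt.preimage_mem_nhds (by rw [hc0]; exact hO.mem_nhds hx.1)
    exact mem_nhdsWithin_of_mem_nhds this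
  have ht : Filter.Tendsto c (𝓝[>] (0 : ℝ)) (𝓝 x) := by
    have := (hc.tendsto 0).mono_left (nhdsWithin_le_nhds (s := Ioi 0))
    rwa [hc0] at this
  refine mem_closure_of_tendsto ht ?_
  filter_upwards [hO', self_mem_nhdsWithin] with t h1 h2
  have h3 : c t 0 = x 0 + t := by simp [c]
  have h4 : 0 < c t 0 := by
    rw [h3]; exact add_pos_of_nonneg_of_pos hx.2 h2
  exact ⟨⟨h1, h4.le⟩, h4⟩

theorem isCoordDomain (hS : IsHalfDomain S) : IsCoordDomain S where
  uniqueDiffOn := by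
    obtain ⟨O, hO, rfl⟩ := hS
    rw [inter_comm]
    refine UniqueDiffOn.inter ?_ hO
    have := (𝓡∂ 4).uniqueDiffOn
    rwa [range_modelWithCornersEuclideanHalfSpace] at this
  subset_closure := hS.subset_closure_posPart.trans
    (closure_mono (interior_maximal inter_subset_left hS.isOpen_posPart))

theorem isOpen_bdryDom (hS : IsHalfDomain S) : IsOpen (bdryDom S) := by
  obtain ⟨O, hO, rfl⟩ := hS
  have : bdryDom (O ∩ {x | 0 ≤ x 0}) = sliceL ⁻¹' O := by
    ext z
    simp [bdryDom, sliceL_apply, slice_zero]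
  rw [this]
  exact hO.preimage sliceL.continuous

/-- The chain rule for the linear inclusion of the boundary: tangential derivatives of an ambient
function depend on its boundary values only. -/
theorem pd_slice (hS : IsHalfDomain S) {f : Coord 4 → ℝ} (hf : ContDiffOn ℝ ∞ f S) {z : Coord 3}
    (hz : z ∈ bdryDom S) (α : Fin 3) :
    pd (bdryDom S) (fun z => f (slice z)) z α = pd S f (slice z) α.succ := by
  have h1 : HasFDerivWithinAt f (fderivWithin ℝ f S (slice z)) S (slice z) :=
    (hf.differentiableOn (by simp) _ hz).hasFDerivWithinAt
  have h2 : HasFDerivWithinAt (fun z => f (slice z)) ((fderivWithin ℝ f S (slice z)).comp sliceL)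
      (bdryDom S) z :=
    HasFDerivWithinAt.comp (t := S) z h1 sliceL.hasFDerivWithinAt (fun _ h => h)
  unfold pd
  rw [h2.fderivWithin (hS.isOpen_bdryDom.uniqueDiffOn z hz), ContinuousLinearMap.comp_apply,
    sliceL_single]

/-- Continuity and density of the positive part carry identities up to the boundary; this is how the
almost-Einstein system is extended from the physical spacetime. -/
theorem ext_posPart (hS : IsHalfDomain S) {f g : smoothFun S}
    (h : ∀ x : S, 0 < (x : Coord 4) 0 → ev x f = ev x g) : f = g := by
  refine ext_ev fun x => ?_
  have hc : ContinuousWithinAt (fun y => rep f y - rep g y) S x :=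
    ((contDiffOn_rep f).continuousOn.sub (contDiffOn_rep g).continuousOn) x x.2
  have h0 : (fun y => rep f y - rep g y) x ∈ closure {(0 : ℝ)} := by
    refine (hc.mono inter_subset_left).mem_closure (hS.subset_closure_posPart x.2) fun y hy => ?_
    have := h ⟨y, hy.1⟩ hy.2
    simp [← rep_apply] at this
    simp [this]
  simp [rep_apply] at h0
  linarith

end IsHalfDomain

open IsSmoothMetric

/-- A metric, defining function and rescaled stress-energy tensor in a boundary chart, such that
`σ⁻² g` satisfies the Einstein equations with `Λ = 3 l` and stress-energy tensor `σ^{r+1} τ`. -/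
structure IsBoundaryModel (S : Set (Coord 4)) (g : Coord 4 → Fin 4 → Fin 4 → ℝ) (σ : Coord 4 → ℝ)
    (τ : Coord 4 → Fin 4 → Fin 4 → ℝ) (l : ℝ) (r : ℕ) : Prop where
  domain : IsHalfDomain S
  metric : IsSmoothMetric S g
  smooth_σ : ContDiffOn ℝ ∞ σ S
  smooth_τ : ∀ a b, ContDiffOn ℝ ∞ (fun x => τ x a b) S
  l_pos : 0 < l
  σ_ne_zero : ∀ x ∈ posPart S, σ x ≠ 0
  σ_eq_zero : ∀ x ∈ S, x 0 = 0 → σ x = 0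
  einstein : ∀ x ∈ posPart S, ∀ a b, ricci (posPart S) (rescale g σ) x a b
      - 1 / 2 * scalarCurv (posPart S) (rescale g σ) x * rescale g σ x a b
      + 3 * l * rescale g σ x a b = σ x ^ (r + 1) * τ x a b

namespace IsBoundaryModel

variable {S : Set (Coord 4)} {g τ : Coord 4 → Fin 4 → Fin 4 → ℝ} {σ : Coord 4 → ℝ} {l : ℝ} {r : ℕ}
  (h : IsBoundaryModel S g σ τ l r)

/-- The metric calculus of the model. -/
def mc : MetricCalculus (smoothFun S) := h.metric.calculus h.domain.isCoordDomain

/-- The defining function, as an element of the algebra of smooth functions. -/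
def sig : smoothFun S := smoothFun.mk σ h.smooth_σ

/-- The rescaled stress-energy tensor. -/
def stress (a b : Fin 4) : smoothFun S := smoothFun.mk (fun x => τ x a b) (h.smooth_τ a b)

/-- The Hessian of the defining function. -/
def hess : Fin 4 → Fin 4 → smoothFun S := h.mc.nabla1 fun a => h.mc.D a h.sig

theorem ev_D_sig (x : S) (a : Fin 4) : ev x (h.mc.D a h.sig) = pd S σ x a :=
  h.metric.ev_D' _ h.sig (fun _ => rfl) x a

theorem ev_hess (x : S) (a b : Fin 4) : ev x (h.hess a b) = hessian S g σ x a b :=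
  h.metric.ev_nabla1 _ (fun y b => (h.ev_D_sig y b).symm) x a b

theorem ev_gradSq (x : S) : ev x (∑ a, h.mc.D a h.sig * h.mc.raise (fun a => h.mc.D a h.sig) a)
    = gradSq S g σ x := by
  simp only [MetricCalculus.raise, map_sum, map_mul, ev_D_sig, gradSq, Finset.mul_sum]
  simp only [mc, ev_gi]
  exact Finset.sum_congr rfl fun a _ => Finset.sum_congr rfl fun b _ => by ring

/-- Where `x⁰ > 0` the function `σ` is nonzero, and that set is dense in `S`. This is what justifies
every cancellation of `σ` in the algebraic part. -/
theorem sig_regular (f : smoothFun S) (hf : h.sig * f = 0) : f = 0 := by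
  refine h.domain.ext_posPart fun x hx => ?_
  have h1 := congrArg (ev x) hf
  rw [map_mul, map_zero] at h1
  rw [map_zero]
  exact (mul_eq_zero.mp h1).resolve_left (h.σ_ne_zero x ⟨x.2, hx⟩)

/-- The Schouten tensor of the model. -/
def sch : Fin 4 → Fin 4 → smoothFun S := h.metric.P h.domain.isCoordDomain

/-- The function `ρ` of the almost-Einstein equations. -/
def rho : smoothFun S :=
  -(algebraMap ℝ _ (1 / 4) * (h.mc.tr h.hess + h.sig * h.mc.tr h.sch
    + algebraMap ℝ _ (1 / 6) * h.sig ^ (r + 2) * h.mc.tr h.stress))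

/-- The tensor `E = ½ (τ_{ab} - ⅓ τ g_{ab})`. -/
def source (a b : Fin 4) : smoothFun S :=
  algebraMap ℝ _ (1 / 2) * (h.stress a b
    - algebraMap ℝ _ (1 / 3) * h.mc.tr h.stress * h.mc.g a b)

theorem ev_g (x : S) (a b : Fin 4) : ev x (h.mc.g a b) = g x a b := rfl

theorem ev_sig (x : S) : ev x h.sig = σ x := rfl

theorem ev_stress (x : S) (a b : Fin 4) : ev x (h.stress a b) = τ x a b := rfl

theorem ev_tr_stress (x : S) : ev x (h.mc.tr h.stress) = trace g τ x :=
  h.metric.ev_tr _ x fun b c => (h.ev_stress x b c).symm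

theorem ev_rho (x : S) : ev x h.rho = -(1 / 4 * (trace g (hessian S g σ) x
    + σ x * trace g (schouten S g) x + 1 / 6 * σ x ^ (r + 2) * trace g τ x)) := by
  have e1 : ev x (h.mc.tr h.hess) = trace g (hessian S g σ) x :=
    h.metric.ev_tr _ x fun b c => (h.ev_hess x b c).symm
  have e2 : ev x (h.mc.tr h.sch) = trace g (schouten S g) x :=
    h.metric.ev_tr _ x fun b c => (h.metric.ev_P _ x b c).symm
  simp only [rho, map_add, map_neg, map_mul, map_pow, e1, e2, ev_tr_stress, ev_sig, ev_algebraMap]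

theorem almost_einstein (h : IsBoundaryModel S g σ τ l r) (x : S) (hx : 0 < (x : Coord 4) 0) :
    (∀ a b, hessian S g σ x a b + σ x * schouten S g x a b
      - 1 / 4 * (trace g (hessian S g σ) x + σ x * trace g (schouten S g) x
          + 1 / 6 * σ x ^ (r + 2) * trace g τ x) * g x a b
      = σ x ^ (r + 2) * (1 / 2 * (τ x a b - 1 / 3 * trace g τ x * g x a b))) ∧
    gradSq S g σ x + l
      - 1 / 2 * σ x * (trace g (hessian S g σ) x + σ x * trace g (schouten S g) x
          + 1 / 6 * σ x ^ (r + 2) * trace g τ x) = 0 := by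
  have hU := h.domain.isOpen_posPart
  have hUS : posPart S ⊆ S := inter_subset_left
  have hx' : (x : Coord 4) ∈ posPart S := ⟨x.2, hx⟩
  have h1 := almost_einstein_of_einstein hU (h.metric.mono hUS) (h.smooth_σ.mono hUS)
    h.σ_ne_zero hx' (h.einstein x hx')
  have hH : trace g (hessian S g σ) x = trace g (hessian (posPart S) g σ) x := by
    simp only [trace, hessian_eq_of_isOpen hU hUS hx']
  have hP : trace g (schouten S g) x = trace g (schouten (posPart S) g) x := by
    simp only [trace, schouten_eq_of_isOpen hU hUS hx']
  simpa only [hH, hP, hessian_eq_of_isOpen hU hUS hx', schouten_eq_of_isOpen hU hUS hx',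
    gradSq_eq_of_isOpen hU hUS hx'] using h1

theorem hess_eq (a b : Fin 4) :
    h.hess a b + h.sig * h.sch a b + h.rho * h.mc.g a b = h.sig ^ (r + 2) * h.source a b := by
  refine h.domain.ext_posPart fun x hx => ?_
  have h1 := (h.almost_einstein x hx).1 a b
  have e2 : ev x (h.sch a b) = schouten S g x a b := h.metric.ev_P _ x a b
  simp only [source, map_add, map_sub, map_mul, map_pow, ev_hess, ev_rho, ev_g, ev_sig,
    ev_stress, ev_tr_stress, e2, ev_algebraMap]
  linear_combination h1

theorem norm_eq : ∑ a, h.mc.D a h.sig * h.mc.raise (fun a => h.mc.D a h.sig) a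
    + algebraMap ℝ _ l + 2 * h.sig * h.rho = 0 := by
  refine h.domain.ext_posPart fun x hx => ?_
  have h1 := (h.almost_einstein x hx).2
  rw [map_add, map_add, h.ev_gradSq]
  simp only [map_mul, map_ofNat, map_zero, ev_rho, ev_sig, ev_algebraMap]
  linear_combination h1

/-- The solution of the almost-Einstein equations given by the model. -/
def scale : h.mc.EinsteinScale where
  σ := h.sig
  ρ := h.rho
  lam := algebraMap ℝ _ l
  P := h.sch
  E := h.source
  r := r
  regular := h.sig_regular
  D_lam := fun a => (h.mc.D a).map_algebraMap l
  schouten := h.metric.ric_eq _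
  hessian := h.hess_eq
  norm := h.norm_eq

end IsBoundaryModel

/-! ### Algebra at a boundary point -/

/-- A tensor in three dimensions with the symmetries of the Weyl tensor vanishes. -/
theorem weyl_three_eq_zero {h : Fin 3 → Fin 3 → ℝ} {C : Fin 3 → Fin 3 → Fin 3 → Fin 3 → ℝ}
    (hh : ∀ a b, h a b = h b a) (hdet : (Matrix.of h).det ≠ 0)
    (h1 : ∀ a b c d, C a b c d = -C b a c d) (h2 : ∀ a b c d, C a b c d = -C a b d c)
    (h3 : ∀ a b c d, C a b c d = C c d a b)
    (htr : ∀ b d, ∑ a, ∑ c, h a c * C a b c d = 0) (a b c d : Fin 3) : C a b c d = 0 := by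
  -- Such a tensor has six independent components, indexed by pairs of the planes 01, 12, 20, and
  -- there are six trace equations.
  have z1 : ∀ a c d, C a a c d = 0 := fun a c d => by linarith [h1 a a c d]
  have z2 : ∀ a b c, C a b c c = 0 := fun a b c => by linarith [h2 a b c c]
  have t00 := htr 0 0
  have t01 := htr 0 1
  have t02 := htr 0 2
  have t11 := htr 1 1
  have t12 := htr 1 2
  have t22 := htr 2 2
  simp only [Fin.sum_univ_three, z1, z2, h1 1 0, h1 2 1, h1 0 2, h2 _ _ 1 0, h2 _ _ 2 1,
    h2 _ _ 0 2, h3 1 2 0 1, h3 2 0 0 1, h3 2 0 1 2, hh 1 0, hh 2 0, hh 2 1]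
    at t00 t01 t02 t11 t12 t22
  rw [Matrix.det_fin_three] at hdet
  simp only [Matrix.of_apply, hh 1 0, hh 2 0, hh 2 1] at hdet
  set p := C 0 1 0 1
  set q := C 0 1 1 2
  set s := C 0 1 2 0
  set t := C 1 2 1 2
  set u := C 1 2 2 0
  set v := C 2 0 2 0
  -- In dimension three the double dual of a curvature tensor is its Einstein tensor: `½ h^ab (h^cd
  -- t_cd) - h^ac h^bd t_cd` equals `det h` times the component of `C` on the planes dual to `a` and
  -- `b`. The six combinations are the six entries of this identity.
  have e_p : p = 0 := by
    refine (mul_eq_zero.mp ?_).resolve_left hdet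
    linear_combination 1 / 2 * h 2 2 * (h 0 0 * t00 + 2 * h 0 1 * t01 + 2 * h 0 2 * t02 + h 1 1 * t11 + 2 * h 1 2 * t12 + h 2 2 * t22)
      - (h 0 2 * h 0 2 * t00
        + h 0 2 * h 1 2 * t01
        + h 0 2 * h 2 2 * t02
        + h 1 2 * h 0 2 * t01
        + h 1 2 * h 1 2 * t11
        + h 1 2 * h 2 2 * t12
        + h 2 2 * h 0 2 * t02
        + h 2 2 * h 1 2 * t12
        + h 2 2 * h 2 2 * t22)
  have e_q : q = 0 := by
    refine (mul_eq_zero.mp ?_).resolve_left hdet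
    linear_combination 1 / 2 * h 0 2 * (h 0 0 * t00 + 2 * h 0 1 * t01 + 2 * h 0 2 * t02 + h 1 1 * t11 + 2 * h 1 2 * t12 + h 2 2 * t22)
      - (h 0 0 * h 0 2 * t00
        + h 0 0 * h 1 2 * t01
        + h 0 0 * h 2 2 * t02
        + h 0 1 * h 0 2 * t01
        + h 0 1 * h 1 2 * t11
        + h 0 1 * h 2 2 * t12
        + h 0 2 * h 0 2 * t02
        + h 0 2 * h 1 2 * t12
        + h 0 2 * h 2 2 * t22)
  have e_s : s = 0 := by
    refine (mul_eq_zero.mp ?_).resolve_left hdet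
    linear_combination 1 / 2 * h 1 2 * (h 0 0 * t00 + 2 * h 0 1 * t01 + 2 * h 0 2 * t02 + h 1 1 * t11 + 2 * h 1 2 * t12 + h 2 2 * t22)
      - (h 0 1 * h 0 2 * t00
        + h 0 1 * h 1 2 * t01
        + h 0 1 * h 2 2 * t02
        + h 1 1 * h 0 2 * t01
        + h 1 1 * h 1 2 * t11
        + h 1 1 * h 2 2 * t12
        + h 1 2 * h 0 2 * t02
        + h 1 2 * h 1 2 * t12
        + h 1 2 * h 2 2 * t22)
  have e_t : t = 0 := by
    refine (mul_eq_zero.mp ?_).resolve_left hdet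
    linear_combination 1 / 2 * h 0 0 * (h 0 0 * t00 + 2 * h 0 1 * t01 + 2 * h 0 2 * t02 + h 1 1 * t11 + 2 * h 1 2 * t12 + h 2 2 * t22)
      - (h 0 0 * h 0 0 * t00
        + h 0 0 * h 0 1 * t01
        + h 0 0 * h 0 2 * t02
        + h 0 1 * h 0 0 * t01
        + h 0 1 * h 0 1 * t11
        + h 0 1 * h 0 2 * t12
        + h 0 2 * h 0 0 * t02
        + h 0 2 * h 0 1 * t12
        + h 0 2 * h 0 2 * t22)
  have e_u : u = 0 := by
    refine (mul_eq_zero.mp ?_).resolve_left hdet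
    linear_combination 1 / 2 * h 0 1 * (h 0 0 * t00 + 2 * h 0 1 * t01 + 2 * h 0 2 * t02 + h 1 1 * t11 + 2 * h 1 2 * t12 + h 2 2 * t22)
      - (h 0 0 * h 0 1 * t00
        + h 0 0 * h 1 1 * t01
        + h 0 0 * h 1 2 * t02
        + h 0 1 * h 0 1 * t01
        + h 0 1 * h 1 1 * t11
        + h 0 1 * h 1 2 * t12
        + h 0 2 * h 0 1 * t02
        + h 0 2 * h 1 1 * t12
        + h 0 2 * h 1 2 * t22)
  have e_v : v = 0 := by
    refine (mul_eq_zero.mp ?_).resolve_left hdet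
    linear_combination 1 / 2 * h 1 1 * (h 0 0 * t00 + 2 * h 0 1 * t01 + 2 * h 0 2 * t02 + h 1 1 * t11 + 2 * h 1 2 * t12 + h 2 2 * t22)
      - (h 0 1 * h 0 1 * t00
        + h 0 1 * h 1 1 * t01
        + h 0 1 * h 1 2 * t02
        + h 1 1 * h 0 1 * t01
        + h 1 1 * h 1 1 * t11
        + h 1 1 * h 1 2 * t12
        + h 1 2 * h 0 1 * t02
        + h 1 2 * h 1 1 * t12
        + h 1 2 * h 1 2 * t22)
  have hp : ∀ γ δ, C 0 1 γ δ = 0 ∧ C 1 2 γ δ = 0 ∧ C 2 0 γ δ = 0 := by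
    intro γ δ
    refine ⟨?_, ?_, ?_⟩ <;> fin_cases γ <;> fin_cases δ <;>
      simp [z2, h2 _ _ 1 0, h2 _ _ 2 1, h2 _ _ 0 2, h3 1 2 0 1, h3 2 0 0 1, h3 2 0 1 2, p, q, s, t, u, v,
        e_p, e_q, e_s, e_t, e_u, e_v]
  fin_cases a <;> fin_cases b <;> simp [z1, h1 1 0, h1 2 1, h1 0 2, hp]

theorem sum_fin_four_eq (f : Fin 4 → ℝ) : ∑ a, f a = f 0 + ∑ α : Fin 3, f α.succ :=
  Fin.sum_univ_succ f

variable {gi : Fin 4 → Fin 4 → ℝ}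

/-- The inverse of the induced metric. -/
def hInv (gi : Fin 4 → Fin 4 → ℝ) (a b : Fin 4) : ℝ := gi a b - gi a 0 * gi b 0 / gi 0 0

theorem hInv_zero_left (hs : ∀ a b, gi a b = gi b a) (h0 : gi 0 0 ≠ 0) (b : Fin 4) :
    hInv gi 0 b = 0 := by
  rw [hInv, hs b 0]; field_simp; ring

theorem hInv_zero_right (h0 : gi 0 0 ≠ 0) (a : Fin 4) :
    hInv gi a 0 = 0 := by
  rw [hInv]; field_simp; ring

/-- A tensor in four dimensions with the symmetries of the Weyl tensor, whose contraction with a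
non-null vector vanishes, is zero. -/
theorem weyl_four_eq_zero {C : Fin 4 → Fin 4 → Fin 4 → Fin 4 → ℝ}
    (hs : ∀ a b, gi a b = gi b a) (h0 : gi 0 0 ≠ 0)
    (hdet : (Matrix.of fun α β : Fin 3 => hInv gi α.succ β.succ).det ≠ 0)
    (h1 : ∀ a b c d, C a b c d = -C b a c d) (h2 : ∀ a b c d, C a b c d = -C a b d c)
    (h3 : ∀ a b c d, C a b c d = C c d a b)
    (htr : ∀ b d, ∑ a, ∑ c, gi a c * C a b c d = 0)
    (hn : ∀ a b d, ∑ c, C a b c d * gi c 0 = 0) (a b c d : Fin 4) : C a b c d = 0 := by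
  -- Replacing `gi` by `hInv` alters the trace by a contraction with the normal, zero by `hn`. As
  -- `hInv` has vanishing zeroth row and column, the tangential components form a trace-free tensor
  -- in dimension three.
  have hsp : ∀ α β γ δ : Fin 3, C α.succ β.succ γ.succ δ.succ = 0 := by
    refine weyl_three_eq_zero (h := fun α β => hInv gi α.succ β.succ)
      (C := fun α β γ δ => C α.succ β.succ γ.succ δ.succ) ?_ hdet (fun _ _ _ _ => h1 _ _ _ _)
      (fun _ _ _ _ => h2 _ _ _ _) (fun _ _ _ _ => h3 _ _ _ _) ?_
    · intro α β; simp only [hInv, hs α.succ β.succ]; ring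
    · intro β δ
      have e : ∑ a, ∑ c, hInv gi a c * C a β.succ c δ.succ = 0 := by
        have : ∑ a, ∑ c, hInv gi a c * C a β.succ c δ.succ
            = (∑ a, ∑ c, gi a c * C a β.succ c δ.succ)
              - ∑ a, gi a 0 / gi 0 0 * ∑ c, C a β.succ c δ.succ * gi c 0 := by
          simp only [hInv, Finset.mul_sum, ← Finset.sum_sub_distrib]
          exact Finset.sum_congr rfl fun a _ => Finset.sum_congr rfl fun c _ => by ring
        rw [this, htr]; simp [hn]
      rw [sum_fin_four_eq] at e
      simp only [sum_fin_four_eq, hInv_zero_left hs h0, hInv_zero_right h0, zero_mul, zero_add,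
        Finset.sum_const_zero] at e
      exact e
  -- The component in direction 0 is recovered from the tangential ones through `hn`, since `gi 0 0`
  -- is nonzero; the zero indices are then filled in one slot at a time.
  have hc : ∀ a b d, (∀ γ : Fin 3, C a b γ.succ d = 0) → ∀ c, C a b c d = 0 := by
    intro a b d h c
    have e := hn a b d
    rw [sum_fin_four_eq] at e
    simp only [h, zero_mul, Finset.sum_const_zero, add_zero] at e
    exact Fin.cases ((mul_eq_zero.mp e).resolve_right h0) h c
  have s1 : ∀ (α β δ : Fin 3) c, C α.succ β.succ c δ.succ = 0 := fun α β δ =>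
    hc _ _ _ fun γ => hsp α β γ δ
  have s2 : ∀ (α β : Fin 3) c d, C α.succ β.succ c d = 0 := fun α β c d => by
    rw [h2, hc _ _ _ (fun γ => by rw [h2, s1, neg_zero]), neg_zero]
  have s3 : ∀ (β : Fin 3) a c d, C a β.succ c d = 0 := fun β a c d => by
    rw [h3, h3, h3]
    exact hc _ _ _ (fun γ => by rw [h3, s2]) a
  refine Fin.cases ?_ (fun β => s3 β a c d) b
  rw [h1, neg_eq_zero]
  refine Fin.cases ?_ (fun α => s3 α 0 c d) a
  linarith [h1 0 0 c d]

/-- The divergence of a tangential tensor along the boundary. -/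
theorem gauss_divergence (hs : ∀ a b, gi a b = gi b a) (h0 : gi 0 0 ≠ 0)
    {Γ : Fin 4 → Fin 4 → Fin 4 → ℝ} {Γb : Fin 3 → Fin 3 → Fin 3 → ℝ}
    (hΓ : ∀ ε γ β, Γ ε.succ γ.succ β.succ
      = Γb ε γ β + Γ 0 γ.succ β.succ / gi 0 0 * gi ε.succ 0)
    {dB : Fin 4 → Fin 4 → Fin 4 → ℝ} {B : Fin 4 → Fin 4 → ℝ}
    (hl : ∀ d, ∑ b, B b d * gi b 0 = 0) (hr : ∀ b, ∑ d, B b d * gi d 0 = 0)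
    (δ : Fin 3) :
    ∑ β : Fin 3, ∑ γ : Fin 3, hInv gi β.succ γ.succ * (dB γ.succ β.succ δ.succ
        - ∑ ε, Γb ε γ β * B ε.succ δ.succ - ∑ ε, Γb ε γ δ * B β.succ ε.succ)
      = ∑ e, ∑ b, (gi e b - gi e 0 * gi b 0 / gi 0 0) * (dB e b δ.succ
        - ∑ f, Γ f e b * B f δ.succ - ∑ f, Γ f e δ.succ * B b f) := by
  -- The ambient and induced Christoffel symbols differ by a multiple of the normal `gi · 0`, which
  -- `B` annihilates in both slots, so ambient and intrinsic derivatives have the same tangential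
  -- components.
  have key : ∀ β γ : Fin 3, dB γ.succ β.succ δ.succ
        - ∑ ε, Γb ε γ β * B ε.succ δ.succ - ∑ ε, Γb ε γ δ * B β.succ ε.succ
      = dB γ.succ β.succ δ.succ
        - ∑ f, Γ f γ.succ β.succ * B f δ.succ - ∑ f, Γ f γ.succ δ.succ * B β.succ f := by
    intro β γ
    have e1 : ∑ f, Γ f γ.succ β.succ * B f δ.succ = ∑ ε, Γb ε γ β * B ε.succ δ.succ := by
      have := hl δ.succ
      rw [sum_fin_four_eq] at this ⊢
      simp only [hΓ, add_mul, Finset.sum_add_distrib]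
      have e : ∑ x : Fin 3, Γ 0 γ.succ β.succ / gi 0 0 * gi x.succ 0 * B x.succ δ.succ
          = Γ 0 γ.succ β.succ / gi 0 0 * ∑ x : Fin 3, B x.succ δ.succ * gi x.succ 0 := by
        rw [Finset.mul_sum]; exact Finset.sum_congr rfl fun _ _ => by ring
      rw [e, ← neg_eq_of_add_eq_zero_right this]
      field_simp; ring
    have e2 : ∑ f, Γ f γ.succ δ.succ * B β.succ f = ∑ ε, Γb ε γ δ * B β.succ ε.succ := by
      have := hr β.succ
      rw [sum_fin_four_eq] at this ⊢
      simp only [hΓ, add_mul, Finset.sum_add_distrib]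
      have e : ∑ x : Fin 3, Γ 0 γ.succ δ.succ / gi 0 0 * gi x.succ 0 * B β.succ x.succ
          = Γ 0 γ.succ δ.succ / gi 0 0 * ∑ x : Fin 3, B β.succ x.succ * gi x.succ 0 := by
        rw [Finset.mul_sum]; exact Finset.sum_congr rfl fun _ _ => by ring
      rw [e, ← neg_eq_of_add_eq_zero_right this]
      field_simp; ring
    rw [e1, e2]
  simp only [key]
  have e : ∀ e b, gi e b - gi e 0 * gi b 0 / gi 0 0 = hInv gi e b := fun _ _ => rfl
  simp only [e]
  rw [sum_fin_four_eq]
  simp only [sum_fin_four_eq (fun b => hInv gi _ b * _), hInv_zero_left hs h0,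
    hInv_zero_right h0, zero_mul, zero_add, Finset.sum_const_zero]
  rw [Finset.sum_comm]
  refine Finset.sum_congr rfl fun γ _ => Finset.sum_congr rfl fun β _ => ?_
  congr 1
  simp only [hInv, hs γ.succ β.succ]; ring

/-! ### Boundary values: the Weyl tensor, the fourth form and its divergence. -/

open smoothFun IsSmoothMetric MetricCalculus

namespace IsBoundaryModel

variable {S : Set (Coord 4)} {g τ : Coord 4 → Fin 4 → Fin 4 → ℝ} {σ : Coord 4 → ℝ} {l : ℝ} {r : ℕ}
  (h : IsBoundaryModel S g σ τ l r)

theorem ev_u (x : S) (a : Fin 4) : ev x (h.scale.u a) = pd S σ x a := h.ev_D_sig x a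

theorem ev_U (x : S) (a : Fin 4) : ev x (h.scale.U a) = ∑ b, ginv g x a b * pd S σ x b := by
  simp only [EinsteinScale.U, raise, map_sum, map_mul, ev_u]
  simp only [mc, ev_gi]

theorem nLow_eq (x : S) (a : Fin 4) : nLow S σ l x a = ev x (h.scale.u a) / √l := by
  rw [nLow, ev_u]

theorem nUp_eq (x : S) (a : Fin 4) : nUp S g σ l x a = ev x (h.scale.U a) / √l := by
  simp only [nUp, ev_U, nLow, Finset.sum_div, mul_div_assoc]

section BoundaryPoint

variable {z : Coord 3} (hz : z ∈ bdryDom S)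

/-- The point of the boundary with coordinates `z`. -/
def bpt (hz : z ∈ bdryDom S) : S := ⟨slice z, hz⟩

theorem ev_bdry_sig : ev (bpt hz) h.scale.σ = 0 := h.σ_eq_zero _ hz (slice_zero z)

theorem ev_bdry_u (α : Fin 3) : ev (bpt hz) (h.scale.u α.succ) = 0 := by
  rw [ev_u]
  change pd S σ (slice z) α.succ = 0
  rw [← h.domain.pd_slice h.smooth_σ hz, ← pd_const (S := bdryDom S) 0 z α]
  refine pd_congr (S := bdryDom S) (fun y hy => ?_) hz α
  exact h.σ_eq_zero _ hy (slice_zero y)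

theorem ev_bdry_U (a : Fin 4) :
    ev (bpt hz) (h.scale.U a) = ginv g (slice z) a 0 * ev (bpt hz) (h.scale.u 0) := by
  have h1 : ∀ α : Fin 3, pd S σ (slice z) α.succ = 0 := fun α => by
    rw [← h.ev_bdry_u hz α, ev_u]; rfl
  rw [ev_U, sum_fin_four_eq, ev_u]
  simp only [bpt, h1, mul_zero, Finset.sum_const_zero, add_zero]

/-- The norm equation at `σ = 0`, where only `∂_0σ` survives. It shows at once that `g^00` and
`∂_0σ` are nonzero, so the conormal is not null. -/
theorem ginv_zero_zero : ginv g (slice z) 0 0 * ev (bpt hz) (h.scale.u 0) ^ 2 = -l := by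
  have h1 := h.scale.map_nn (h.ev_bdry_sig hz)
  rw [EinsteinScale.nn, map_sum, sum_fin_four_eq] at h1
  simp only [map_mul, h.ev_bdry_u hz, zero_mul, Finset.sum_const_zero, add_zero,
    h.ev_bdry_U hz] at h1
  have h2 : ev (bpt hz) h.scale.lam = l := rfl
  rw [h2] at h1
  linarith

theorem ginv_zero_zero_ne (h : IsBoundaryModel S g σ τ l r) (hz : z ∈ bdryDom S) : ginv g (slice z) 0 0 ≠ 0 := by
  intro h0
  have h1 := h.ginv_zero_zero hz
  rw [h0, zero_mul] at h1
  linarith [h.l_pos]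

theorem ginv_symm (h : IsBoundaryModel S g σ τ l r) {x : Coord 4} (hx : x ∈ S) (a b : Fin 4) : ginv g x a b = ginv g x b a := by
  have h1 := congrArg (ev ⟨x, hx⟩) (h.mc.gi_symm a b)
  simpa only [mc, ev_gi] using h1

theorem sum_ginv_mul (h : IsBoundaryModel S g σ τ l r) {x : Coord 4} (hx : x ∈ S) (a b : Fin 4) :
    ∑ e, ginv g x a e * g x e b = if a = b then 1 else 0 := by
  have h1 := congrArg (ev ⟨x, hx⟩) (h.mc.gi_mul_g a b)
  simpa only [map_sum, map_mul, mc, ev_gi, h.metric.ev_g, apply_ite (ev _), map_one, map_zero]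
    using h1

theorem sum_hInv_mul (h : IsBoundaryModel S g σ τ l r) (hz : z ∈ bdryDom S) (α : Fin 3) (b : Fin 4) :
    ∑ ε : Fin 3, hInv (ginv g (slice z)) α.succ ε.succ * g (slice z) ε.succ b
      = (if α.succ = b then 1 else 0)
        - ginv g (slice z) α.succ 0 / ginv g (slice z) 0 0 * (if 0 = b then 1 else 0) := by
  rw [← h.sum_ginv_mul hz, ← h.sum_ginv_mul hz]
  have h1 : ∑ e : Fin 4, hInv (ginv g (slice z)) α.succ e * g (slice z) e b
      = ∑ ε : Fin 3, hInv (ginv g (slice z)) α.succ ε.succ * g (slice z) ε.succ b := by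
    rw [sum_fin_four_eq, hInv_zero_right (h.ginv_zero_zero_ne hz), zero_mul, zero_add]
  rw [← h1]
  simp only [hInv, Finset.mul_sum, ← Finset.sum_sub_distrib, h.ginv_symm hz 0]
  exact Finset.sum_congr rfl fun e _ => by ring

theorem hInv_mul_gbar (h : IsBoundaryModel S g σ τ l r) (hz : z ∈ bdryDom S) :
    (Matrix.of fun α β : Fin 3 => hInv (ginv g (slice z)) α.succ β.succ) * Matrix.of (gbar g z)
      = 1 := by
  ext α β
  rw [Matrix.mul_apply]
  simp only [Matrix.of_apply, gbar, h.sum_hInv_mul hz, Matrix.one_apply]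
  simp [(Fin.succ_ne_zero β).symm]

/-- The inverse of a block of `g` is the Schur complement of the complementary block in `g⁻¹`. -/
theorem ginv_gbar (h : IsBoundaryModel S g σ τ l r) (hz : z ∈ bdryDom S) (α β : Fin 3) :
    ginv (gbar g) z α β = hInv (ginv g (slice z)) α.succ β.succ := by
  rw [ginv, Matrix.inv_eq_left_inv (h.hInv_mul_gbar hz)]; rfl

/-- At the boundary the integrability condition annihilates the gradient contraction of the Weyl
tensor; the gradient is a nonzero multiple of `g^{a0}`, so `weyl_four_eq_zero` applies. -/
theorem weyl_bdry (h : IsBoundaryModel S g σ τ l r) (hz : z ∈ bdryDom S) (a b c d : Fin 4) : weyl S g (slice z) a b c d = 0 := by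
  have hs := h.scale.P_symm
  have hw : ∀ a b c d, ev (bpt hz) (h.mc.weylT h.scale.P a b c d) = weyl S g (slice z) a b c d :=
    fun a b c d => h.metric.ev_weylT _ (bpt hz) a b c d
  refine weyl_four_eq_zero (C := weyl S g (slice z)) (h.ginv_symm hz) (h.ginv_zero_zero_ne hz) ?_
    ?_ ?_ ?_ ?_ ?_ a b c d
  · exact left_ne_zero_of_mul (b := (Matrix.of (gbar g z)).det) (by
      rw [← Matrix.det_mul, h.hInv_mul_gbar hz, Matrix.det_one]; exact one_ne_zero)
  · intro a b c d
    rw [← hw, ← hw, ← map_neg, ← weylT_antisymm_left]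
  · intro a b c d
    rw [← hw, ← hw, ← map_neg, ← weylT_antisymm_right]
  · intro a b c d
    rw [← hw, ← hw, h.mc.weylT_pair hs]
  · intro b d
    have h1 := congrArg (ev (bpt hz)) (h.mc.tr_weylT h.scale.schouten b d)
    simp only [tr, map_sum, map_mul, map_zero, hw] at h1
    simp only [mc, ev_gi] at h1
    exact h1
  · intro a b d
    have h1 := h.scale.map_weylT_contract (h.ev_bdry_sig hz) a b d
    simp only [hw, h.ev_bdry_U hz] at h1
    have h2 : ev (bpt hz) (h.scale.u 0) ≠ 0 := by
      intro h0
      have h3 := h.ginv_zero_zero hz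
      rw [h0] at h3
      simp at h3
      linarith [h.l_pos]
    refine (mul_eq_zero.mp ?_).resolve_right h2
    rw [Finset.sum_mul, ← h1]
    exact Finset.sum_congr rfl fun c _ => by ring

theorem cottonN_eq (α β : Fin 3) :
    cottonN S g σ l z α β = ev (bpt hz) (h.scale.B α.succ β.succ) / √l := by
  have hc : ∀ a b c, ev (bpt hz) (h.mc.cot h.scale.P a b c) = cotton S g (slice z) a b c :=
    fun a b c => h.metric.ev_cot _ (bpt hz) a b c
  have hU : ∀ c, nUp S g σ l (slice z) c = ev (bpt hz) (h.scale.U c) / √l :=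
    fun c => h.nUp_eq (bpt hz) c
  simp only [cottonN, EinsteinScale.B, map_sum, map_mul, hc, hU, Finset.sum_div, mul_div_assoc]

theorem cottonN_symm (h : IsBoundaryModel S g σ τ l r) (hz : z ∈ bdryDom S) (α β : Fin 3) : cottonN S g σ l z α β = cottonN S g σ l z β α := by
  rw [h.cottonN_eq hz, h.cottonN_eq hz,
    h.scale.map_B_symm (h.ev_bdry_sig hz) (h.ev_bdry_u hz α) (h.ev_bdry_u hz β)]

theorem weylMag_bdry (h : IsBoundaryModel S g σ τ l r) (hz : z ∈ bdryDom S) (α β γ : Fin 3) : weylMag S g σ l z α β γ = 0 := by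
  simp [weylMag, h.weyl_bdry hz]

/-- The Weyl tensor vanishes along the entire boundary, so its tangential derivatives vanish too and
only the Cotton term, already symmetric, is left. -/
theorem fourthFF_eq (h : IsBoundaryModel S g σ τ l r) (hz : z ∈ bdryDom S) (α β : Fin 3) :
    fourthFF S g σ l z α β = -l * cottonN S g σ l z α β := by
  have h1 : weylEl S g σ l z α β = 0 := by simp [weylEl, h.weyl_bdry hz]
  have h2 : ∀ δ α β γ, cov3 (bdryDom S) (gbar g)
      (fun y α' β' γ' => (weylMag S g σ l y α' β' γ' + weylMag S g σ l y β' α' γ') / 2)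
      z δ α β γ = 0 := by
    intro δ α β γ
    have h3 : pd (bdryDom S) (fun y =>
        (weylMag S g σ l y α β γ + weylMag S g σ l y β α γ) / 2) z δ = 0 := by
      rw [← pd_const (S := bdryDom S) 0 z δ]
      exact pd_congr (fun y hy => by simp [h.weylMag_bdry hy]) hz δ
    simp [cov3, h3, h.weylMag_bdry hz]
  simp only [fourthFF, h1, h2, h.cottonN_symm hz β α, mul_zero, Finset.sum_const_zero]
  ring

/-- Writing the inverse induced metric as a Schur complement subtracts a multiple of the normal with
coefficient `Γ^0`. The `d = 0` term of the sum has coefficient zero, so no normal derivatives of the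
metric enter the induced symbols. -/
theorem christoffel_gbar (h : IsBoundaryModel S g σ τ l r) (hz : z ∈ bdryDom S) (ε γ β : Fin 3) :
    christoffel S g (slice z) ε.succ γ.succ β.succ
      = christoffel (bdryDom S) (gbar g) z ε γ β
        + christoffel S g (slice z) 0 γ.succ β.succ / ginv g (slice z) 0 0
          * ginv g (slice z) ε.succ 0 := by
  have hpd : ∀ i a b, pd (bdryDom S) (fun y => gbar g y a b) z i
      = pd S (fun y => g y a.succ b.succ) (slice z) i.succ :=
    fun i a b => h.domain.pd_slice (h.metric.smooth _ _) hz i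
  have h1 : christoffel (bdryDom S) (gbar g) z ε γ β
      = 1 / 2 * ∑ d, hInv (ginv g (slice z)) ε.succ d *
        (pd S (fun y => g y β.succ d) (slice z) γ.succ
          + pd S (fun y => g y γ.succ d) (slice z) β.succ
          - pd S (fun y => g y γ.succ β.succ) (slice z) d) := by
    rw [sum_fin_four_eq, hInv_zero_right (h.ginv_zero_zero_ne hz), zero_mul, zero_add]
    simp only [christoffel, hpd, h.ginv_gbar hz]
  rw [h1]
  simp only [christoffel, hInv, sub_mul, Finset.sum_sub_distrib, h.ginv_symm hz 0]
  simp only [Finset.mul_sum, Finset.sum_mul, Finset.sum_div, mul_sub]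
  rw [← sub_eq_zero]
  simp only [← Finset.sum_sub_distrib, ← Finset.sum_add_distrib]
  refine Finset.sum_eq_zero fun d _ => ?_
  ring

/-- The divergence of the fourth conformal fundamental form in terms of the normal derivative of
the Cotton tensor. -/
theorem divFourthFF_eq (δ : Fin 3) :
    divFourthFF S g σ l z δ
      = -ev (bpt hz) (∑ e, h.scale.U e * h.mc.D e (h.scale.W δ.succ)) / √l := by
  set φ := ev (bpt hz) with hφ
  have hl : 0 < √l := Real.sqrt_pos.mpr h.l_pos
  have hu0 := h.ginv_zero_zero hz
  rw [← hφ] at hu0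
  have hg0 := h.ginv_zero_zero_ne hz
  have hune : φ (h.scale.u 0) ≠ 0 := by
    intro h0
    rw [h0] at hu0
    simp at hu0
    linarith [h.l_pos]
  -- The fourth form is `-√l B` at every boundary point, not only at `z`, so its tangential
  -- derivatives are those of the ambient smooth function `-√l B`.
  have hX : ∀ (y : Coord 3) (hy : y ∈ bdryDom S) (α β : Fin 3), fourthFF S g σ l y α β
      = (algebraMap ℝ _ (-√l) * h.scale.B β.succ α.succ : smoothFun S).1 (bpt hy) := by
    intro y hy α β
    change _ = ev (bpt hy) (algebraMap ℝ _ (-√l) * h.scale.B β.succ α.succ)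
    rw [h.fourthFF_eq hy, h.cottonN_symm hy, h.cottonN_eq hy, map_mul, ev_algebraMap]
    field_simp
    rw [Real.sq_sqrt h.l_pos.le]
    ring
  have hXz : ∀ α β : Fin 3, fourthFF S g σ l z α β = -√l * φ (h.scale.B β.succ α.succ) :=
    fun α β => hX z hz α β
  have hpd : ∀ i α β, pd (bdryDom S) (fun y => fourthFF S g σ l y α β) z i
      = -√l * φ (h.mc.D i.succ (h.scale.B β.succ α.succ)) := by
    intro i α β
    let f : smoothFun S := algebraMap ℝ _ (-√l) * h.scale.B β.succ α.succ
    have h1 : pd (bdryDom S) (fun y => fourthFF S g σ l y α β) z i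
        = pd (bdryDom S) (fun y => rep f (slice y)) z i :=
      pd_congr (fun y hy => by rw [hX y hy]; exact (rep_apply f (bpt hy)).symm) hz i
    rw [h1, h.domain.pd_slice (contDiffOn_rep f) hz]
    have h2 := h.metric.ev_D' h.domain.isCoordDomain f (F := rep f) (rep_apply f) (bpt hz) i.succ
    have h3 : h.mc.D i.succ f = algebraMap ℝ _ (-√l) * h.mc.D i.succ (h.scale.B β.succ α.succ) := by
      rw [Derivation.leibniz, Derivation.map_algebraMap]; simp
    change ev (bpt hz) (h.mc.D i.succ f) = _ at h2
    rw [h3, map_mul, ev_algebraMap] at h2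
    exact h2.symm
  have hgauss := gauss_divergence (gi := ginv g (slice z)) (h.ginv_symm hz) hg0
    (Γ := christoffel S g (slice z)) (Γb := christoffel (bdryDom S) (gbar g) z)
    (h.christoffel_gbar hz) (dB := fun e b d => φ (h.mc.D e (h.scale.B b d)))
    (B := fun b d => φ (h.scale.B b d)) ?_ ?_ δ
  · have h1 : divFourthFF S g σ l z δ = -√l * ∑ β : Fin 3, ∑ γ : Fin 3,
        hInv (ginv g (slice z)) β.succ γ.succ * (φ (h.mc.D γ.succ (h.scale.B β.succ δ.succ))
        - ∑ ε, christoffel (bdryDom S) (gbar g) z ε γ β * φ (h.scale.B ε.succ δ.succ)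
        - ∑ ε, christoffel (bdryDom S) (gbar g) z ε γ δ * φ (h.scale.B β.succ ε.succ)) := by
      simp only [divFourthFF, cov2, hpd, hXz, h.ginv_gbar hz, Finset.mul_sum]
      refine Finset.sum_congr rfl fun β _ => Finset.sum_congr rfl fun γ _ => ?_
      have : ∀ w v : Fin 3 → ℝ, ∑ ε, w ε * (-√l * v ε) = -√l * ∑ ε, w ε * v ε := by
        intro w v; rw [Finset.mul_sum]; exact Finset.sum_congr rfl fun _ _ => by ring
      rw [this, this]
      ring
    rw [h1, hgauss]
    have hn : ∀ e b, φ (h.mc.D e (h.scale.B b δ.succ))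
        - ∑ f, christoffel S g (slice z) f e b * φ (h.scale.B f δ.succ)
        - ∑ f, christoffel S g (slice z) f e δ.succ * φ (h.scale.B b f)
        = φ (h.mc.nabla2 h.scale.B e b δ.succ) := by
      intro e b
      simp only [nabla2, map_sub, map_sum, map_mul]
      simp only [mc, hφ, h.metric.ev_Γ]
      rfl
    simp only [hn]
    have hd := h.scale.map_div_B (h.ev_bdry_sig hz) δ.succ
    have hw := h.scale.map_normal_nabla2_B (h.ev_bdry_sig hz) δ.succ
    rw [← hφ] at hd hw
    simp only [tr, map_sum, map_mul] at hd
    have hgi : ∀ e b, φ (h.mc.gi e b) = ginv g (slice z) e b := fun e b =>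
      h.metric.ev_gi _ (bpt hz) e b
    simp only [hgi] at hd
    have hU : ∀ e, φ (h.scale.U e) = ginv g (slice z) e 0 * φ (h.scale.u 0) := h.ev_bdry_U hz
    rw [← hw]
    simp only [hU, sub_mul, Finset.sum_sub_distrib, hd]
    -- As `g^00 (∂_0σ)² = -l`, the normal projector `g^{e0} g^{b0} / g^00` is `-σ^e σ^b / l`; the
    -- double normal part of `∇B` is thus the normal derivative of `W` up to this factor.
    have h2 : ∑ e, ∑ b, ginv g (slice z) e 0 * φ (h.scale.u 0)
          * (ginv g (slice z) b 0 * φ (h.scale.u 0)) * φ (h.mc.nabla2 h.scale.B e b δ.succ)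
        = -l * ∑ e, ∑ b, ginv g (slice z) e 0 * ginv g (slice z) b 0 / ginv g (slice z) 0 0
          * φ (h.mc.nabla2 h.scale.B e b δ.succ) := by
      rw [← hu0]
      simp only [Finset.mul_sum]
      refine Finset.sum_congr rfl fun e _ => Finset.sum_congr rfl fun b _ => ?_
      field_simp
    rw [h2]
    field_simp
    rw [Real.sq_sqrt h.l_pos.le]
    ring
  -- Tangentiality of `B`: in the first slot it is the vanishing of `W` on the boundary, and in the
  -- second (next goal) the antisymmetry of the Cotton tensor.
  · intro d
    have h1 := h.scale.map_W (h.ev_bdry_sig hz) d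
    rw [EinsteinScale.W, map_sum] at h1
    simp only [map_mul, h.ev_bdry_U hz] at h1
    refine (mul_eq_zero.mp ?_).resolve_right hune
    rw [Finset.sum_mul, ← h1]
    exact Finset.sum_congr rfl fun b _ => by ring
  · intro b
    have h1 := congrArg φ (h.scale.B_contract_right b)
    rw [map_sum, map_zero] at h1
    simp only [map_mul, hφ, h.ev_bdry_U hz] at h1
    refine (mul_eq_zero.mp ?_).resolve_right hune
    rw [Finset.sum_mul, ← h1]
    exact Finset.sum_congr rfl fun b _ => by ring

end BoundaryPoint

end IsBoundaryModel

/-! ### From the source `E` back to the stress-energy tensor. -/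

open smoothFun IsSmoothMetric MetricCalculus

namespace IsBoundaryModel

variable {S : Set (Coord 4)} {g τ : Coord 4 → Fin 4 → Fin 4 → ℝ} {σ : Coord 4 → ℝ} {l : ℝ} {r : ℕ}
  (h : IsBoundaryModel S g σ τ l r)

/-- `τ_{ab} σ^b`. -/
def stressU (a : Fin 4) : smoothFun S := ∑ b, h.stress a b * h.scale.U b

/-- The divergence of the rescaled stress-energy tensor. -/
def divStress (a : Fin 4) : smoothFun S := h.mc.tr fun c b => h.mc.nabla2 h.stress c a b

theorem two_mul_source (a b : Fin 4) : 2 * h.source a b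
    = h.stress a b + -(algebraMap ℝ _ (1 / 3) * h.mc.tr h.stress) * h.mc.g a b := by
  have h2 : (2 : smoothFun S) * algebraMap ℝ _ (1 / 2) = 1 := by
    rw [← map_ofNat (algebraMap ℝ (smoothFun S)) 2, ← map_mul]; norm_num
  rw [source]
  linear_combination (h.stress a b
    - algebraMap ℝ _ (1 / 3) * h.mc.tr h.stress * h.mc.g a b) * h2

theorem three_mul_third : (3 : smoothFun S) * algebraMap ℝ _ (1 / 3) = 1 := by
  rw [← map_ofNat (algebraMap ℝ (smoothFun S)) 3, ← map_mul]; norm_num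

theorem tr_source : 6 * h.mc.tr h.source = -h.mc.tr h.stress := by
  have h1 : h.mc.tr (fun a b => 2 * h.source a b) = _ := congrArg h.mc.tr
    (funext fun a => funext fun b => h.two_mul_source a b)
  rw [tr_mul, tr_add, tr_mul] at h1
  change 2 * h.mc.tr h.source = h.mc.tr h.stress + _ * h.mc.tr h.mc.g at h1
  rw [tr_g] at h1
  linear_combination 3 * h1 - 4 * h.mc.tr h.stress * three_mul_third (S := S)

theorem scale_EU (a : Fin 4) : 6 * h.scale.EU a
    = 3 * h.stressU a - h.mc.tr h.stress * h.scale.u a := by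
  have h1 : 2 * h.scale.EU a = ∑ b, (2 * h.source a b) * h.scale.U b := by
    rw [EinsteinScale.EU, Finset.mul_sum]
    exact Finset.sum_congr rfl fun b _ => (mul_assoc _ _ _).symm
  have h2 : ∑ b, h.mc.g a b * h.scale.U b = h.scale.u a := h.mc.g_mul_raise _ a
  simp only [h.two_mul_source, add_mul, Finset.sum_add_distrib, mul_assoc, ← Finset.mul_sum,
    h2] at h1
  rw [stressU]
  linear_combination 3 * h1 - h.mc.tr h.stress * h.scale.u a * three_mul_third (S := S)

theorem scale_divE (a : Fin 4) : 6 * h.scale.divE a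
    = 3 * h.divStress a - h.mc.D a (h.mc.tr h.stress) := by
  set k := -(algebraMap ℝ (smoothFun S) (1 / 3) * h.mc.tr h.stress) with hk
  have h1 : 2 * h.scale.divE a = h.divStress a + h.mc.D a k := by
    have e : ∀ c b, 2 * h.mc.nabla2 h.source c a b
        = h.mc.nabla2 h.stress c a b + h.mc.D c k * h.mc.g a b := by
      intro c b
      have e1 : h.mc.nabla2 (fun a b => 2 * h.source a b) c a b
          = h.mc.nabla2 (fun a b => h.stress a b + k * h.mc.g a b) c a b := by
        congr 1; funext a b; exact h.two_mul_source a b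
      rw [nabla2_mul, nabla2_add, nabla2_mul, nabla2_g] at e1
      have e2 : h.mc.D c (2 : smoothFun S) = 0 := (h.mc.D c).map_natCast 2
      rw [e2] at e1
      linear_combination e1
    calc 2 * h.scale.divE a = h.mc.tr (fun c b => 2 * h.mc.nabla2 h.source c a b) := by
          rw [tr_mul]; rfl
      _ = h.mc.tr (fun c b => h.mc.nabla2 h.stress c a b + h.mc.D c k * h.mc.g a b) := by
          simp only [e]
      _ = _ := by rw [tr_add, tr_mul_g]; rfl
  have h2 : h.mc.D a k = -(algebraMap ℝ (smoothFun S) (1 / 3) * h.mc.D a (h.mc.tr h.stress)) := by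
    rw [hk, map_neg, Derivation.leibniz, Derivation.map_algebraMap]; simp
  rw [h2] at h1
  linear_combination 3 * h1 - h.mc.D a (h.mc.tr h.stress) * three_mul_third (S := S)

/-- The conservation law for `r = 0` rewritten from `E` to `τ`. It shows that `τ_ab σ^b` is normal
up to `σ` times the divergence of `τ`, with no error term. -/
theorem stressU_eq (h : IsBoundaryModel S g σ τ l 0) (a : Fin 4) :
    h.stressU a = h.scale.u a * h.mc.tr h.stress + h.sig * h.divStress a := by
  have h1 : -h.scale.EU a - 2 * h.scale.u a * h.mc.tr h.source
      + h.sig * (h.scale.divE a - h.mc.D a (h.mc.tr h.source)) = 0 := by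
    have h0 := h.scale.conservation a
    have hr : h.scale.r = 0 := rfl
    rw [hr] at h0
    push_cast at h0
    have hE : h.scale.E = h.source := rfl
    have hs : h.scale.σ = h.sig := rfl
    rw [hE, hs] at h0
    linear_combination h0
  have h2 : 6 * h.mc.D a (h.mc.tr h.source) = -h.mc.D a (h.mc.tr h.stress) := by
    have e := congrArg (h.mc.D a) h.tr_source
    rw [Derivation.leibniz, map_neg] at e
    have e2 : h.mc.D a (6 : smoothFun S) = 0 := (h.mc.D a).map_natCast 6
    rw [e2] at e
    simpa using e
  have h3 : 3 * (h.stressU a) = 3 * (h.scale.u a * h.mc.tr h.stress + h.sig * h.divStress a) := by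
    linear_combination -6 * h1 - h.scale_EU a - 2 * h.scale.u a * h.tr_source
      + h.sig * h.scale_divE a - h.sig * h2
  have h4 := congrArg (algebraMap ℝ (smoothFun S) (1 / 3) * ·) h3
  linear_combination h4 + (h.scale.u a * h.mc.tr h.stress + h.sig * h.divStress a
    - h.stressU a) * three_mul_third (S := S)

theorem stressN_eq (x : S) (a : Fin 4) : stressN S g σ l τ x a = ev x (h.stressU a) / √l := by
  simp only [stressN, h.nUp_eq, stressU, map_sum, map_mul, ev_stress, Finset.sum_div,
    mul_div_assoc]

theorem stressNT_eq (x : S) (a : Fin 4) : stressNT S g σ l τ x a = 1 / √l * (ev x (h.stressU a)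
    - ev x (h.scale.u a) * ev x (∑ c, h.stressU c * h.scale.U c) / ev x h.scale.nn) := by
  have hl : √l ≠ 0 := (Real.sqrt_pos.mpr h.l_pos).ne'
  have h1 : ∑ c, stressN S g σ l τ x c * nUp S g σ l x c
      = ev x (∑ c, h.stressU c * h.scale.U c) / (√l * √l) := by
    simp only [h.stressN_eq, h.nUp_eq, map_sum, map_mul, Finset.sum_div]
    exact Finset.sum_congr rfl fun c _ => by rw [div_mul_div_comm]
  have h2 : ∑ c, nLow S σ l x c * nUp S g σ l x c = ev x h.scale.nn / (√l * √l) := by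
    simp only [h.nLow_eq, h.nUp_eq, EinsteinScale.nn, map_sum, map_mul, Finset.sum_div]
    exact Finset.sum_congr rfl fun c _ => by rw [div_mul_div_comm]
  rw [stressNT, h1, h2, h.stressN_eq, h.nLow_eq, mul_div_assoc, div_div_div_cancel_right₀
    (mul_ne_zero hl hl)]
  ring

theorem stressNT_bdry {z : Coord 3} (hz : z ∈ bdryDom S) (α : Fin 3) :
    stressNT S g σ l τ (slice z) α.succ = ev (bpt hz) (h.stressU α.succ) / √l := by
  have h1 := h.stressNT_eq (bpt hz) α.succ
  rw [h.ev_bdry_u hz] at h1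
  change stressNT S g σ l τ (slice z) α.succ = _ at h1
  rw [h1]; ring

theorem pd_bdry {z : Coord 3} (hz : z ∈ bdryDom S) (f : smoothFun S) {F : Coord 3 → ℝ}
    (hF : ∀ (y : Coord 3) (hy : y ∈ bdryDom S), F y = ev (bpt hy) f) (α : Fin 3) :
    pd (bdryDom S) F z α = ev (bpt hz) (h.mc.D α.succ f) := by
  have h1 : pd (bdryDom S) F z α = pd (bdryDom S) (fun y => rep f (slice y)) z α :=
    pd_congr (fun y hy => by rw [hF y hy]; exact (rep_apply f (bpt hy)).symm) hz α
  rw [h1, h.domain.pd_slice (contDiffOn_rep f) hz]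
  exact (h.metric.ev_D' h.domain.isCoordDomain f (F := rep f) (rep_apply f) (bpt hz) α.succ).symm

theorem divFourthFF_of_one (h : IsBoundaryModel S g σ τ l 1) {z : Coord 3} (hz : z ∈ bdryDom S)
    (α : Fin 3) :
    divFourthFF S g σ l z α = -l ^ 2 * stressNT S g σ l τ (slice z) α.succ := by
  have h1 := h.scale.map_normal_deriv_W_of_pos (h.ev_bdry_sig hz) rfl (h.ev_bdry_u hz α)
  have h2 := congrArg (ev (bpt hz)) (h.scale_EU α.succ)
  simp only [map_mul, map_sub, map_ofNat, h.ev_bdry_u hz, mul_zero, sub_zero] at h2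
  have h3 : ev (bpt hz) h.scale.lam = l := rfl
  rw [h.divFourthFF_eq hz, h1, h.stressNT_bdry hz, h3]
  have h4 : ev (bpt hz) (h.stressU α.succ) = 2 * ev (bpt hz) (h.scale.EU α.succ) := by linarith
  rw [h4]; ring

section RadiativeDecay

variable (h : IsBoundaryModel S g σ τ l 0)

/-- The leading coefficient of `τ^⊤_{an}`. -/
def stressCoeff (x : Coord 4) (a : Fin 4) : ℝ :=
  1 / √l * (rep (h.divStress a) x - rep (h.scale.u a) x *
    rep (∑ c, h.divStress c * h.scale.U c) x / rep h.scale.nn x)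

/-- By `stressU_eq` the leading part is a multiple of the conormal, which the projection removes; an
exact factor `σ` remains wherever the gradient is not null. -/
theorem stressNT_eq_of_zero (x : S) (hx : ev x h.scale.nn ≠ 0) (a : Fin 4) :
    stressNT S g σ l τ x a = σ x * h.stressCoeff x a := by
  have h1 : ∑ c, h.stressU c * h.scale.U c = h.scale.nn * h.mc.tr h.stress
      + h.sig * ∑ c, h.divStress c * h.scale.U c := by
    simp only [h.stressU_eq, EinsteinScale.nn, Finset.sum_mul, Finset.mul_sum,
      ← Finset.sum_add_distrib]
    exact Finset.sum_congr rfl fun c _ => by ring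
  rw [h.stressNT_eq, h1, h.stressU_eq, stressCoeff]
  simp only [rep_apply, map_add, map_mul, ev_sig]
  field_simp
  ring

variable {z : Coord 3} (hz : z ∈ bdryDom S)

theorem nn_bdry : ev (bpt hz) h.scale.nn ≠ 0 := by
  rw [h.scale.map_nn (h.ev_bdry_sig hz)]
  have : ev (bpt hz) h.scale.lam = l := rfl
  rw [this]
  exact neg_ne_zero.mpr h.l_pos.ne'

theorem stressNT_bdry_of_zero (h : IsBoundaryModel S g σ τ l 0) (hz : z ∈ bdryDom S) (a : Fin 4) :
    stressNT S g σ l τ (slice z) a = 0 := by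
  have h1 := h.stressNT_eq_of_zero (bpt hz) (h.nn_bdry hz) a
  change stressNT S g σ l τ (slice z) a = σ (slice z) * _ at h1
  rw [h1, h.σ_eq_zero _ hz (slice_zero z), zero_mul]

theorem stressCoeff_bdry (α : Fin 3) :
    h.stressCoeff (slice z) α.succ = ev (bpt hz) (h.divStress α.succ) / √l := by
  have h1 : rep (h.scale.u α.succ) (slice z) = 0 :=
    (rep_apply _ (bpt hz)).trans (h.ev_bdry_u hz α)
  have h2 : rep (h.divStress α.succ) (slice z) = ev (bpt hz) (h.divStress α.succ) :=
    rep_apply _ (bpt hz)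
  rw [stressCoeff, h1, h2]; ring

theorem exists_stressCoeff_contDiffOn (h : IsBoundaryModel S g σ τ l 0) (hz : z ∈ bdryDom S) :
    ∃ V ∈ 𝓝[S] slice z, V ⊆ S ∧ (∀ x ∈ V, ∀ a, stressNT S g σ l τ x a = σ x * h.stressCoeff x a) ∧
      ∀ a, ContDiffOn ℝ ∞ (fun x => h.stressCoeff x a) V := by
  refine ⟨{x ∈ S | rep h.scale.nn x ≠ 0}, ?_, fun x hx => hx.1, ?_, ?_⟩
  · have hc : ContinuousWithinAt (rep h.scale.nn) S (slice z) :=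
      (contDiffOn_rep h.scale.nn).continuousOn _ hz
    have h0 : rep h.scale.nn (slice z) ≠ 0 := by
      rw [show rep h.scale.nn (slice z) = _ from rep_apply _ (bpt hz)]; exact h.nn_bdry hz
    filter_upwards [hc.eventually_ne h0, self_mem_nhdsWithin] with x h1 h2
    exact ⟨h2, h1⟩
  · intro x hx a
    exact h.stressNT_eq_of_zero ⟨x, hx.1⟩ (by rw [← rep_apply]; exact hx.2) a
  · intro a
    have hs : ∀ f : smoothFun S, ContDiffOn ℝ ∞ (rep f) {x ∈ S | rep h.scale.nn x ≠ 0} :=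
      fun f => (contDiffOn_rep f).mono fun x hx => hx.1
    exact contDiffOn_const.mul ((hs _).sub (((hs _).mul (hs _)).div (hs _) fun x hx => hx.2))

theorem isStressExpansion_stressCoeff (hz : z ∈ bdryDom S) :
    IsStressExpansion S g σ l τ h.stressCoeff (slice z) := by
  obtain ⟨V, hV, hVS, h1, h2⟩ := h.exists_stressCoeff_contDiffOn hz
  intro a
  refine ⟨?_, ?_⟩
  · exact ((h2 a).continuousOn _ (mem_of_mem_nhdsWithin hz hV)).mono_of_mem_nhdsWithin hV
  · refine Filter.EventuallyEq.trans_isBigO ?_ (Asymptotics.isBigO_zero _ _)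
    filter_upwards [hV] with x hx
    rw [h1 x hx]; simp

/-- Two coefficients satisfy `σ (j - k) = O(σ²)`; dividing by `σ` where it is nonzero and letting
the point tend to the boundary gives equality there by continuity. Thus the divergence formula need
be checked for one coefficient only. -/
theorem stressExpansion_unique (h : IsBoundaryModel S g σ τ l 0) (hz : z ∈ bdryDom S)
    {j k : Coord 4 → Fin 4 → ℝ} (hj : IsStressExpansion S g σ l τ j (slice z))
    (hk : IsStressExpansion S g σ l τ k (slice z)) (a : Fin 4) :
    j (slice z) a = k (slice z) a := by
  have hsub : posPart S ⊆ S := inter_subset_left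
  have hne : (𝓝[posPart S] slice z).NeBot :=
    mem_closure_iff_nhdsWithin_neBot.mp (h.domain.subset_closure_posPart hz)
  have h1 : (fun x => σ x * (j x a - k x a)) =O[𝓝[posPart S] slice z] fun x => σ x * σ x := by
    have := ((hk a).2.sub (hj a).2).mono (nhdsWithin_mono _ hsub)
    refine (this.congr (fun x => ?_) fun x => ?_) <;> ring
  have h2 : (fun x => j x a - k x a) =O[𝓝[posPart S] slice z] σ := by
    obtain ⟨c, hc⟩ := h1.bound
    refine Asymptotics.IsBigO.of_bound c ?_
    filter_upwards [hc, self_mem_nhdsWithin] with x hx hxp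
    rw [norm_mul, norm_mul] at hx
    have : 0 < ‖σ x‖ := norm_pos_iff.mpr (h.σ_ne_zero x hxp)
    refine le_of_mul_le_mul_left ?_ this
    linarith
  have h3 : Filter.Tendsto σ (𝓝[posPart S] slice z) (𝓝 0) := by
    have := (h.smooth_σ.continuousOn _ hz).mono hsub
    rwa [ContinuousWithinAt, h.σ_eq_zero _ hz (slice_zero z)] at this
  have h4 := h2.trans_tendsto h3
  have h5 : Filter.Tendsto (fun x => j x a - k x a) (𝓝[posPart S] slice z)
      (𝓝 (j (slice z) a - k (slice z) a)) :=
    ((hj a).1.sub (hk a).1).mono hsub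
  exact sub_eq_zero.mp (tendsto_nhds_unique h5 h4)

theorem divFourthFF_of_zero (h : IsBoundaryModel S g σ τ l 0) (hz : z ∈ bdryDom S)
    {j : Coord 4 → Fin 4 → ℝ} (hj : IsStressExpansion S g σ l τ j (slice z)) (α : Fin 3) :
    divFourthFF S g σ l z α = -l ^ 2 * j (slice z) α.succ
      + l ^ (3 / 2 : ℝ) / 3 * pd (bdryDom S) (fun y => trace g τ (slice y)) z α := by
  have hl : √l ≠ 0 := (Real.sqrt_pos.mpr h.l_pos).ne'
  have hlp : l ^ (3 / 2 : ℝ) = l * √l := by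
    rw [Real.sqrt_eq_rpow, show (3 / 2 : ℝ) = 1 + 1 / 2 by norm_num, Real.rpow_add h.l_pos,
      Real.rpow_one]
  have h1 := h.scale.map_normal_deriv_W_of_zero (h.ev_bdry_sig hz) rfl (h.ev_bdry_u hz α)
  have h2 := congrArg (ev (bpt hz)) (h.scale_divE α.succ)
  simp only [map_mul, map_sub, map_ofNat] at h2
  have h3 : ev (bpt hz) h.scale.lam = l := rfl
  rw [h.divFourthFF_eq hz, h1, h3, h.pd_bdry hz (h.mc.tr h.stress)
    (fun y hy => (h.ev_tr_stress (bpt hy)).symm), hlp,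
    h.stressExpansion_unique hz hj (h.isStressExpansion_stressCoeff hz), h.stressCoeff_bdry hz]
  -- The divergence of `τ` accounts for the term in `j`, and the trace part of `E` for the gradient
  -- of `τ` along the boundary.
  have h4 : ev (bpt hz) (h.scale.divE α.succ) = 1 / 6 * (3 * ev (bpt hz) (h.divStress α.succ)
      - ev (bpt hz) (h.mc.D α.succ (h.mc.tr h.stress))) := by linarith
  rw [h4]
  have h5 : √l ^ 2 = l := Real.sq_sqrt h.l_pos.le
  field_simp
  rw [h5]
  ring

end RadiativeDecay

end IsBoundaryModel

/-! ### Boundary charts -/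

section Charts

theorem isHalfDomain_extend_target {M : Type*} [TopologicalSpace M]
    (e : OpenPartialHomeomorph M (EuclideanHalfSpace 4)) : IsHalfDomain (e.extend (𝓡∂ 4)).target :=
  ⟨(𝓡∂ 4).symm ⁻¹' e.target, e.open_target.preimage (𝓡∂ 4).continuous_symm, by
    rw [e.extend_target, range_modelWithCornersEuclideanHalfSpace]⟩

variable {M : Type*} [TopologicalSpace M] [ChartedSpace (EuclideanHalfSpace 4) M]
  {e : OpenPartialHomeomorph M (EuclideanHalfSpace 4)}

theorem contMDiffOn_extend_symm_target (he : e ∈ IsManifold.maximalAtlas (𝓡∂ 4) ∞ M) :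
    ContMDiffOn 𝓘(ℝ, Coord 4) (𝓡∂ 4) ∞ (e.extend (𝓡∂ 4)).symm (e.extend (𝓡∂ 4)).target := by
  rw [e.extend_target']
  exact contMDiffOn_extend_symm he

/-- A point is a boundary point if and only if it lies on the boundary of the half-space in any
given chart of the smooth structure. -/
theorem mem_boundary_iff [IsManifold (𝓡∂ 4) ∞ M] (he : e ∈ IsManifold.maximalAtlas (𝓡∂ 4) ∞ M)
    {p : M} (hp : p ∈ e.source) : p ∈ (𝓡∂ 4).boundary M ↔ e.extend (𝓡∂ 4) p 0 = 0 := by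
  let Φ : PartialDiffeomorph (𝓡∂ 4) (𝓡∂ 4) M (EuclideanHalfSpace 4) ∞ :=
    { toPartialEquiv := e.toPartialEquiv
      open_source := e.open_source
      open_target := e.open_target
      contMDiffOn_toFun := contMDiffOn_of_mem_maximalAtlas he
      contMDiffOn_invFun := contMDiffOn_symm_of_mem_maximalAtlas he }
  have h1 : (𝓡∂ 4).IsBoundaryPoint p ↔ (𝓡∂ 4).IsBoundaryPoint (e p) :=
    IsLocalDiffeomorphAt.isBoundaryPoint_iff (n := ∞) (by simp) ⟨Φ, hp, eqOn_refl _ _⟩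
  change (𝓡∂ 4).IsBoundaryPoint p ↔ _
  rw [h1, ModelWithCorners.isBoundaryPoint_iff, frontier_range_modelWithCornersEuclideanHalfSpace]
  simp only [mfld_simps, mem_ofPred_eq]
  exact eq_comm

/-- The coordinate vectors are linearly independent and span the tangent space. -/
theorem bijective_mfderivWithin_extend_symm (he : e ∈ IsManifold.maximalAtlas (𝓡∂ 4) ∞ M)
    [IsManifold (𝓡∂ 4) ∞ M]
    {x : Coord 4} (hx : x ∈ (e.extend (𝓡∂ 4)).target) :
    Function.Bijective (mfderivWithin 𝓘(ℝ, Coord 4) (𝓡∂ 4) (e.extend (𝓡∂ 4)).symm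
      (e.extend (𝓡∂ 4)).target x) := by
  set S := (e.extend (𝓡∂ 4)).target
  set ψ := e.extend (𝓡∂ 4)
  have hu : UniqueMDiffWithinAt 𝓘(ℝ, Coord 4) S x :=
    ((isHalfDomain_extend_target e).isCoordDomain.uniqueDiffOn x hx).uniqueMDiffWithinAt
  have hs : ψ.symm x ∈ e.source := by
    have := ψ.map_target hx
    rwa [e.extend_source] at this
  have h1 : MDifferentiableWithinAt 𝓘(ℝ, Coord 4) (𝓡∂ 4) ψ.symm S x :=
    (contMDiffOn_extend_symm_target he x hx).mdifferentiableWithinAt (by simp)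
  have h2 : MDifferentiableAt (𝓡∂ 4) 𝓘(ℝ, Coord 4) ψ (ψ.symm x) :=
    (e.contMDiffAt_extend he hs).mdifferentiableAt (by simp)
  have h3 := mfderiv_comp_mfderivWithin x h2 h1 hu
  have h4 := mfderivWithin_congr_of_mem (I := 𝓘(ℝ, Coord 4)) (I' := 𝓘(ℝ, Coord 4))
    (f₁ := ψ ∘ ψ.symm) (f := id) (fun y hy => ψ.right_inv hy) hx
  have h5 := h4.trans (mfderivWithin_id hu)
  let A : Coord 4 →ₗ[ℝ] Coord 4 := (mfderivWithin 𝓘(ℝ, Coord 4) (𝓡∂ 4) ψ.symm S x).toLinearMap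
  have hinj : Function.Injective A := by
    intro v w hvw
    have e1 : ∀ v : Coord 4, v = mfderiv (𝓡∂ 4) 𝓘(ℝ, Coord 4) ψ (ψ.symm x) (A v) :=
      fun v => (DFunLike.congr_fun h5 v).symm.trans (DFunLike.congr_fun h3 v)
    rw [e1 v, e1 w, hvw]
  exact ⟨hinj, (LinearMap.injective_iff_surjective (f := A)).mp hinj⟩

theorem comp_det_ne_zero [IsManifold (𝓡∂ 4) ∞ M] (he : e ∈ IsManifold.maximalAtlas (𝓡∂ 4) ∞ M)
    {g : Tensor2 (𝓡∂ 4) M} (hg : IsLorentzMetric (𝓡∂ 4) g) {x : Coord 4}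
    (hx : x ∈ (e.extend (𝓡∂ 4)).target) : (Matrix.of (comp (𝓡∂ 4) e g x)).det ≠ 0 := by
  intro hdet
  obtain ⟨v, hv, hGv⟩ := Matrix.exists_mulVec_eq_zero_iff.mpr hdet
  obtain ⟨hinj, hsurj⟩ := bijective_mfderivWithin_extend_symm he hx
  let p := (e.extend (𝓡∂ 4)).symm x
  let A : Coord 4 →ₗ[ℝ] TangentSpace (𝓡∂ 4) p := (mfderivWithin 𝓘(ℝ, Coord 4) (𝓡∂ 4)
    (e.extend (𝓡∂ 4)).symm (e.extend (𝓡∂ 4)).target x).toLinearMap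
  let B := g p
  have hsum : ∀ w : Coord 4, w = ∑ i, w i • EuclideanSpace.single i (1 : ℝ) := by
    intro w
    ext j
    simp [Pi.single_apply]
  let w : Coord 4 := WithLp.toLp 2 v
  have h1 : ∀ i, B (A (EuclideanSpace.single i 1)) (A w) = 0 := by
    intro i
    have h2 := congrFun hGv i
    rw [hsum w]
    simp only [map_sum, map_smul, smul_eq_mul]
    refine Eq.trans ?_ h2
    simp only [Matrix.mulVec, dotProduct]
    exact Finset.sum_congr rfl fun j _ => mul_comm _ _
  have h2 : ∀ u, B u (A w) = 0 := by
    intro u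
    obtain ⟨u', rfl⟩ := hsurj u
    change B (A u') (A w) = 0
    rw [hsum u']
    simp only [map_sum, map_smul]
    rw [sum_apply]
    exact Finset.sum_eq_zero fun i _ => by
      rw [smul_apply, h1, smul_zero]
  obtain ⟨b, hb⟩ := hg.signature p
  -- A kernel vector of the component matrix lies in the radical of the metric; testing it against
  -- the orthonormal basis kills each of its coordinates.
  have h3 : A w = 0 := by
    rw [← b.sum_repr (A w)]
    refine Finset.sum_eq_zero fun i _ => ?_
    have h4 := h2 (b i)
    rw [← b.sum_repr (A w)] at h4
    simp only [map_sum, map_smul, smul_eq_mul] at h4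
    have h5 : ∀ j, b.repr (A w) j * B (b i) (b j)
        = if i = j then b.repr (A w) j * (if i = 0 then -1 else 1) else 0 := by
      intro j
      rw [show B (b i) (b j) = _ from hb i j]; split_ifs <;> simp
    simp only [h5, Finset.sum_ite_eq, Finset.mem_univ, if_true] at h4
    rw [(mul_eq_zero.mp h4).resolve_right (by split_ifs <;> norm_num), zero_smul]
  have h6 : w = 0 := hinj (h3.trans (map_zero A).symm)
  exact hv (by simpa [w] using h6)

theorem isSmoothMetric_comp [IsManifold (𝓡∂ 4) ∞ M]
    (he : e ∈ IsManifold.maximalAtlas (𝓡∂ 4) ∞ M)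
    {g : Tensor2 (𝓡∂ 4) M} (hg : IsLorentzMetric (𝓡∂ 4) g) :
    IsSmoothMetric (e.extend (𝓡∂ 4)).target (comp (𝓡∂ 4) e g) where
  smooth := hg.smooth e he
  symm _ _ _ _ := hg.symm _ _ _
  det_ne_zero _ hx := comp_det_ne_zero he hg hx

end Charts

/-! ### Curvature depends only on the metric in the domain -/

section Congruence

open smoothFun

variable {n : ℕ} {S : Set (Coord n)} {g g' : Coord n → Fin n → Fin n → ℝ}

theorem ginv_congr {x : Coord n} (h : g x = g' x) : ginv g x = ginv g' x := by
  funext a b; rw [ginv, ginv, h]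

theorem christoffel_congr (h : ∀ x ∈ S, g x = g' x) {x : Coord n} (hx : x ∈ S)
    (c a b : Fin n) : christoffel S g x c a b = christoffel S g' x c a b := by
  have hp : ∀ i a b, pd S (fun y => g y a b) x i = pd S (fun y => g' y a b) x i :=
    fun i a b => pd_congr (fun y hy => by rw [h y hy]) hx i
  simp only [christoffel, hp, ginv_congr (h x hx)]

theorem ricci_congr (h : ∀ x ∈ S, g x = g' x) {x : Coord n} (hx : x ∈ S) :
    ricci S g x = ricci S g' x := by
  funext b d
  have hp : ∀ i c a b, pd S (fun y => christoffel S g y c a b) x i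
      = pd S (fun y => christoffel S g' y c a b) x i :=
    fun i c a b => pd_congr (fun y hy => christoffel_congr h hy c a b) hx i
  simp only [ricci, riemannUp, hp, christoffel_congr h hx]

theorem scalarCurv_congr (h : ∀ x ∈ S, g x = g' x) {x : Coord n} (hx : x ∈ S) :
    scalarCurv S g x = scalarCurv S g' x := by
  simp only [scalarCurv, trace, ginv_congr (h x hx), ricci_congr h hx]

end Congruence

/-! ### Charts of the spacetime induced by boundary charts of the extension. -/

namespace IsConformalExtension

variable {N : Type*} [TopologicalSpace N] [ChartedSpace (Coord 4) N]
  {M : Type*} [TopologicalSpace M] [ChartedSpace (EuclideanHalfSpace 4) M] [IsManifold (𝓡∂ 4) ∞ M]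
  {Λ : ℝ} {q : ℕ} {gN TN : Tensor2 (𝓡 4) N} {φ : N → M}
  {g : Tensor2 (𝓡∂ 4) M} {Ω : M → ℝ} {τ : Tensor2 (𝓡∂ 4) M}
  {e : OpenPartialHomeomorph M (EuclideanHalfSpace 4)}

theorem isOpenEmbedding (h : IsConformalExtension Λ q gN TN φ g Ω τ) :
    Topology.IsOpenEmbedding φ where
  toIsEmbedding := h.embedding.isEmbedding
  isOpen_range := by
    rw [h.range_embedding, isOpen_compl_iff]
    exact ModelWithCorners.isClosed_boundary (n := ∞) (by simp)

theorem mem_range_of_mem_posPart (h : IsConformalExtension Λ q gN TN φ g Ω τ)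
    (he : e ∈ IsManifold.maximalAtlas (𝓡∂ 4) ∞ M) {x : Coord 4}
    (hx : x ∈ posPart (e.extend (𝓡∂ 4)).target) : (e.extend (𝓡∂ 4)).symm x ∈ range φ := by
  have hs : (e.extend (𝓡∂ 4)).symm x ∈ e.source := by
    have := (e.extend (𝓡∂ 4)).map_target hx.1
    rwa [e.extend_source] at this
  rw [h.range_embedding, mem_compl_iff, mem_boundary_iff he hs, (e.extend (𝓡∂ 4)).right_inv hx.1]
  exact hx.2.ne'

/-- The chart of the spacetime induced by a boundary chart of its conformal extension. -/
def chart [Nonempty N] (h : IsConformalExtension Λ q gN TN φ g Ω τ)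
    (he : e ∈ IsManifold.maximalAtlas (𝓡∂ 4) ∞ M) : OpenPartialHomeomorph N (Coord 4) where
  toFun p := e.extend (𝓡∂ 4) (φ p)
  invFun x := (h.isOpenEmbedding.toOpenPartialHomeomorph φ).symm ((e.extend (𝓡∂ 4)).symm x)
  source := φ ⁻¹' e.source
  target := posPart (e.extend (𝓡∂ 4)).target
  map_source' p hp := by
    have h1 : e.extend (𝓡∂ 4) (φ p) ∈ (e.extend (𝓡∂ 4)).target :=
      (e.extend (𝓡∂ 4)).map_source (by rw [e.extend_source]; exact hp)
    refine ⟨h1, ((isHalfDomain_extend_target e).nonneg h1).lt_of_ne fun h0 => ?_⟩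
    have h2 : φ p ∈ ((𝓡∂ 4).boundary M)ᶜ := h.range_embedding ▸ mem_range_self p
    exact h2 ((mem_boundary_iff he hp).mpr h0.symm)
  map_target' x hx := by
    rw [mem_preimage, h.isOpenEmbedding.toOpenPartialHomeomorph_right_inv φ
      (h.mem_range_of_mem_posPart he hx)]
    have := (e.extend (𝓡∂ 4)).map_target hx.1
    rwa [e.extend_source] at this
  left_inv' p hp := by
    rw [e.extend_left_inv hp, h.isOpenEmbedding.toOpenPartialHomeomorph_left_inv φ]
  right_inv' x hx := by
    rw [h.isOpenEmbedding.toOpenPartialHomeomorph_right_inv φ (h.mem_range_of_mem_posPart he hx),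
      (e.extend (𝓡∂ 4)).right_inv hx.1]
  open_source := e.open_source.preimage h.isOpenEmbedding.continuous
  open_target := (isHalfDomain_extend_target e).isOpen_posPart
  continuousOn_toFun := (e.continuousOn_extend (I := 𝓡∂ 4)).comp
    h.isOpenEmbedding.continuous.continuousOn fun p hp => by rw [e.extend_source]; exact hp
  continuousOn_invFun := by
    refine (h.isOpenEmbedding.toOpenPartialHomeomorph φ).continuousOn_symm.comp
      ((e.continuousOn_extend_symm (I := 𝓡∂ 4)).mono inter_subset_left) fun x hx => ?_
    rw [Topology.IsOpenEmbedding.toOpenPartialHomeomorph_target]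
    exact h.mem_range_of_mem_posPart he hx

section Chart

variable [Nonempty N] (h : IsConformalExtension Λ q gN TN φ g Ω τ)
  (he : e ∈ IsManifold.maximalAtlas (𝓡∂ 4) ∞ M)

theorem embedding_chart_symm {x : Coord 4} (hx : x ∈ posPart (e.extend (𝓡∂ 4)).target) :
    φ ((h.chart he).symm x) = (e.extend (𝓡∂ 4)).symm x :=
  h.isOpenEmbedding.toOpenPartialHomeomorph_right_inv φ (h.mem_range_of_mem_posPart he hx)

theorem chart_target : (h.chart he).target = posPart (e.extend (𝓡∂ 4)).target := rfl

/-- Smoothness of a continuous map into `N` can be tested after composition with the immersion `φ`,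
and that composite is the inverse of the boundary chart. -/
theorem contMDiffOn_chart_symm [IsManifold (𝓡 4) ∞ N] : ContMDiffOn (𝓡 4) (𝓡 4) ∞ (h.chart he).symm
    (posPart (e.extend (𝓡∂ 4)).target) := by
  intro x hx
  have hn := (isHalfDomain_extend_target e).isOpen_posPart.mem_nhds hx
  refine ContMDiffAt.contMDiffWithinAt ?_
  rw [ContMDiffAt.iff_comp_isImmersionAt (h.embedding.isImmersion.isImmersionAt _)]
  refine ⟨(h.chart he).symm.continuousAt hx, ?_⟩
  have h1 : ContMDiffAt (𝓡 4) (𝓡∂ 4) ∞ (e.extend (𝓡∂ 4)).symm x :=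
    (contMDiffOn_extend_symm_target he).contMDiffAt (Filter.mem_of_superset hn inter_subset_left)
  refine h1.congr_of_eventuallyEq ?_
  filter_upwards [hn] with y hy
  exact h.embedding_chart_symm he hy

theorem chart_mem_maximalAtlas [IsManifold (𝓡 4) ∞ N] : h.chart he ∈ IsManifold.maximalAtlas (𝓡 4) ∞ N := by
  refine (h.chart he).mem_maximalAtlas_of_contMDiffOn ?_ (h.contMDiffOn_chart_symm he)
  exact (e.contMDiffOn_extend he).comp h.embedding.contMDiff.contMDiffOn fun p hp => hp

theorem chart_extend_target :
    ((h.chart he).extend (𝓡 4)).target = posPart (e.extend (𝓡∂ 4)).target := by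
  simp only [mfld_simps, chart_target]

theorem mfderiv_coordVec [IsManifold (𝓡 4) ∞ N] {x : Coord 4} (hx : x ∈ posPart (e.extend (𝓡∂ 4)).target) (i : Fin 4) :
    (mfderiv (𝓡 4) (𝓡∂ 4) φ ((h.chart he).symm x) (coordVec (𝓡 4) (h.chart he) x i) : Coord 4)
      = (coordVec (𝓡∂ 4) e x i : Coord 4) := by
  set V := posPart (e.extend (𝓡∂ 4)).target with hV
  have hVo : IsOpen V := (isHalfDomain_extend_target e).isOpen_posPart
  have hu : UniqueMDiffWithinAt 𝓘(ℝ, Coord 4) V x := hVo.uniqueMDiffWithinAt hx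
  have h1 : MDifferentiableWithinAt 𝓘(ℝ, Coord 4) (𝓡 4) (h.chart he).symm V x :=
    (h.contMDiffOn_chart_symm he x hx).mdifferentiableWithinAt (by simp)
  have h2 : MDifferentiableAt (𝓡 4) (𝓡∂ 4) φ ((h.chart he).symm x) :=
    h.embedding.contMDiff.contMDiffAt.mdifferentiableAt (by simp)
  have h3 := mfderiv_comp_mfderivWithin x h2 h1 hu
  have h4 := mfderivWithin_congr_of_mem (I := 𝓘(ℝ, Coord 4)) (I' := 𝓡∂ 4)
    (f₁ := φ ∘ (h.chart he).symm) (f := (e.extend (𝓡∂ 4)).symm)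
    (fun y hy => h.embedding_chart_symm he hy) hx
  have h5 := mfderivWithin_subset (f := (e.extend (𝓡∂ 4)).symm) (I' := 𝓡∂ 4)
    (inter_subset_left : V ⊆ (e.extend (𝓡∂ 4)).target) hu
    ((contMDiffOn_extend_symm_target he x hx.1).mdifferentiableWithinAt (by simp))
  have h6 : coordVec (𝓡 4) (h.chart he) x i = mfderivWithin 𝓘(ℝ, Coord 4) (𝓡 4) (h.chart he).symm V x
      (EuclideanSpace.single i (1 : ℝ) : Coord 4) := by
    rw [hV, ← h.chart_extend_target he]
    rfl
  rw [h6]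
  exact (DFunLike.congr_fun h3 (EuclideanSpace.single i (1 : ℝ) : Coord 4)).symm.trans
    (DFunLike.congr_fun (h4.trans h5) (EuclideanSpace.single i (1 : ℝ) : Coord 4))

/-- Since `φ` sends coordinate vectors of the induced chart to those of `e`, a pullback relation
between tensors becomes an equality of components; it serves for the metric and the stress-energy
tensor alike. -/
theorem comp_chart [IsManifold (𝓡 4) ∞ N] {t : Tensor2 (𝓡 4) N} {s : Tensor2 (𝓡∂ 4) M} {f : M → ℝ}
    (ht : ∀ (p : N) (v w : TangentSpace (𝓡 4) p), t p v w =
      f (φ p) * s (φ p) (mfderiv (𝓡 4) (𝓡∂ 4) φ p v) (mfderiv (𝓡 4) (𝓡∂ 4) φ p w))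
    {x : Coord 4} (hx : x ∈ posPart (e.extend (𝓡∂ 4)).target) (i j : Fin 4) :
    comp (𝓡 4) (h.chart he) t x i j
      = f ((e.extend (𝓡∂ 4)).symm x) * comp (𝓡∂ 4) e s x i j := by
  -- The base points agree only propositionally, so vectors are compared in the common model space
  -- `Coord 4`, to which all tangent spaces reduce.
  have key : ∀ (p p' : M), p = p' → ∀ v v' w w' : Coord 4, v = v' → w = w' →
      f p * (s p : Coord 4 →L[ℝ] Coord 4 →L[ℝ] ℝ) v w
        = f p' * (s p' : Coord 4 →L[ℝ] Coord 4 →L[ℝ] ℝ) v' w' := by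
    rintro p _ rfl v _ w _ rfl rfl
    rfl
  exact (ht _ _ _).trans (key _ _ (h.embedding_chart_symm he hx) _ _ _ _
    (h.mfderiv_coordVec he hx i) (h.mfderiv_coordVec he hx j))

end Chart

/-- The coordinate representation of a conformal extension in a boundary chart. -/
theorem isBoundaryModel [IsManifold (𝓡 4) ∞ N] {r : ℕ}
    (h : IsConformalExtension Λ (r + 1) gN TN φ g Ω τ)
    (he : e ∈ IsManifold.maximalAtlas (𝓡∂ 4) ∞ M) :
    IsBoundaryModel (e.extend (𝓡∂ 4)).target (comp (𝓡∂ 4) e g)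
      (fun x => Ω ((e.extend (𝓡∂ 4)).symm x)) (comp (𝓡∂ 4) e τ) (Λ / 3) r where
  domain := isHalfDomain_extend_target e
  metric := isSmoothMetric_comp he h.lorentz
  smooth_σ := (h.smooth_Ω.comp_contMDiffOn (contMDiffOn_extend_symm_target he)).contDiffOn
  smooth_τ := h.smooth_τ e he
  l_pos := div_pos h.Λ_pos (by norm_num)
  σ_ne_zero x hx h0 := by
    have h1 := h.mem_range_of_mem_posPart he hx
    rw [h.range_embedding] at h1
    exact h1 ((h.zero_Ω _).mp h0)
  σ_eq_zero x hx h0 := by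
    have hs : (e.extend (𝓡∂ 4)).symm x ∈ e.source := by
      have := (e.extend (𝓡∂ 4)).map_target hx
      rwa [e.extend_source] at this
    rw [h.zero_Ω, mem_boundary_iff he hs, (e.extend (𝓡∂ 4)).right_inv hx, h0]
  einstein x hx a b := by
    -- The induced chart needs a point of `N`; the given interior point provides one.
    obtain ⟨p, -⟩ := h.mem_range_of_mem_posPart he hx
    have : Nonempty N := ⟨p⟩
    have hg : ∀ y ∈ posPart (e.extend (𝓡∂ 4)).target, comp (𝓡 4) (h.chart he) gN y
        = IsSmoothMetric.rescale (comp (𝓡∂ 4) e g) (fun x => Ω ((e.extend (𝓡∂ 4)).symm x)) y := fun y hy =>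
      funext fun i => funext fun j =>
        h.comp_chart he (f := fun p => (Ω p ^ 2)⁻¹) h.metric_eq hy i j
    have h1 := h.einstein (h.chart he) (h.chart_mem_maximalAtlas he) x
      (by rw [h.chart_extend_target he]; exact hx) a b
    rw [h.chart_extend_target he, ricci_congr hg hx, scalarCurv_congr hg hx, hg x hx,
      h.comp_chart he (f := fun p => Ω p ^ (r + 1)) h.stress_eq hx] at h1
    rw [← h1]
    ring

end IsConformalExtension

end AdS

end

/-! ### The theorem in a boundary chart. -/

theorem theorem2
    {N : Type*} [TopologicalSpace N] [ChartedSpace (AdS.Coord 4) N] [IsManifold (𝓡 4) ∞ N]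
    {M : Type*} [TopologicalSpace M] [ChartedSpace (EuclideanHalfSpace 4) M]
    [IsManifold (𝓡∂ 4) ∞ M]
    (Λ : ℝ) (q : ℕ) (hq : q = 1 ∨ q = 2)
    (gN TN : AdS.Tensor2 (𝓡 4) N) (φ : N → M)
    (g : AdS.Tensor2 (𝓡∂ 4) M) (Ω : M → ℝ) (τ : AdS.Tensor2 (𝓡∂ 4) M)
    (h : AdS.IsConformalExtension Λ q gN TN φ g Ω τ)
    (e : OpenPartialHomeomorph M (EuclideanHalfSpace 4))
    (he : e ∈ IsManifold.maximalAtlas (𝓡∂ 4) ∞ M)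
    (p : M) (hpe : p ∈ e.source) (hp : p ∈ (𝓡∂ 4).boundary M) :
    let S : Set (AdS.Coord 4) := (e.extend (𝓡∂ 4)).target
    let G := AdS.comp (𝓡∂ 4) e g
    let t := AdS.comp (𝓡∂ 4) e τ
    let σ : AdS.Coord 4 → ℝ := fun x => Ω ((e.extend (𝓡∂ 4)).symm x)
    let l : ℝ := Λ / 3
    let y : AdS.Coord 4 := e.extend (𝓡∂ 4) p
    let z : AdS.Coord 3 := AdS.bdryCoord y
    -- the Weyl tensor vanishes on the boundary
    (∀ a b c d : Fin 4, AdS.weyl S G y a b c d = 0) ∧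
    -- the tensor `τ^⊤_{an}` vanishes on the boundary for `q = 1`
    (q = 1 → ∀ a : Fin 4, AdS.stressNT S G σ l t y a = 0) ∧
    -- the fourth conformal fundamental form is `-λ A^⊤_{anb}`
    (∀ α β : Fin 3, AdS.fourthFF S G σ l z α β = -l * AdS.cottonN S G σ l z α β) ∧
    -- the divergence for `q = 1`; `j` exists, and the formula holds for each such `j`
    (q = 1 →
      (∃ j : AdS.Coord 4 → Fin 4 → ℝ, AdS.IsStressExpansion S G σ l t j y ∧
        ∃ U ∈ 𝓝[S] y, ∀ a : Fin 4, ContDiffOn ℝ ∞ (fun x => j x a) U) ∧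
      ∀ j : AdS.Coord 4 → Fin 4 → ℝ, AdS.IsStressExpansion S G σ l t j y →
        ∀ α : Fin 3, AdS.divFourthFF S G σ l z α =
          -l ^ 2 * j y α.succ
            + l ^ (3 / 2 : ℝ) / 3 *
              AdS.pd (AdS.bdryDom S) (fun z' => AdS.trace G t (AdS.slice z')) z α) ∧
    -- the divergence for `q = 2`
    (q = 2 → ∀ α : Fin 3,
      AdS.divFourthFF S G σ l z α = -l ^ 2 * AdS.stressNT S G σ l t y α.succ) := by
  intro S G t σ l y z
  have hyS : y ∈ S := (e.extend (𝓡∂ 4)).map_source (by rwa [e.extend_source])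
  have hy : AdS.slice z = y := AdS.slice_bdryCoord ((AdS.mem_boundary_iff he hpe).mp hp)
  have hz : z ∈ AdS.bdryDom S := by rw [AdS.bdryDom, mem_preimage, hy]; exact hyS
  rw [← hy]
  -- The models below use `r = q - 1`, so the cases are `r = 0` and `r = 1`.
  rcases hq with rfl | rfl
  · have hm : AdS.IsBoundaryModel S G σ t l 0 := h.isBoundaryModel he
    refine ⟨hm.weyl_bdry hz, fun _ => hm.stressNT_bdry_of_zero hz, hm.fourthFF_eq hz,
      fun _ => ⟨⟨hm.stressCoeff, hm.isStressExpansion_stressCoeff hz, ?_⟩,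
        fun j hj => hm.divFourthFF_of_zero hz hj⟩, fun h2 => absurd h2 (by norm_num)⟩
    obtain ⟨V, hV, -, -, hj⟩ := hm.exists_stressCoeff_contDiffOn hz
    exact ⟨V, hV, hj⟩
  · have hm : AdS.IsBoundaryModel S G σ t l 1 := h.isBoundaryModel he
    exact ⟨hm.weyl_bdry hz, fun h1 => absurd h1 (by norm_num), hm.fourthFF_eq hz,
      fun h1 => absurd h1 (by norm_num), fun _ => hm.divFourthFF_of_one hz⟩
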